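/- Let $\mathcal W=(M,\mathcal F_1,\dots,\mathcal F_n)$ be a regular $n$-web on a smooth manifold $M$ of dimension $m\ge 1$, that is, $n$ foliations with $\operatorname{codim}\bigcap_i T_x\mathcal F_i=\sum_i\operatorname{codim}T_x\mathcal F_i$ for all $x\in M$, and let $\operatorname{codim}\mathcal F_i=c_i$ with $\sum_{i=1}^n c_i=m$. Fix $p\in M$. A divergence-free $n$-web-germ $\mathcal W_\Omega$ with underlying web $\mathcal W$ is given by a germ at $p$ of a smooth nowhere-vanishing volume form $\Omega$. Two such germs $\mathcal W_\Omega,\mathcal W_{\Omega'}$ are equivalent if there is a diffeomorphism-germ $\varphi:(M,p)\to(M,p)$ which carries the leaves of each $\mathcal F_i$ to the leaves of $\mathcal F_{\sigma(i)}$, for some permutation $\sigma$, and satisfies $\varphi^*\Omega'=\Omega$. Put $m_i=\sum_{j<i}c_j$ and $\pi_i=\{m_i+1,\dots,m_{i+1}\}$, and write $k\sim l$ if $k,l$ lie in the same $\pi_i$. The standard web on $\mathbb R^m$ has the foliations $T\mathcal F_i=\bigcap_{k\in\pi_i}\ker dx_k$; put $T\mathcal F_i^c=\bigcap_{j\ne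 i}T\mathcal F_j=\operatorname{span}\{\partial/\partial x_k:k\in\pi_i\}$ and let $F_i$ be the leaf of $\mathcal F_i^c$ through $0$, i.e. the coordinate plane $\{x: x_k=0 \text{ for } k\notin\pi_i\}$. Let $\Lambda=dx_1\wedge\dots\wedge dx_m$. A chart $\psi$ of $M$ is $\mathcal W$-adapted at $x$ if $\psi(x)=0$, its image is an open box, and it carries the foliations of $\mathcal W$ (up to their ordering) to those of the standard web. The nonuniformity tensor $\mathcal K(\mathcal W_\Omega)$ is the symmetric $2$-tensor field given in any $\mathcal W$-adapted chart, in which $\Omega=h\,dx_1\wedge\dots\wedge dx_m$, by $\sum_{k\not\sim l}\frac{\partial^2\log |h|}{\partial x_k\partial x_l}\,dx_k\otimes dx_l$. A $\mathcal W$-adapted chart $\psi$ at $p$ is normalized for $\Omega$ if $(\psi^{-1})^*\Omega=\Lambda$ at all points of $\bigcup_iF_i$ near $0$. Let $\mathfrak G_{\mathcal W}$ be the set of diffeomorphism-germs $\varphi:(\mathbb R^m,0)\to(\mathbb R^m,0)$ which preserve the standard web (up to a permutation of its foliations) and satisfy $(\varphi^*\Lambda)_{|q}=\Lambda_{|q}$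 for all $q\in\bigcup_iF_i$ near $0$. Let $\mathcal T$ be the set of germs at $0$ of smooth covariant $2$-tensor fields $A$ on $\mathbb R^m$ such that 1. $A(X,Y)=A(Y,X)$ for all $X,Y$; 2. $A(X,Y)=0$ for $X,Y\in T\mathcal F_i^c$, $i=1,\dots,n$; 3. $X\,A(Y,Z)=Y\,A(X,Z)$ for constant vector fields $X\in T\mathcal F_i^c$, $Y\in T\mathcal F_j^c$, $Z\in T\mathcal F_k^c$ with $i\ne k$ and $j\ne k$ (equivalently, for the coordinate vector fields in these distributions). **Theorem.** $\mathfrak G_{\mathcal W}$ is a group under composition and acts on $\mathcal T$ by pullback. Each $\mathcal W_\Omega$ admits a normalized chart, and $(\psi^{-1})^*\mathcal K(\mathcal W_\Omega)\in\mathcal T$ for every normalized chart $\psi$. The map $$\mathcal W_\Omega\longmapsto \mathfrak G_{\mathcal W}\cdot(\psi^{-1})^*\mathcal K(\mathcal W_\Omega),\qquad \psi\text{ any normalized chart for }\Omega,$$ is well defined (independent of $\psi$) and induces a bijection between the set of equivalence classes of divergence-free $n$-web-germs at $p$ with underlying web $\mathcal W$ and the set of $\mathfrak G_{\mathcal W}$-orbits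 in $\mathcal T$. -/

import Mathlib

open Set Filter Topology
open scoped Manifold ContDiff

noncomputable section

namespace DivFreeWeb

/-! ### The model space and its standard web -/

/-- The coordinate space `ℝᵐ`, `m = c₁ + ⋯ + cₙ`, for a sequence of codimensions `c`. -/
abbrev Space {n : ℕ} (c : Fin n → ℕ) : Type := EuclideanSpace ℝ (Fin (∑ i, c i))

/-- The block `i` with `k ∈ πᵢ = {mᵢ + 1, …, mᵢ₊₁}`, where `mᵢ = c₁ + ⋯ + cᵢ₋₁`
(lexicographic numbering of the coordinates). -/
def block {n : ℕ} (c : Fin n → ℕ) (k : Fin (∑ i, c i)) : Fin n := (finSigmaFinEquiv.symm k).1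

/-- The coordinate vector `∂/∂xₖ`. -/
def ex {n : ℕ} (c : Fin n → ℕ) (k : Fin (∑ i, c i)) : Space c := EuclideanSpace.single k 1

/-- The coordinate covector `dxₖ`. -/
def dx {n : ℕ} (c : Fin n → ℕ) (k : Fin (∑ i, c i)) : Space c →ₗ[ℝ] ℝ :=
  (EuclideanSpace.proj k : Space c →L[ℝ] ℝ).toLinearMap

/-- The unit volume form `Λ = dx₁ ∧ ⋯ ∧ dxₘ`. -/
def unitVol {n : ℕ} (c : Fin n → ℕ) : Space c [⋀^Fin (∑ i, c i)]→ₗ[ℝ] ℝ :=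
  (EuclideanSpace.basisFun (Fin (∑ i, c i)) ℝ).toBasis.det

/-- The (constant) tangent space `T𝓕ᵢ = ⋂_{k ∈ πᵢ} ker dxₖ` of the `i`-th foliation of the
standard web. -/
def stdTangent {n : ℕ} (c : Fin n → ℕ) (i : Fin n) : Submodule ℝ (Space c) :=
  ⨅ k : {k // block c k = i}, LinearMap.ker (dx c k)

/-- The (constant) tangent space `T𝓕ᵢᶜ = ⋂_{j ≠ i} T𝓕ⱼ` of the `i`-th complementary foliation of
the standard web.  As a subset of `ℝᵐ` it is the leaf `Fᵢ` of `𝓕ᵢᶜ` through `0`. -/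
def stdCompl {n : ℕ} (c : Fin n → ℕ) (i : Fin n) : Submodule ℝ (Space c) :=
  ⨅ j : {j // j ≠ i}, stdTangent c j

/-! ### Regular webs on manifolds -/

section Web

variable {n : ℕ} {c : Fin n → ℕ} {M : Type*} [TopologicalSpace M] [ChartedSpace (Space c) M]

/-- `D` is the tangent distribution of a smooth foliation of codimension `k`: locally, the leaves
are the fibres of a smooth submersion to `ℝᵏ`. -/
def IsFoliation (k : ℕ) (D : ∀ x : M, Submodule ℝ (TangentSpace 𝓘(ℝ, Space c) x)) : Prop :=
  ∀ q : M, ∃ (U : Set M) (f : M → EuclideanSpace ℝ (Fin k)), IsOpen U ∧ q ∈ U ∧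
    ContMDiffOn 𝓘(ℝ, Space c) 𝓘(ℝ, EuclideanSpace ℝ (Fin k)) ∞ f U ∧
    ∀ x ∈ U,
      Function.Surjective (mfderiv 𝓘(ℝ, Space c) 𝓘(ℝ, EuclideanSpace ℝ (Fin k)) f x) ∧
      D x = LinearMap.ker
        (mfderiv 𝓘(ℝ, Space c) 𝓘(ℝ, EuclideanSpace ℝ (Fin k)) f x).toLinearMap

variable (c M) in
/-- A regular `n`-web on `M` with `codim 𝓕ᵢ = cᵢ` and `c₁ + ⋯ + cₙ = dim M`: `n` foliations, each
given by its tangent distribution, in general position. -/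
structure RegularWeb where
  tangent : Fin n → ∀ x : M, Submodule ℝ (TangentSpace 𝓘(ℝ, Space c) x)
  isFoliation : ∀ i, IsFoliation (c i) (tangent i)
  generalPosition : ∀ x : M,
    Module.finrank ℝ (TangentSpace 𝓘(ℝ, Space c) x ⧸ (⨅ i, tangent i x)) =
      ∑ i, Module.finrank ℝ (TangentSpace 𝓘(ℝ, Space c) x ⧸ tangent i x)

/-- `ψ` is a `W`-adapted chart centred at `x`: a smooth chart of `M` onto an open box, with
`ψ(x) = 0`, which carries the foliations to those of the standard web.  As webs are not
distinguished according to the ordering of their foliations, the foliation which corresponds to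
the `i`-th block of coordinates is `𝓕_{σ(i)}` for some permutation `σ` (necessarily with
`codim 𝓕_{σ(i)} = codim 𝓕ᵢ`). -/
structure IsAdapted (W : RegularWeb c M) (x : M) (ψ : OpenPartialHomeomorph M (Space c)) :
    Prop where
  mem_atlas : ψ ∈ IsManifold.maximalAtlas 𝓘(ℝ, Space c) ∞ M
  mem_source : x ∈ ψ.source
  map_point : ψ x = 0
  cubical : ∃ a b : Fin (∑ i, c i) → ℝ, ψ.target = {y | ∀ k, a k < y k ∧ y k < b k}
  straight : ∃ σ : Equiv.Perm (Fin n), ∀ y ∈ ψ.source, ∀ i,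
    W.tangent (σ i) y =
      (stdTangent c i).comap (mfderiv 𝓘(ℝ, Space c) 𝓘(ℝ, Space c) ψ y).toLinearMap

/-! ### Volume forms and the nonuniformity tensor -/

/-- The coordinate expression `(ψ⁻¹)^* Ω` of an `m`-form in a chart. -/
def coordForm (Ω : ∀ x : M, TangentSpace 𝓘(ℝ, Space c) x [⋀^Fin (∑ i, c i)]→ₗ[ℝ] ℝ)
    (ψ : OpenPartialHomeomorph M (Space c)) (y : Space c) :
    Space c [⋀^Fin (∑ i, c i)]→ₗ[ℝ] ℝ :=
  (Ω (ψ.symm y)).compLinearMap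
    (mfderiv 𝓘(ℝ, Space c) 𝓘(ℝ, Space c) ψ.symm y).toLinearMap

/-- The density `h` of `Ω = h(x) dx₁ ∧ ⋯ ∧ dxₘ` in a chart. -/
def density (Ω : ∀ x : M, TangentSpace 𝓘(ℝ, Space c) x [⋀^Fin (∑ i, c i)]→ₗ[ℝ] ℝ)
    (ψ : OpenPartialHomeomorph M (Space c)) (y : Space c) : ℝ :=
  coordForm Ω ψ y (ex c)

variable (c) in
/-- A representative of a germ at `p` of smooth nowhere-vanishing volume forms: it is smooth and
nonvanishing near `p`, its values elsewhere are irrelevant. -/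
structure VolumeForm (p : M) where
  toFun : ∀ x : M, TangentSpace 𝓘(ℝ, Space c) x [⋀^Fin (∑ i, c i)]→ₗ[ℝ] ℝ
  smooth : ∀ᶠ y in 𝓝 (chartAt (Space c) p p),
    ContDiffAt ℝ ∞ (density toFun (chartAt (Space c) p)) y
  ne_zero : ∀ᶠ x in 𝓝 p, toFun x ≠ 0

/-- The tensor `∑_{k ≁ l} ∂²(log h)/∂xₖ∂xₗ dxₖ dxₗ` at `y ∈ ℝᵐ`. -/
def mixedLogHessian (c : Fin n → ℕ) (h : Space c → ℝ) (y : Space c) :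
    LinearMap.BilinForm ℝ (Space c) :=
  ∑ k, ∑ l, (if block c k = block c l then 0
    else fderiv ℝ (fun z => fderiv ℝ (fun w => Real.log (h w)) z (ex c l)) y (ex c k)) •
      LinearMap.BilinForm.linMulLin (dx c k) (dx c l)

open Classical in
/-- The nonuniformity tensor field `𝒦(W_Ω)` on `M`.  At `x` it is given by
`∑_{k ≁ l} ∂²(log h)/∂xₖ∂xₗ dxₖ dxₗ` in a `W`-adapted chart centred at `x` (every such chart gives
the same value where `Ω` is smooth and nonzero). -/
def nonuniformity (W : RegularWeb c M)
    (Ω : ∀ x : M, TangentSpace 𝓘(ℝ, Space c) x [⋀^Fin (∑ i, c i)]→ₗ[ℝ] ℝ) (x : M) :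
    LinearMap.BilinForm ℝ (TangentSpace 𝓘(ℝ, Space c) x) :=
  if H : ∃ ψ, IsAdapted W x ψ then
    (mixedLogHessian c (density Ω H.choose) (H.choose x)).comp
      (mfderiv 𝓘(ℝ, Space c) 𝓘(ℝ, Space c) H.choose x).toLinearMap
      (mfderiv 𝓘(ℝ, Space c) 𝓘(ℝ, Space c) H.choose x).toLinearMap
  else 0

/-- The coordinate expression `(ψ⁻¹)^* 𝒦(W_Ω)` of the nonuniformity tensor in a chart. -/
def coordNonuniformity (W : RegularWeb c M)
    (Ω : ∀ x : M, TangentSpace 𝓘(ℝ, Space c) x [⋀^Fin (∑ i, c i)]→ₗ[ℝ] ℝ)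
    (ψ : OpenPartialHomeomorph M (Space c)) (y : Space c) : LinearMap.BilinForm ℝ (Space c) :=
  (nonuniformity W Ω (ψ.symm y)).comp
    (mfderiv 𝓘(ℝ, Space c) 𝓘(ℝ, Space c) ψ.symm y).toLinearMap
    (mfderiv 𝓘(ℝ, Space c) 𝓘(ℝ, Space c) ψ.symm y).toLinearMap

/-- `ψ` is a normalized `W_Ω`-adapted coordinate system centred at `p`: it is adapted, and
`Ω = Λ` along the germs at `p` of the leaves `Fᵢ ∋ p` of the complementary foliations `𝓕ᵢᶜ`. -/
def IsNormalized (W : RegularWeb c M) {p : M} (Ω : VolumeForm c p)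
    (ψ : OpenPartialHomeomorph M (Space c)) : Prop :=
  IsAdapted W p ψ ∧ ∀ᶠ y in 𝓝 (0 : Space c), ∀ i, y ∈ stdCompl c i →
    coordForm Ω.toFun ψ y = unitVol c

/-- Equivalence of the divergence-free web-germs `W_Ω` and `W_{Ω'}` at `p`: there is a
diffeomorphism-germ `φ : (M, p) → (M, p)` which carries the foliations of `W` to the foliations of
`W` up to a permutation and satisfies `φ^* Ω' = Ω`. -/
def WebEquiv (W : RegularWeb c M) {p : M} (Ω Ω' : VolumeForm c p) : Prop :=
  ∃ φ : OpenPartialHomeomorph M M, p ∈ φ.source ∧ φ p = p ∧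
    ContMDiffOn 𝓘(ℝ, Space c) 𝓘(ℝ, Space c) ∞ φ φ.source ∧
    ContMDiffOn 𝓘(ℝ, Space c) 𝓘(ℝ, Space c) ∞ φ.symm φ.target ∧
    (∃ σ : Equiv.Perm (Fin n), ∀ᶠ x in 𝓝 p, ∀ i,
      (W.tangent i x).map (mfderiv 𝓘(ℝ, Space c) 𝓘(ℝ, Space c) φ x).toLinearMap =
        W.tangent (σ i) (φ x)) ∧
    ∀ᶠ x in 𝓝 p,
      (Ω'.toFun (φ x)).compLinearMap
        (mfderiv 𝓘(ℝ, Space c) 𝓘(ℝ, Space c) φ x).toLinearMap = Ω.toFun x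

end Web

/-! ### The group and its action on tensor germs -/

/-- The group `𝔊_W` of coordinate transformation-germs `φ : (ℝᵐ, 0) → (ℝᵐ, 0)` (given by
representatives) which preserve the web and satisfy `φ^* Λ = Λ` at the points of the leaves
`Fᵢ ∋ 0` of the complementary foliations. -/
def webGroup {n : ℕ} (c : Fin n → ℕ) : Set (OpenPartialHomeomorph (Space c) (Space c)) :=
  {φ | 0 ∈ φ.source ∧ φ 0 = 0 ∧ ContDiffOn ℝ ∞ φ φ.source ∧ ContDiffOn ℝ ∞ φ.symm φ.target ∧
    (∃ σ : Equiv.Perm (Fin n), ∀ᶠ x in 𝓝 (0 : Space c), ∀ i,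
      (stdTangent c i).map (fderiv ℝ φ x).toLinearMap = stdTangent c (σ i)) ∧
    ∀ᶠ q in 𝓝 (0 : Space c), ∀ i, q ∈ stdCompl c i →
      (unitVol c).compLinearMap (fderiv ℝ φ q).toLinearMap = unitVol c}

/-- The pullback `φ^* A` of a covariant `2`-tensor field on `ℝᵐ`. -/
def pullback {n : ℕ} {c : Fin n → ℕ} (φ : Space c → Space c)
    (A : Space c → LinearMap.BilinForm ℝ (Space c)) (x : Space c) :
    LinearMap.BilinForm ℝ (Space c) :=
  (A (φ x)).comp (fderiv ℝ φ x).toLinearMap (fderiv ℝ φ x).toLinearMap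

/-- A representative of a germ at `0` of smooth covariant `2`-tensor fields on `ℝᵐ` satisfying the
identities of nonuniformity tensors with respect to the standard web.  In the third identity `X`,
`Y`, `Z` are constant vector fields, that is, combinations of coordinate fields with constant
coefficients. -/
structure NonuniformityTensor {n : ℕ} (c : Fin n → ℕ) where
  toFun : Space c → LinearMap.BilinForm ℝ (Space c)
  smooth : ∀ᶠ x in 𝓝 (0 : Space c), ∀ X Y, ContDiffAt ℝ ∞ (fun y => toFun y X Y) x
  symm : ∀ᶠ x in 𝓝 (0 : Space c), ∀ X Y, toFun x X Y = toFun x Y X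
  diag : ∀ᶠ x in 𝓝 (0 : Space c), ∀ i, ∀ X ∈ stdCompl c i, ∀ Y ∈ stdCompl c i, toFun x X Y = 0
  compat : ∀ᶠ x in 𝓝 (0 : Space c), ∀ i j k, i ≠ k → j ≠ k →
    ∀ X ∈ stdCompl c i, ∀ Y ∈ stdCompl c j, ∀ Z ∈ stdCompl c k,
      fderiv ℝ (fun y => toFun y Y Z) x X = fderiv ℝ (fun y => toFun y X Z) x Y

/-- `A` and `B` lie in the same orbit of the action of `𝔊_W` by pullback on tensor germs. -/
def SameOrbit {n : ℕ} {c : Fin n → ℕ} (A B : NonuniformityTensor c) : Prop :=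
  ∃ φ ∈ webGroup c, A.toFun =ᶠ[𝓝 0] pullback φ B.toFun

end DivFreeWeb

end

noncomputable section

namespace DivFreeWeb

/-! ### Smooth dependence of integrals on parameters -/

section Integrals

/-! The mixed part of the Hessian of a function-germ, i.e. the second derivatives in two directions
from different blocks, vanishes precisely when the function is a sum of functions of one block each.
Such a sum is determined by its restrictions to the leaves `Fᵢ`. So a function-germ is determined by
its mixed Hessian and its values on the leaves (`eventually_eq_zero_of_mixedHess_eq_zero`). The
theorem applies this principle to the logarithm of the density of `Ω`.

The mixed Hessian of the log-density is a tensor for changes of adapted coordinates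
(`mixedLogHessian_transform`). The derivative of a web-preserving map permutes the blocks, so its
mixed second derivatives vanish and the chain rule has no second-order remainder (`mixedHess_comp`).
Its Jacobian determinant is a product of factors depending on one block each, so the logarithm of
the determinant has zero mixed Hessian (`mixedHess_log_det`).

The three identities for tensors in `𝒯` are the integrability conditions for being a mixed Hessian.
For each `k`, the entries of `A` paired with `∂/∂xₖ` are integrated along the other blocks to a
function `b k`. The form `∑ b k dxₖ` is then closed, and its primitive `u` vanishes on the leaves
(`NonuniformityTensor.exists_potential`).

A chart is normalized by composing with a web-preserving map whose Jacobian equals the density along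
the leaves (`exists_webMap_with_det`). In normalized charts an equivalence of web-germs becomes an
element of `𝔊_W`, because both densities are `1` on the leaves. This gives both independence of the
chart and constancy on classes (`sameOrbit_of_webEquiv`). Injectivity is the uniqueness principle
for log-densities (`webEquiv_of_sameOrbit`), and the form with density `exp u` gives surjectivity
(`exists_volumeForm`). -/

theorem hasFDerivAt_intervalIntegral_of_contDiff {E F : Type*} [NormedAddCommGroup E]
    [NormedSpace ℝ E] [FiniteDimensional ℝ E] [NormedAddCommGroup F] [NormedSpace ℝ F]
    [CompleteSpace F] {f : E × ℝ → F} (hf : ContDiff ℝ 1 f) (x : E) :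
    HasFDerivAt (fun x => ∫ t in (0 : ℝ)..1, f (x, t))
      (∫ t in (0 : ℝ)..1, (fderiv ℝ f (x, t)).comp (ContinuousLinearMap.inl ℝ E ℝ)) x := by
  have hf' : Continuous (fun q : E × ℝ =>
      (fderiv ℝ f q).comp (ContinuousLinearMap.inl ℝ E ℝ)) :=
    (hf.continuous_fderiv (by simp)).clm_comp continuous_const
  -- Compactness gives a constant that dominates the derivative of the integrand near `x`, which is
  -- what differentiation under the integral needs.
  have hK : IsCompact (Metric.closedBall x 1 ×ˢ Icc (0 : ℝ) 1) :=
    (isCompact_closedBall x 1).prod isCompact_Icc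
  obtain ⟨C, hC⟩ := hK.exists_bound_of_continuousOn hf'.continuousOn
  refine intervalIntegral.hasFDerivAt_integral_of_dominated_of_fderiv_le
    (μ := MeasureTheory.volume) (bound := fun _ => C)
    (F' := fun x t => (fderiv ℝ f (x, t)).comp (ContinuousLinearMap.inl ℝ E ℝ))
    (Metric.ball_mem_nhds x one_pos) ?_ ?_ ?_ ?_ ?_ ?_
  · exact Eventually.of_forall fun y =>
      (hf.continuous.comp (by fun_prop : Continuous fun t : ℝ => (y, t))).aestronglyMeasurable
  · exact (hf.continuous.comp
      (by fun_prop : Continuous fun t : ℝ => (x, t))).intervalIntegrable _ _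
  · exact (hf'.comp (by fun_prop : Continuous fun t : ℝ => (x, t))).aestronglyMeasurable
  · refine Eventually.of_forall fun t ht y hy => hC (y, t) ⟨Metric.ball_subset_closedBall hy, ?_⟩
    rw [uIoc_of_le zero_le_one] at ht
    exact ⟨ht.1.le, ht.2⟩
  · exact intervalIntegrable_const
  · refine Eventually.of_forall fun t _ y _ => ?_
    have h1 := (hf.differentiable (by simp) (y, t)).hasFDerivAt
    have h2 : HasFDerivAt (fun y : E => (y, t)) (ContinuousLinearMap.inl ℝ E ℝ) y :=
      hasFDerivAt_prodMk_left y t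
    exact h1.comp y h2

/-- The derivative is again a parameter integral, but with values in `E →L[ℝ] F`. The induction on
`n` therefore quantifies over all targets `F`, and keeping everything in `Type` lets the new target
stay in the same universe. -/
theorem contDiff_intervalIntegral {E : Type} [NormedAddCommGroup E] [NormedSpace ℝ E]
    [FiniteDimensional ℝ E] (n : ℕ) : ∀ {F : Type} [NormedAddCommGroup F] [NormedSpace ℝ F]
    [CompleteSpace F] {f : E × ℝ → F}, ContDiff ℝ ∞ f →
    ContDiff ℝ n (fun x => ∫ t in (0 : ℝ)..1, f (x, t)) := by
  induction n with
  | zero =>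
    intro F _ _ _ f hf
    refine contDiff_zero.2 (continuous_iff_continuousAt.2 fun x => ?_)
    exact (hasFDerivAt_intervalIntegral_of_contDiff (hf.of_le (by simp)) x).continuousAt
  | succ n ih =>
    intro F _ _ _ f hf
    have hd := fun x => hasFDerivAt_intervalIntegral_of_contDiff (hf.of_le (by simp)) x
    rw [show ((n + 1 : ℕ) : WithTop ℕ∞) = (n : WithTop ℕ∞) + 1 by push_cast; rfl,
      contDiff_succ_iff_fderiv]
    refine ⟨fun x => (hd x).differentiableAt, by simp, ?_⟩
    rw [funext fun x => (hd x).fderiv]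
    refine ih (f := fun q => (fderiv ℝ f q).comp (ContinuousLinearMap.inl ℝ E ℝ)) ?_
    exact (hf.fderiv_right (by simp)).clm_comp contDiff_const

/-- Multiplication by a bump function. Germs are globalized so that the integrals below are defined
and smooth everywhere. -/
theorem exists_contDiff_eventuallyEq {E F : Type*} [NormedAddCommGroup E] [NormedSpace ℝ E]
    [FiniteDimensional ℝ E] [NormedAddCommGroup F] [NormedSpace ℝ F] {f : E → F} {x : E}
    (hf : ∀ᶠ y in 𝓝 x, ContDiffAt ℝ ∞ f y) : ∃ g : E → F, ContDiff ℝ ∞ g ∧ g =ᶠ[𝓝 x] f := by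
  obtain ⟨ε, hε, hball⟩ := Metric.eventually_nhds_iff_ball.1 hf
  let χ : ContDiffBump x := ⟨ε / 4, ε / 2, by linarith, by linarith⟩
  refine ⟨fun y => χ y • f y, contDiff_iff_contDiffAt.2 fun y => ?_, ?_⟩
  · by_cases hy : dist y x < ε
    · exact χ.contDiff.contDiffAt.smul (hball y hy)
    · have hy' : y ∉ tsupport χ := by
        rw [χ.tsupport_eq, Metric.mem_closedBall]
        change ¬ dist y x ≤ ε / 2
        linarith
      have : (fun y => χ y • f y) =ᶠ[𝓝 y] fun _ => 0 := by
        filter_upwards [(isClosed_tsupport χ).isOpen_compl.mem_nhds hy'] with z hz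
        rw [image_eq_zero_of_notMem_tsupport hz, zero_smul]
      exact contDiffAt_const.congr_of_eventuallyEq this
  · filter_upwards [χ.eventuallyEq_one] with y hy
    simp [hy]

/-- A form of Poincaré's lemma with parameters: a `1`-form which is closed along the fibres of the
projection `1 - Q` has a primitive along these fibres, vanishing where `Q x = 0`. -/
theorem exists_fiberwise_primitive {E : Type} [NormedAddCommGroup E] [NormedSpace ℝ E]
    [FiniteDimensional ℝ E] (Q : E →L[ℝ] E) (hQ : ∀ x, Q (Q x) = Q x) {α : E → E →L[ℝ] ℝ}
    (hα : ∀ᶠ x in 𝓝 (0 : E), ContDiffAt ℝ ∞ α x)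
    (hs : ∀ᶠ x in 𝓝 (0 : E), ∀ v w,
      fderiv ℝ α x (Q v) (Q w) = fderiv ℝ α x (Q w) (Q v)) :
    ∃ b : E → ℝ, ContDiff ℝ ∞ b ∧ (∀ᶠ x in 𝓝 0, ∀ v, fderiv ℝ b x (Q v) = α x (Q v)) ∧
      ∀ x, Q x = 0 → b x = 0 := by
  obtain ⟨β, hβ, hβα⟩ := exists_contDiff_eventuallyEq hα
  -- The segment from `x - Q x` to `x`, which stays in the fibre through `x`. The primitive is the
  -- integral of the form along it.
  let γ : E × ℝ → E := fun q => q.1 - Q q.1 + q.2 • Q q.1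
  have hγ : ContDiff ℝ ∞ γ := by fun_prop
  let f : E × ℝ → ℝ := fun q => β (γ q) (Q q.1)
  have hf : ContDiff ℝ ∞ f := (hβ.comp hγ).clm_apply (Q.contDiff.comp contDiff_fst)
  refine ⟨fun x => ∫ t in (0 : ℝ)..1, f (x, t),
    contDiff_infty.2 fun n => contDiff_intervalIntegral n hf, ?_, fun x hx => by simp [f, hx]⟩
  have hs' : ∀ᶠ x in 𝓝 (0 : E), ∀ v w,
      fderiv ℝ β x (Q v) (Q w) = fderiv ℝ β x (Q w) (Q v) := by
    filter_upwards [hs, hβα.eventuallyEq_nhds] with x hx hx'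
    rwa [hx'.fderiv_eq]
  -- Closedness is known only near `0`. By compactness of `[0, 1]` it holds along the whole segment
  -- once `x` is close to `0`.
  have htube : ∀ᶠ x in 𝓝 (0 : E), ∀ t ∈ Icc (0 : ℝ) 1, ∀ v w,
      fderiv ℝ β (γ (x, t)) (Q v) (Q w) = fderiv ℝ β (γ (x, t)) (Q w) (Q v) := by
    refine isCompact_Icc.eventually_forall_of_forall_eventually fun t _ => ?_
    have h0 : γ (0, t) = 0 := by simp [γ]
    have := hγ.continuous.continuousAt (x := ((0 : E), t))
    rw [ContinuousAt, h0] at this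
    exact this.eventually hs'
  filter_upwards [htube, hβα] with x hx hxα v
  rw [(hasFDerivAt_intervalIntegral_of_contDiff (hf.of_le (by simp)) x).fderiv]
  have hcont : Continuous fun t : ℝ =>
      (fderiv ℝ f (x, t)).comp (ContinuousLinearMap.inl ℝ E ℝ) :=
    ((hf.continuous_fderiv (by simp)).comp
      (by fun_prop : Continuous fun t : ℝ => (x, t))).clm_comp continuous_const
  rw [ContinuousLinearMap.intervalIntegral_apply (hcont.intervalIntegrable _ _)]
  have hline : ∀ t : ℝ, HasDerivAt (fun t : ℝ => γ (x, t)) (Q x) t := fun t => by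
    simpa [γ] using ((hasDerivAt_id t).smul_const (Q x)).const_add (x - Q x)
  -- Closedness turns the derivative of the integrand in the direction `Q v` into a total
  -- `t`-derivative, as `hint` shows. The integral then reduces to the boundary term at `t = 1`.
  have hprim : ∀ t : ℝ, HasDerivAt (fun t : ℝ => t * β (γ (x, t)) (Q v))
      (β (γ (x, t)) (Q v) + t * fderiv ℝ β (γ (x, t)) (Q x) (Q v)) t := fun t => by
    have h1 : HasDerivAt (fun t => β (γ (x, t))) (fderiv ℝ β (γ (x, t)) (Q x)) t :=
      ((hβ.differentiable (by simp) _).hasFDerivAt).comp_hasDerivAt t (hline t)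
    have h2 : HasDerivAt (fun t => β (γ (x, t)) (Q v)) (fderiv ℝ β (γ (x, t)) (Q x) (Q v)) t :=
      ((ContinuousLinearMap.apply ℝ ℝ (Q v)).hasFDerivAt).comp_hasDerivAt t h1
    have h3 := (hasDerivAt_id' t).mul h2
    rw [one_mul] at h3
    exact h3
  have hint : ∀ t ∈ uIcc (0 : ℝ) 1,
      (fderiv ℝ f (x, t)).comp (ContinuousLinearMap.inl ℝ E ℝ) (Q v) =
        β (γ (x, t)) (Q v) + t * fderiv ℝ β (γ (x, t)) (Q x) (Q v) := fun t ht => by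
    rw [uIcc_of_le zero_le_one] at ht
    have h1 : HasFDerivAt (fun y : E => f (y, t))
        ((fderiv ℝ f (x, t)).comp (ContinuousLinearMap.inl ℝ E ℝ)) x :=
      HasFDerivAt.comp (f := fun y : E => (y, t)) x
        (hf.differentiable (by simp) (x, t)).hasFDerivAt (hasFDerivAt_prodMk_left x t)
    have h2 : HasFDerivAt (fun y : E => γ (y, t)) (ContinuousLinearMap.id ℝ E - Q + t • Q) x :=
      (ContinuousLinearMap.id ℝ E - Q + t • Q).hasFDerivAt
    have h3 : HasFDerivAt (fun y : E => β (γ (y, t)))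
        ((fderiv ℝ β (γ (x, t))).comp (ContinuousLinearMap.id ℝ E - Q + t • Q)) x :=
      (hβ.differentiable (by simp) _).hasFDerivAt.comp x h2
    have h4 := h3.clm_apply (Q.hasFDerivAt (x := x))
    rw [h1.unique h4]
    simp only [add_apply, ContinuousLinearMap.comp_apply,
      ContinuousLinearMap.flip_apply, sub_apply, smul_apply,
      ContinuousLinearMap.id_apply, hQ, sub_self, zero_add, map_smul, smul_eq_mul]
    rw [hx t ht v x]
  rw [intervalIntegral.integral_congr hint,
    intervalIntegral.integral_eq_sub_of_hasDerivAt (fun t _ => hprim t) ?_]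
  · simp [γ, hxα]
  · refine Continuous.intervalIntegrable ?_ _ _
    have hγx : Continuous fun t : ℝ => γ (x, t) := hγ.continuous.comp (by fun_prop)
    have hb := hβ.continuous.comp hγx
    have hb' := (hβ.continuous_fderiv (by simp)).comp hγx
    exact (hb.clm_apply continuous_const).add
      (continuous_id.mul ((hb'.clm_apply continuous_const).clm_apply continuous_const))

end Integrals

/-! ### Linear algebra of the standard web -/

section LinearAlgebra

variable {n : ℕ} {c : Fin n → ℕ}

@[simp] theorem dx_apply (k : Fin (∑ i, c i)) (x : Space c) : dx c k x = x k := rfl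

theorem ex_apply (k l : Fin (∑ i, c i)) : ex c k l = if l = k then 1 else 0 := by
  simp [ex]

theorem basisFun_eq_ex (k : Fin (∑ i, c i)) :
    (EuclideanSpace.basisFun (Fin (∑ i, c i)) ℝ).toBasis k = ex c k := by
  simp [ex]

theorem sum_smul_ex (x : Space c) : ∑ k, x k • ex c k = x := by
  ext l
  simp [ex_apply, Finset.sum_apply]

theorem mem_stdTangent {i : Fin n} {x : Space c} :
    x ∈ stdTangent c i ↔ ∀ k, block c k = i → x k = 0 := by
  simp [stdTangent]

theorem mem_stdCompl {i : Fin n} {x : Space c} :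
    x ∈ stdCompl c i ↔ ∀ k, block c k ≠ i → x k = 0 := by
  simp only [stdCompl, Submodule.mem_iInf, Subtype.forall, mem_stdTangent]
  exact ⟨fun h k hk => h _ hk k rfl, fun h j hj k hk => h k (hk ▸ hj)⟩

theorem mem_stdTangent_of_mem_stdCompl {i j : Fin n} (hij : j ≠ i) {x : Space c}
    (hx : x ∈ stdCompl c i) : x ∈ stdTangent c j :=
  mem_stdTangent.2 fun k hk => mem_stdCompl.1 hx k (hk ▸ hij)

theorem ex_mem_stdCompl (k : Fin (∑ i, c i)) : ex c k ∈ stdCompl c (block c k) :=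
  mem_stdCompl.2 fun l hl => by
    rw [ex_apply, if_neg]
    rintro rfl
    exact hl rfl

theorem eq_zero_of_mem_stdCompl {i j : Fin n} (hij : i ≠ j) {x : Space c}
    (hi : x ∈ stdCompl c i) (hj : x ∈ stdCompl c j) : x = 0 := by
  ext k
  by_cases hk : block c k = i
  · exact mem_stdCompl.1 hj k (hk ▸ hij)
  · exact mem_stdCompl.1 hi k hk

/-- The projection of `ℝᵐ` onto the `i`-th block of coordinates. -/
def blockProj (c : Fin n → ℕ) (i : Fin n) : Space c →L[ℝ] Space c :=
  ∑ k, if block c k = i then (EuclideanSpace.proj k : Space c →L[ℝ] ℝ).smulRight (ex c k) else 0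

theorem blockProj_apply (i : Fin n) (x : Space c) (l : Fin (∑ i, c i)) :
    blockProj c i x l = if block c l = i then x l else 0 := by
  have h : blockProj c i x = ∑ k, if block c k = i then x k • ex c k else 0 := by
    rw [blockProj, sum_apply]
    refine Finset.sum_congr rfl fun k _ => ?_
    split_ifs <;> simp
  rw [h, WithLp.ofLp_sum, Finset.sum_apply, Finset.sum_eq_single l]
  · split_ifs <;> simp [ex_apply]
  · intro k _ hk
    split_ifs <;> simp [ex_apply, hk.symm]
  · simp

theorem blockProj_mem (i : Fin n) (x : Space c) : blockProj c i x ∈ stdCompl c i :=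
  mem_stdCompl.2 fun k hk => by rw [blockProj_apply, if_neg hk]

theorem blockProj_of_mem {i : Fin n} {x : Space c} (hx : x ∈ stdCompl c i) :
    blockProj c i x = x := by
  ext k
  rw [blockProj_apply]
  split_ifs with h
  · rfl
  · exact (mem_stdCompl.1 hx k h).symm

theorem blockProj_of_mem_of_ne {i j : Fin n} (hij : i ≠ j) {x : Space c}
    (hx : x ∈ stdCompl c i) : blockProj c j x = 0 := by
  ext k
  rw [blockProj_apply]
  split_ifs with h
  · exact mem_stdCompl.1 hx k (h ▸ hij.symm)
  · rfl

/-- The projection of `ℝᵐ` onto the blocks of coordinates other than the `i`-th one. -/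
def offProj (c : Fin n → ℕ) (i : Fin n) : Space c →L[ℝ] Space c :=
  ContinuousLinearMap.id ℝ (Space c) - blockProj c i

theorem offProj_def (i : Fin n) (x : Space c) : offProj c i x = x - blockProj c i x := rfl

theorem offProj_apply (i : Fin n) (x : Space c) (l : Fin (∑ i, c i)) :
    offProj c i x l = if block c l = i then 0 else x l := by
  rw [offProj_def, PiLp.sub_apply, blockProj_apply]
  split_ifs <;> simp

theorem offProj_offProj (i : Fin n) (x : Space c) :
    offProj c i (offProj c i x) = offProj c i x := by
  ext l
  simp only [offProj_apply]
  split_ifs <;> rfl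

theorem sub_offProj (i : Fin n) (x : Space c) : x - offProj c i x = blockProj c i x := by
  rw [offProj_def, sub_sub_cancel]

theorem offProj_ex {i : Fin n} {k : Fin (∑ i, c i)} (hk : block c k ≠ i) :
    offProj c i (ex c k) = ex c k := by
  rw [offProj_def, blockProj_of_mem_of_ne hk (ex_mem_stdCompl k), sub_zero]

theorem offProj_of_mem {i : Fin n} {x : Space c} (hx : x ∈ stdCompl c i) :
    offProj c i x = 0 := by
  rw [offProj_def, blockProj_of_mem hx, sub_self]

theorem map_offProj_eq_zero {F : Type*} [AddCommGroup F] [Module ℝ F] (f : Space c →ₗ[ℝ] F)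
    {i : Fin n} (h : ∀ k, block c k ≠ i → f (ex c k) = 0) (v : Space c) :
    f (offProj c i v) = 0 := by
  rw [← sum_smul_ex (offProj c i v), map_sum]
  refine Finset.sum_eq_zero fun k _ => ?_
  rw [map_smul, offProj_apply]
  split_ifs with hk
  · rw [zero_smul]
  · rw [h k hk, smul_zero]

theorem bilinForm_ext {A B : LinearMap.BilinForm ℝ (Space c)}
    (h : ∀ k l, A (ex c k) (ex c l) = B (ex c k) (ex c l)) : A = B :=
  (EuclideanSpace.basisFun (Fin (∑ i, c i)) ℝ).toBasis.ext fun k =>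
    (EuclideanSpace.basisFun (Fin (∑ i, c i)) ℝ).toBasis.ext fun l => by
      simpa only [basisFun_eq_ex] using h k l

end LinearAlgebra

/-! ### Mixed Hessians -/

section MixedHessian

variable {n : ℕ} {c : Fin n → ℕ}

/-- The tensor `∑_{k ≁ l} ∂²u/∂xₖ∂xₗ dxₖ dxₗ` at `y ∈ ℝᵐ`. -/
def mixedHess (c : Fin n → ℕ) (u : Space c → ℝ) (y : Space c) :
    LinearMap.BilinForm ℝ (Space c) :=
  ∑ k, ∑ l, (if block c k = block c l then 0
    else fderiv ℝ (fun z => fderiv ℝ u z (ex c l)) y (ex c k)) •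
      LinearMap.BilinForm.linMulLin (dx c k) (dx c l)

theorem mixedLogHessian_eq (h : Space c → ℝ) :
    mixedLogHessian c h = mixedHess c (fun w => Real.log (h w)) := rfl

theorem mixedHess_apply (u : Space c → ℝ) (y X Y : Space c) :
    mixedHess c u y X Y = ∑ k, ∑ l, (if block c k = block c l then 0
      else fderiv ℝ (fun z => fderiv ℝ u z (ex c l)) y (ex c k)) * (X k * Y l) := by
  simp only [mixedHess, LinearMap.sum_apply, LinearMap.smul_apply, dx_apply, smul_eq_mul,
    LinearMap.BilinForm.linMulLin_apply]

theorem mixedHess_ex (u : Space c → ℝ) (y : Space c) (k l : Fin (∑ i, c i)) :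
    mixedHess c u y (ex c k) (ex c l) = if block c k = block c l then 0
      else fderiv ℝ (fun z => fderiv ℝ u z (ex c l)) y (ex c k) := by
  rw [mixedHess_apply, Finset.sum_eq_single k, Finset.sum_eq_single l]
  · simp [ex_apply]
  · intro b _ hb
    simp [ex_apply, hb]
  · simp
  · intro b _ hb
    simp [ex_apply, hb]
  · simp

theorem mixedHess_congr {u v : Space c → ℝ} {y : Space c} (h : u =ᶠ[𝓝 y] v) :
    mixedHess c u y = mixedHess c v y := by
  refine bilinForm_ext fun k l => ?_
  rw [mixedHess_ex, mixedHess_ex]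
  have : (fun z => fderiv ℝ u z (ex c l)) =ᶠ[𝓝 y] fun z => fderiv ℝ v z (ex c l) := by
    filter_upwards [h.eventuallyEq_nhds] with z hz
    rw [hz.fderiv_eq]
  rw [this.fderiv_eq]

theorem fderiv_fderiv_apply {E F : Type*} [NormedAddCommGroup E] [NormedSpace ℝ E]
    [NormedAddCommGroup F] [NormedSpace ℝ F] {u : E → F} {y : E} (hu : ContDiffAt ℝ ∞ u y)
    (v w : E) : fderiv ℝ (fun z => fderiv ℝ u z v) y w = fderiv ℝ (fderiv ℝ u) y w v := by
  have h : DifferentiableAt ℝ (fderiv ℝ u) y :=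
    (hu.fderiv_right (m := 1) (by norm_cast)).differentiableAt (by simp)
  have := h.hasFDerivAt.clm_apply (hasFDerivAt_const v y)
  rw [this.fderiv]
  simp

theorem fderiv_fderiv_comm {E F : Type*} [NormedAddCommGroup E] [NormedSpace ℝ E]
    [NormedAddCommGroup F] [NormedSpace ℝ F] {u : E → F} {y : E} (hu : ContDiffAt ℝ ∞ u y)
    (v w : E) :
    fderiv ℝ (fun z => fderiv ℝ u z v) y w = fderiv ℝ (fun z => fderiv ℝ u z w) y v := by
  rw [fderiv_fderiv_apply hu, fderiv_fderiv_apply hu]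
  exact (hu.isSymmSndFDerivAt (by simp; norm_cast)).eq w v

theorem contDiffAt_fderiv_apply {E F : Type*} [NormedAddCommGroup E] [NormedSpace ℝ E]
    [NormedAddCommGroup F] [NormedSpace ℝ F] {u : E → F} {y : E} (hu : ContDiffAt ℝ ∞ u y)
    (v : E) : ContDiffAt ℝ ∞ (fun z => fderiv ℝ u z v) y :=
  (hu.fderiv_right (by simp)).clm_apply contDiffAt_const

/-- The entries deleted from the Hessian have both indices in one block, and there a coordinate of
`X` or of `Y` is zero. -/
theorem mixedHess_of_mem_of_ne {u : Space c → ℝ} {y : Space c} (hu : ContDiffAt ℝ ∞ u y)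
    {i j : Fin n} (hij : i ≠ j) {X Y : Space c} (hX : X ∈ stdCompl c i) (hY : Y ∈ stdCompl c j) :
    mixedHess c u y X Y = fderiv ℝ (fun z => fderiv ℝ u z Y) y X := by
  rw [mixedHess_apply, fderiv_fderiv_apply hu]
  conv_rhs => rw [← sum_smul_ex X, ← sum_smul_ex Y]
  simp only [map_sum, map_smul, sum_apply, smul_apply,
    smul_eq_mul, Finset.mul_sum]
  rw [Finset.sum_comm]
  refine Finset.sum_congr rfl fun l _ => Finset.sum_congr rfl fun k _ => ?_
  rw [fderiv_fderiv_apply hu]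
  split_ifs with hkl
  · by_cases hk : block c k = i
    · rw [mem_stdCompl.1 hY l (by rw [← hkl, hk]; exact hij)]
      simp
    · rw [mem_stdCompl.1 hX k hk]
      simp
  · ring

theorem mixedHess_of_mem {u : Space c → ℝ} {y : Space c} {i : Fin n} {X Y : Space c}
    (hX : X ∈ stdCompl c i) (hY : Y ∈ stdCompl c i) : mixedHess c u y X Y = 0 := by
  rw [mixedHess_apply]
  refine Finset.sum_eq_zero fun k _ => Finset.sum_eq_zero fun l _ => ?_
  by_cases hk : block c k = i
  · by_cases hl : block c l = i
    · rw [if_pos (hk.trans hl.symm), zero_mul]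
    · rw [mem_stdCompl.1 hY l hl]
      simp
  · rw [mem_stdCompl.1 hX k hk]
    simp

theorem mixedHess_symm {u : Space c → ℝ} {y : Space c} (hu : ContDiffAt ℝ ∞ u y) (X Y : Space c) :
    mixedHess c u y X Y = mixedHess c u y Y X := by
  rw [mixedHess_apply, mixedHess_apply, Finset.sum_comm]
  refine Finset.sum_congr rfl fun k _ => Finset.sum_congr rfl fun l _ => ?_
  rw [fderiv_fderiv_comm hu]
  simp only [eq_comm, mul_comm]

/-- The mixed Hessian of a function-germ satisfies the identities of nonuniformity tensors. -/
def NonuniformityTensor.ofPotential (u : Space c → ℝ)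
    (hu : ∀ᶠ x in 𝓝 (0 : Space c), ContDiffAt ℝ ∞ u x) : NonuniformityTensor c where
  toFun := mixedHess c u
  smooth := by
    filter_upwards [hu] with x hx X Y
    simp only [mixedHess_apply]
    refine ContDiffAt.sum fun k _ => ContDiffAt.sum fun l _ => ContDiffAt.mul ?_ contDiffAt_const
    split_ifs
    · exact contDiffAt_const
    · exact contDiffAt_fderiv_apply (contDiffAt_fderiv_apply hx _) _
  symm := hu.mono fun x hx X Y => mixedHess_symm hx X Y
  diag := Eventually.of_forall fun x i X hX Y hY => mixedHess_of_mem hX hY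
  compat := by
    filter_upwards [hu.eventually_nhds] with x hx i j k hik hjk X hX Y hY Z hZ
    have h1 : ∀ {l : Fin n} {V : Space c}, l ≠ k → V ∈ stdCompl c l →
        (fun y => mixedHess c u y V Z) =ᶠ[𝓝 x] fun y => fderiv ℝ (fun z => fderiv ℝ u z Z) y V :=
      fun hl hV => hx.mono fun y hy => mixedHess_of_mem_of_ne hy hl hV hZ
    rw [(h1 hjk hY).fderiv_eq, (h1 hik hX).fderiv_eq]
    exact fderiv_fderiv_comm (contDiffAt_fderiv_apply hx.self_of_nhds Z) Y X

/-- A function whose derivatives along the fibres of `1 - Q` vanish is constant along them. -/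
theorem eventually_eq_of_fderiv_comp_eq_zero {E : Type*} [NormedAddCommGroup E] [NormedSpace ℝ E]
    (Q : E →L[ℝ] E) {f : E → ℝ}
    (hf : ∀ᶠ x in 𝓝 (0 : E), DifferentiableAt ℝ f x)
    (h : ∀ᶠ x in 𝓝 (0 : E), ∀ v, fderiv ℝ f x (Q v) = 0) :
    ∀ᶠ x in 𝓝 (0 : E), f x = f (x - Q x) := by
  let γ : E × ℝ → E := fun q => q.1 - Q q.1 + q.2 • Q q.1
  have hγ : Continuous γ := by fun_prop
  have htube : ∀ᶠ x in 𝓝 (0 : E), ∀ t ∈ Icc (0 : ℝ) 1,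
      DifferentiableAt ℝ f (γ (x, t)) ∧ ∀ v, fderiv ℝ f (γ (x, t)) (Q v) = 0 := by
    refine isCompact_Icc.eventually_forall_of_forall_eventually fun t _ => ?_
    have h0 : γ (0, t) = 0 := by simp [γ]
    have := hγ.continuousAt (x := ((0 : E), t))
    rw [ContinuousAt, h0] at this
    exact this.eventually (hf.and h)
  filter_upwards [htube] with x hx
  have hline : ∀ t : ℝ, HasDerivAt (fun t : ℝ => γ (x, t)) (Q x) t := fun t => by
    simpa [γ] using ((hasDerivAt_id t).smul_const (Q x)).const_add (x - Q x)
  have hd : ∀ t ∈ Icc (0 : ℝ) 1, HasDerivAt (fun t => f (γ (x, t))) 0 t := fun t ht => by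
    have := (hx t ht).1.hasFDerivAt.comp_hasDerivAt t (hline t)
    rwa [(hx t ht).2 x] at this
  have := constant_of_has_deriv_right_zero
    (fun t ht => (hd t ht).continuousAt.continuousWithinAt)
    (fun t ht => (hd t ⟨ht.1, ht.2.le⟩).hasDerivWithinAt) 1 (by simp)
  simpa [γ] using this

/-- The derivative of a function vanishing along `Fᵢ` vanishes in the directions of `Fᵢ`. -/
theorem fderiv_eq_zero_of_mem_stdCompl {f : Space c → ℝ} {i : Fin n} {x v : Space c}
    (hf : ∀ᶠ y in 𝓝 x, y ∈ stdCompl c i → f y = 0) (hd : DifferentiableAt ℝ f x)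
    (hx : x ∈ stdCompl c i) (hv : v ∈ stdCompl c i) : fderiv ℝ f x v = 0 := by
  have hline : HasDerivAt (fun t : ℝ => x + t • v) v 0 := by
    simpa using ((hasDerivAt_id (0 : ℝ)).smul_const v).const_add x
  have h1 : HasDerivAt (fun t : ℝ => f (x + t • v)) (fderiv ℝ f x v) 0 := by
    refine HasFDerivAt.comp_hasDerivAt (0 : ℝ) ?_ hline
    simpa using hd.hasFDerivAt
  have h2 : (fun t : ℝ => f (x + t • v)) =ᶠ[𝓝 0] fun _ => 0 := by
    have hc : Tendsto (fun t : ℝ => x + t • v) (𝓝 0) (𝓝 x) := by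
      simpa using hline.continuousAt.tendsto
    filter_upwards [hc.eventually hf] with t ht
    exact ht ((stdCompl c i).add_mem hx ((stdCompl c i).smul_mem t hv))
  exact (h1.congr_of_eventuallyEq h2.symm).unique (hasDerivAt_const 0 0)

/-- A function-germ is determined by its mixed Hessian and its values along the leaves `Fᵢ`. -/
theorem eventually_eq_zero_of_mixedHess_eq_zero (hm : 0 < ∑ i, c i) {w : Space c → ℝ}
    (hw : ∀ᶠ x in 𝓝 (0 : Space c), ContDiffAt ℝ ∞ w x)
    (hH : ∀ᶠ x in 𝓝 (0 : Space c), mixedHess c w x = 0)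
    (h0 : ∀ᶠ x in 𝓝 (0 : Space c), ∀ i, x ∈ stdCompl c i → w x = 0) :
    ∀ᶠ x in 𝓝 (0 : Space c), w x = 0 := by
  have hdiff : ∀ᶠ x in 𝓝 (0 : Space c), DifferentiableAt ℝ w x :=
    hw.mono fun x hx => hx.differentiableAt (by simp)
  -- Since the mixed Hessian vanishes, `∂w/∂xₗ` does not depend on the other blocks, so it may be
  -- evaluated at the projection to the leaf of the block of `l`. There it is a tangential
  -- derivative of a function that vanishes on the leaf.
  have hpart : ∀ l, ∀ᶠ x in 𝓝 (0 : Space c), fderiv ℝ w x (ex c l) = 0 := by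
    intro l
    have hconst := eventually_eq_of_fderiv_comp_eq_zero (offProj c (block c l))
      (f := fun x => fderiv ℝ w x (ex c l))
      (hw.mono fun x hx => (contDiffAt_fderiv_apply hx _).differentiableAt (by simp))
      (by
        filter_upwards [hH] with x hx v
        refine map_offProj_eq_zero
          (fderiv ℝ (fun x => fderiv ℝ w x (ex c l)) x).toLinearMap (fun k hk => ?_) v
        have := mixedHess_ex w x k l
        rw [hx, if_neg hk] at this
        simpa using this.symm)
    have hP : Tendsto (blockProj c (block c l)) (𝓝 0) (𝓝 0) := by
      simpa using (blockProj c (block c l)).continuous.tendsto 0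
    filter_upwards [hconst, hP.eventually hdiff, hP.eventually h0.eventually_nhds]
      with x hx hxd hx0
    rw [hx, sub_offProj]
    exact fderiv_eq_zero_of_mem_stdCompl (hx0.mono fun y hy => hy _) hxd
      (blockProj_mem _ _) (ex_mem_stdCompl l)
  have hfd : ∀ᶠ x in 𝓝 (0 : Space c), ∀ v, fderiv ℝ w x (ContinuousLinearMap.id ℝ _ v) = 0 := by
    filter_upwards [eventually_all.2 hpart] with x hx v
    rw [ContinuousLinearMap.id_apply, ← sum_smul_ex v, map_sum]
    exact Finset.sum_eq_zero fun l _ => by rw [map_smul, hx l, smul_zero]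
  filter_upwards [eventually_eq_of_fderiv_comp_eq_zero _ hdiff hfd] with x hx
  rw [hx]
  -- Every leaf passes through `0`; positive dimension supplies an index for one of them.
  simpa using h0.self_of_nhds (block c ⟨0, hm⟩) (by simp)

end MixedHessian

/-! ### Integrating a nonuniformity tensor to a potential -/

section Potential

variable {n : ℕ} {c : Fin n → ℕ}

theorem hasFDerivAt_sum_smul_proj {a : Fin (∑ i, c i) → Space c → ℝ} {x : Space c}
    (ha : ∀ l, DifferentiableAt ℝ (a l) x) (v w : Space c) :
    fderiv ℝ (fun y => ∑ l, a l y • (EuclideanSpace.proj l : Space c →L[ℝ] ℝ)) x v w =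
      ∑ l, fderiv ℝ (a l) x v * w l := by
  have := HasFDerivAt.fun_sum (u := Finset.univ) fun l _ =>
    (ha l).hasFDerivAt.smul_const (EuclideanSpace.proj l : Space c →L[ℝ] ℝ)
  rw [this.fderiv]
  simp [sum_apply]

/-- Closedness of the form `∑ aₗ dxₗ`, tested on `v` and `w`. The cross-derivative condition is
needed only on the supports of the two vectors, so that forms closed merely along some of the blocks
are covered. -/
theorem sum_fderiv_mul_comm {a : Fin (∑ i, c i) → Space c → ℝ} {x v w : Space c}
    (h : ∀ j l, v j ≠ 0 → w l ≠ 0 →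
      fderiv ℝ (a l) x (ex c j) = fderiv ℝ (a j) x (ex c l)) :
    ∑ l, fderiv ℝ (a l) x v * w l = ∑ l, fderiv ℝ (a l) x w * v l := by
  have key : ∀ v w : Space c, ∑ l, fderiv ℝ (a l) x v * w l =
      ∑ l, ∑ j, v j * w l * fderiv ℝ (a l) x (ex c j) := by
    intro v w
    refine Finset.sum_congr rfl fun l _ => ?_
    conv_lhs => rw [← sum_smul_ex v]
    rw [map_sum, Finset.sum_mul]
    refine Finset.sum_congr rfl fun j _ => ?_
    rw [map_smul, smul_eq_mul]
    ring
  rw [key, key, Finset.sum_comm]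
  refine Finset.sum_congr rfl fun j _ => Finset.sum_congr rfl fun l _ => ?_
  by_cases hv : v j = 0
  · simp [hv]
  by_cases hw : w l = 0
  · simp [hw]
  rw [h j l hv hw]
  ring

variable (A : NonuniformityTensor c)

/-- The partial derivative along `xₖ` of a potential of a nonuniformity tensor. -/
theorem NonuniformityTensor.exists_partial_potential (k : Fin (∑ i, c i)) :
    ∃ b : Space c → ℝ, ContDiff ℝ ∞ b ∧
      (∀ᶠ x in 𝓝 (0 : Space c), ∀ l, block c l ≠ block c k →
        fderiv ℝ b x (ex c l) = A.toFun x (ex c l) (ex c k)) ∧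
      ∀ x ∈ stdCompl c (block c k), b x = 0 := by
  -- For fixed `k`, `compat` says exactly that the form with these coefficients is closed along the
  -- blocks not containing `k`.
  let a : Fin (∑ i, c i) → Space c → ℝ := fun l x => A.toFun x (ex c l) (ex c k)
  obtain ⟨b, hb, hb', hb0⟩ := exists_fiberwise_primitive (offProj c (block c k))
    (offProj_offProj _)
    (α := fun x => ∑ l, a l x • (EuclideanSpace.proj l : Space c →L[ℝ] ℝ))
    (by
      filter_upwards [A.smooth] with x hx
      exact ContDiffAt.sum fun l _ => (hx _ _).smul contDiffAt_const)
    (by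
      filter_upwards [A.smooth, A.compat] with x hx hc v w
      have hd : ∀ l, DifferentiableAt ℝ (a l) x :=
        fun l => (hx (ex c l) (ex c k)).differentiableAt (by simp)
      rw [hasFDerivAt_sum_smul_proj hd, hasFDerivAt_sum_smul_proj hd]
      refine sum_fderiv_mul_comm fun j l hj hl => ?_
      rw [offProj_apply] at hj hl
      exact hc _ _ _ (fun h => hj (if_pos h)) (fun h => hl (if_pos h)) _ (ex_mem_stdCompl j) _
        (ex_mem_stdCompl l) _ (ex_mem_stdCompl k))
  refine ⟨b, hb, ?_, fun x hx => hb0 x (offProj_of_mem hx)⟩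
  filter_upwards [hb'] with x hx l hl
  have := hx (ex c l)
  rw [offProj_ex hl] at this
  rw [this, sum_apply, Finset.sum_eq_single l]
  · simp [ex_apply, a]
  · intro j _ hj
    simp [ex_apply, hj]
  · simp

/-- Every nonuniformity tensor is the mixed Hessian of a function which vanishes along the
leaves `Fᵢ`. -/
theorem NonuniformityTensor.exists_potential :
    ∃ u : Space c → ℝ, ContDiff ℝ ∞ u ∧ A.toFun =ᶠ[𝓝 0] mixedHess c u ∧
      ∀ᶠ x in 𝓝 (0 : Space c), ∀ i, x ∈ stdCompl c i → u x = 0 := by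
  choose b hb hbA hb0 using A.exists_partial_potential
  have hbA' := eventually_all.2 hbA
  -- For indices in different blocks this is the symmetry of `A`. Within one block, `compat` shows
  -- that the difference of the two sides is constant along the other blocks. It vanishes on the
  -- leaf of that block, where `b k` and `b l` are identically zero.
  have hcomm : ∀ k l, ∀ᶠ x in 𝓝 (0 : Space c),
      fderiv ℝ (b l) x (ex c k) = fderiv ℝ (b k) x (ex c l) := by
    intro k l
    by_cases hkl : block c k = block c l
    · let f : Space c → ℝ := fun x => fderiv ℝ (b l) x (ex c k) - fderiv ℝ (b k) x (ex c l)
      have hsm : ∀ k l, ContDiff ℝ ∞ fun x => fderiv ℝ (b l) x (ex c k) := fun k l =>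
        contDiff_iff_contDiffAt.2 fun x => contDiffAt_fderiv_apply (hb l).contDiffAt _
      have hsd : ∀ k l x, DifferentiableAt ℝ (fun x => fderiv ℝ (b l) x (ex c k)) x :=
        fun k l x => (hsm k l).differentiable (by simp) x
      have hf : Differentiable ℝ f := fun x => (hsd k l x).sub (hsd l k x)
      have hconst := eventually_eq_of_fderiv_comp_eq_zero (offProj c (block c k)) (f := f)
        (Eventually.of_forall fun x => hf x)
        (by
          filter_upwards [hbA'.eventually_nhds, A.compat, A.symm.eventually_nhds]
            with x hx hc hs v
          refine map_offProj_eq_zero (fderiv ℝ f x).toLinearMap (fun j hj => ?_) v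
          have hpart : ∀ r s, block c r = block c k → block c s = block c k →
              fderiv ℝ (fun x => fderiv ℝ (b r) x (ex c s)) x (ex c j) =
                fderiv ℝ (fun y => A.toFun y (ex c r) (ex c j)) x (ex c s) := by
            intro r s hr _
            rw [fderiv_fderiv_comm (hb r).contDiffAt]
            have : (fun x => fderiv ℝ (b r) x (ex c j)) =ᶠ[𝓝 x]
                fun y => A.toFun y (ex c r) (ex c j) := by
              filter_upwards [hx, hs] with y hy hsy
              rw [hy r j (by rw [hr]; exact hj), hsy]
            rw [this.fderiv_eq]
          have hfd : fderiv ℝ f x = fderiv ℝ (fun x => fderiv ℝ (b l) x (ex c k)) x -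
              fderiv ℝ (fun x => fderiv ℝ (b k) x (ex c l)) x :=
            fderiv_sub (hsd k l x) (hsd l k x)
          rw [hfd]
          change fderiv ℝ (fun x => fderiv ℝ (b l) x (ex c k)) x (ex c j) -
              fderiv ℝ (fun x => fderiv ℝ (b k) x (ex c l)) x (ex c j) = 0
          rw [hpart l k hkl.symm rfl, hpart k l rfl hkl.symm, sub_eq_zero]
          exact hc _ _ _ (Ne.symm hj) (by rw [← hkl]; exact Ne.symm hj) _ (ex_mem_stdCompl k) _
            (ex_mem_stdCompl l) _ (ex_mem_stdCompl j))
      have hzero : ∀ r s, block c r = block c k → block c s = block c k → ∀ x,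
          fderiv ℝ (b r) (blockProj c (block c k) x) (ex c s) = 0 := fun r s hr hs x =>
        fderiv_eq_zero_of_mem_stdCompl (i := block c k)
          (Eventually.of_forall fun y hy => hb0 r y (hr ▸ hy))
          ((hb r).differentiable (by simp) _) (blockProj_mem _ _) (hs ▸ ex_mem_stdCompl s)
      filter_upwards [hconst] with x hx
      rw [sub_offProj] at hx
      have h0 : f x = 0 := by
        rw [hx]
        simp only [f]
        rw [hzero l k hkl.symm rfl, hzero k l rfl hkl.symm, sub_self]
      exact sub_eq_zero.1 h0
    · filter_upwards [hbA', A.symm] with x hx hs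
      rw [hx l k hkl, hx k l (Ne.symm hkl), hs]
  have hcomm' : ∀ᶠ x in 𝓝 (0 : Space c), ∀ k l,
      fderiv ℝ (b l) x (ex c k) = fderiv ℝ (b k) x (ex c l) :=
    eventually_all.2 fun k => eventually_all.2 fun l => hcomm k l
  obtain ⟨u, hu, hu', hu0⟩ := exists_fiberwise_primitive (ContinuousLinearMap.id ℝ (Space c))
    (fun _ => rfl) (α := fun x => ∑ l, b l x • (EuclideanSpace.proj l : Space c →L[ℝ] ℝ))
    (Eventually.of_forall fun x =>
      ContDiffAt.sum fun l _ => (hb l).contDiffAt.smul contDiffAt_const)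
    (by
      filter_upwards [hcomm'] with x hx v w
      have hd : ∀ l, DifferentiableAt ℝ (b l) x := fun l => (hb l).differentiable (by simp) x
      rw [hasFDerivAt_sum_smul_proj hd, hasFDerivAt_sum_smul_proj hd]
      exact sum_fderiv_mul_comm fun j l _ _ => hx j l)
  have hpart : ∀ᶠ x in 𝓝 (0 : Space c), ∀ v, fderiv ℝ u x v = ∑ l, b l x * v l := by
    filter_upwards [hu'] with x hx v
    simpa [sum_apply] using hx v
  have hpart_ex : ∀ᶠ x in 𝓝 (0 : Space c), ∀ l, fderiv ℝ u x (ex c l) = b l x := by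
    filter_upwards [hpart] with x hx l
    rw [hx, Finset.sum_eq_single l]
    · simp [ex_apply]
    · intro j _ hj
      simp [ex_apply, hj]
    · simp
  refine ⟨u, hu, ?_, ?_⟩
  · filter_upwards [hpart_ex.eventually_nhds, hbA', A.diag] with x hx hxA hd
    refine bilinForm_ext fun k l => ?_
    rw [mixedHess_ex]
    split_ifs with hkl
    · exact hd _ _ (ex_mem_stdCompl k) _ (hkl ▸ ex_mem_stdCompl l)
    · have : (fun z => fderiv ℝ u z (ex c l)) =ᶠ[𝓝 x] b l := hx.mono fun y hy => hy l
      rw [this.fderiv_eq, hxA l k hkl]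
  · refine eventually_all.2 fun i => ?_
    have hP : Tendsto (blockProj c i) (𝓝 0) (𝓝 0) := by
      simpa using (blockProj c i).continuous.tendsto 0
    have hd : ∀ x, HasFDerivAt (fun x => u (blockProj c i x))
        ((fderiv ℝ u (blockProj c i x)).comp (blockProj c i)) x := fun x =>
      (hu.differentiable (by simp) _).hasFDerivAt.comp x (blockProj c i).hasFDerivAt
    -- The differential of `u` along the leaf has the coefficients `b l` with `l` in block `i`, and
    -- these vanish there. So `u` is constant on the leaf and equals its value at `0`.
    have := eventually_eq_of_fderiv_comp_eq_zero (ContinuousLinearMap.id ℝ (Space c))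
      (f := fun x => u (blockProj c i x)) (Eventually.of_forall fun x => (hd x).differentiableAt)
      (by
        filter_upwards [hP.eventually hpart] with x hx v
        rw [(hd x).fderiv, ContinuousLinearMap.comp_apply, hx]
        refine Finset.sum_eq_zero fun l _ => ?_
        by_cases hl : block c l = i
        · rw [hb0 l _ (hl ▸ blockProj_mem _ _), zero_mul]
        · rw [blockProj_apply, if_neg hl, mul_zero])
    filter_upwards [this] with x hx hxi
    rw [blockProj_of_mem hxi] at hx
    rw [hx]
    exact hu0 _ (by simp)

end Potential

/-! ### Maps preserving the standard web -/

section WebMaps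

variable {n : ℕ} {c : Fin n → ℕ}

theorem det_eq_matrix_det (f : Space c →L[ℝ] Space c) :
    f.det = Matrix.det (Matrix.of fun k l => f (ex c l) k) := by
  rw [ContinuousLinearMap.det,
    ← LinearMap.det_toMatrix (EuclideanSpace.basisFun (Fin (∑ i, c i)) ℝ).toBasis]
  congr 1

theorem contDiffAt_det_fderiv {τ : Space c → Space c} {y : Space c} (hτ : ContDiffAt ℝ ∞ τ y) :
    ContDiffAt ℝ ∞ (fun z => (fderiv ℝ τ z).det) y := by
  simp only [det_eq_matrix_det, Matrix.det_apply, Matrix.of_apply]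
  refine ContDiffAt.sum fun σ _ => ContDiffAt.const_smul _ (contDiffAt_prod fun k _ => ?_)
  exact (contDiffAt_euclidean.1 (contDiffAt_fderiv_apply hτ _)) _

theorem injective_of_det_ne_zero {f : Space c →L[ℝ] Space c} (hf : f.det ≠ 0) :
    Function.Injective f :=
  (LinearMap.equivOfDetNeZero f.toLinearMap hf).injective

/-- `τ` is smooth with invertible derivative at `y`, and its derivative maps the standard web to
itself, permuting its foliations by `σ`. -/
structure IsWebMapAt (σ : Equiv.Perm (Fin n)) (τ : Space c → Space c) (y : Space c) : Prop where
  smooth : ContDiffAt ℝ ∞ τ y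
  det_ne : (fderiv ℝ τ y).det ≠ 0
  map_tangent : ∀ i, (stdTangent c i).map (fderiv ℝ τ y).toLinearMap = stdTangent c (σ i)

variable {σ : Equiv.Perm (Fin n)} {τ : Space c → Space c} {y : Space c}

theorem IsWebMapAt.mem_stdTangent (h : IsWebMapAt σ τ y) {i : Fin n} {v : Space c}
    (hv : v ∈ stdTangent c i) : fderiv ℝ τ y v ∈ stdTangent c (σ i) := by
  rw [← h.map_tangent i]
  exact Submodule.mem_map_of_mem hv

theorem IsWebMapAt.mem_stdCompl (h : IsWebMapAt σ τ y) {i : Fin n} {v : Space c}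
    (hv : v ∈ stdCompl c i) : fderiv ℝ τ y v ∈ stdCompl c (σ i) := by
  refine DivFreeWeb.mem_stdCompl.2 fun k hk => ?_
  have hne : σ.symm (block c k) ≠ i := fun e => hk (by rw [← e, σ.apply_symm_apply])
  have := h.mem_stdTangent (mem_stdTangent_of_mem_stdCompl hne hv)
  exact DivFreeWeb.mem_stdTangent.1 this k (σ.apply_symm_apply _).symm

/-- The part of `v` outside block `i` is tangent to the `i`-th foliation, so its image is tangent to
the foliation `σ i`. The hypothesis also puts this image in the complementary space. These two
spaces meet only in `0`, and the derivative is injective. -/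
theorem IsWebMapAt.mem_stdCompl_of_map_mem (h : IsWebMapAt σ τ y) {i : Fin n} {v : Space c}
    (hv : fderiv ℝ τ y v ∈ stdCompl c (σ i)) : v ∈ stdCompl c i := by
  have hsplit : fderiv ℝ τ y (offProj c i v) =
      fderiv ℝ τ y v - fderiv ℝ τ y (blockProj c i v) := by
    rw [offProj_def, map_sub]
  have h1 : fderiv ℝ τ y (offProj c i v) ∈ stdCompl c (σ i) := by
    rw [hsplit]
    exact (stdCompl c (σ i)).sub_mem hv (h.mem_stdCompl (blockProj_mem i v))
  have h2 : fderiv ℝ τ y (offProj c i v) ∈ stdTangent c (σ i) :=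
    h.mem_stdTangent (DivFreeWeb.mem_stdTangent.2 fun k hk => by rw [offProj_apply, if_pos hk])
  have h3 : fderiv ℝ τ y (offProj c i v) = 0 := by
    ext k
    by_cases hk : block c k = σ i
    · exact DivFreeWeb.mem_stdTangent.1 h2 k hk
    · exact DivFreeWeb.mem_stdCompl.1 h1 k hk
  have h4 : offProj c i v = 0 := injective_of_det_ne_zero h.det_ne (by rw [h3, map_zero])
  rw [offProj_def, sub_eq_zero] at h4
  rw [h4]
  exact blockProj_mem i v

/-- The mixed second derivatives of a map preserving the standard web vanish. -/
theorem fderiv_fderiv_eq_zero (h : ∀ᶠ z in 𝓝 y, IsWebMapAt σ τ z) {k l : Fin (∑ i, c i)}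
    (hkl : block c k ≠ block c l) :
    fderiv ℝ (fun z => fderiv ℝ τ z (ex c k)) y (ex c l) = 0 := by
  -- The vector `∂τ/∂xₖ` stays in one fixed subspace, hence so do its derivatives. By symmetry a
  -- mixed second derivative lies in the complementary spaces of two different blocks, hence is
  -- zero.
  have key : ∀ (k l : Fin (∑ i, c i)),
      fderiv ℝ (fun z => fderiv ℝ τ z (ex c k)) y (ex c l) ∈ stdCompl c (σ (block c k)) := by
    intro k l
    refine mem_stdCompl.2 fun a ha => ?_
    have hd : DifferentiableAt ℝ (fun z => fderiv ℝ τ z (ex c k)) y :=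
      (contDiffAt_fderiv_apply h.self_of_nhds.smooth _).differentiableAt (by simp)
    have h1 : HasFDerivAt (fun z => fderiv ℝ τ z (ex c k) a)
        ((EuclideanSpace.proj a : Space c →L[ℝ] ℝ).comp
          (fderiv ℝ (fun z => fderiv ℝ τ z (ex c k)) y)) y :=
      (EuclideanSpace.proj a : Space c →L[ℝ] ℝ).hasFDerivAt.comp y hd.hasFDerivAt
    have h2 : (fun z => fderiv ℝ τ z (ex c k) a) =ᶠ[𝓝 y] fun _ => 0 := by
      filter_upwards [h] with z hz
      exact mem_stdCompl.1 (hz.mem_stdCompl (ex_mem_stdCompl k)) a ha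
    have h3 := (h1.congr_of_eventuallyEq h2.symm).unique (hasFDerivAt_const 0 y)
    simpa using congrArg (fun f => f (ex c l)) h3
  refine eq_zero_of_mem_stdCompl (fun e => hkl (σ.injective e)) (key k l) ?_
  rw [fderiv_fderiv_comm h.self_of_nhds.smooth]
  exact key l k

/-- In the chain rule for second derivatives the term with the second derivative of `τ` vanishes in
mixed directions. The derivative of `τ` sends distinct blocks to distinct blocks, so deleting the
entries within blocks commutes with the pullback. -/
theorem mixedHess_comp {u : Space c → ℝ} (h : ∀ᶠ z in 𝓝 y, IsWebMapAt σ τ z)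
    (hu : ∀ᶠ z in 𝓝 (τ y), ContDiffAt ℝ ∞ u z) :
    mixedHess c (fun z => u (τ z)) y = pullback τ (mixedHess c u) y := by
  have hy := h.self_of_nhds
  have hτy := hy.smooth.differentiableAt (by simp)
  refine bilinForm_ext fun k l => ?_
  change _ = mixedHess c u (τ y) (fderiv ℝ τ y (ex c k)) (fderiv ℝ τ y (ex c l))
  rw [mixedHess_ex]
  split_ifs with hkl
  · rw [mixedHess_of_mem (hy.mem_stdCompl (ex_mem_stdCompl k))
      (hkl ▸ hy.mem_stdCompl (ex_mem_stdCompl l))]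
  · rw [mixedHess_of_mem_of_ne hu.self_of_nhds (fun e => hkl (σ.injective e))
      (hy.mem_stdCompl (ex_mem_stdCompl k)) (hy.mem_stdCompl (ex_mem_stdCompl l)),
      fderiv_fderiv_apply hu.self_of_nhds]
    have h1 : (fun z => fderiv ℝ (fun z => u (τ z)) z (ex c l)) =ᶠ[𝓝 y]
        fun z => fderiv ℝ u (τ z) (fderiv ℝ τ z (ex c l)) := by
      filter_upwards [h, hτy.continuousAt.eventually hu] with z hz huz
      have := (huz.differentiableAt (by simp)).hasFDerivAt.comp z
        (hz.smooth.differentiableAt (by simp)).hasFDerivAt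
      rw [HasFDerivAt.fderiv (f := fun z => u (τ z)) this]
      rfl
    have hu' : DifferentiableAt ℝ (fderiv ℝ u) (τ y) :=
      (hu.self_of_nhds.fderiv_right (m := ∞) (by simp)).differentiableAt (by simp)
    have h2 : HasFDerivAt (fun z => fderiv ℝ u (τ z)) ((fderiv ℝ (fderiv ℝ u) (τ y)).comp
      (fderiv ℝ τ y)) y := hu'.hasFDerivAt.comp y hτy.hasFDerivAt
    have h3 : DifferentiableAt ℝ (fun z => fderiv ℝ τ z (ex c l)) y :=
      (contDiffAt_fderiv_apply hy.smooth _).differentiableAt (by simp)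
    rw [h1.fderiv_eq, (h2.clm_apply h3.hasFDerivAt).fderiv]
    simp [fderiv_fderiv_eq_zero h (Ne.symm hkl)]

/-- The four-point identity for the Jacobian determinants of maps preserving the standard web. -/
theorem det_mul_det_eq {i : Fin n} {T00 T10 T01 T11 : Space c →L[ℝ] Space c}
    (h00 : T00.det ≠ 0)
    (hmem : ∀ v, T00 v ∈ stdCompl c (σ i) → v ∈ stdCompl c i)
    (hmem' : ∀ k, block c k = i → T10 (ex c k) ∈ stdCompl c (σ i))
    (h1 : ∀ k, block c k = i → T11 (ex c k) = T10 (ex c k) ∧ T01 (ex c k) = T00 (ex c k))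
    (h2 : ∀ k, block c k ≠ i → T11 (ex c k) = T01 (ex c k) ∧ T10 (ex c k) = T00 (ex c k)) :
    T11.det * T00.det = T01.det * T10.det := by
  let e := LinearMap.equivOfDetNeZero T00.toLinearMap h00
  have he : ∀ v, e v = T00 v := fun v => rfl
  have hS : ∀ v ∈ stdCompl c i, T01 v = T00 v := by
    intro v hv
    rw [← sum_smul_ex v, map_sum, map_sum]
    refine Finset.sum_congr rfl fun k _ => ?_
    rw [map_smul, map_smul]
    by_cases hk : block c k = i
    · rw [(h1 k hk).2]
    · rw [mem_stdCompl.1 hv k hk, zero_smul, zero_smul]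
  -- The identity `T11 = T01 ∘ T00⁻¹ ∘ T10` is checked column by column. In block `i`, `T00⁻¹ ∘ T10`
  -- stays in the block, where `T01` agrees with `T00`. Outside it, `T10` agrees with `T00` and
  -- `T00⁻¹ ∘ T10` fixes the basis vector. Taking determinants avoids any splitting into block
  -- determinants.
  have hT : T11.toLinearMap = T01.toLinearMap ∘ₗ e.symm.toLinearMap ∘ₗ T10.toLinearMap := by
    refine (EuclideanSpace.basisFun (Fin (∑ i, c i)) ℝ).toBasis.ext fun k => ?_
    rw [basisFun_eq_ex]
    change T11 (ex c k) = T01 (e.symm (T10 (ex c k)))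
    by_cases hk : block c k = i
    · have hy : T00 (e.symm (T10 (ex c k))) = T10 (ex c k) := by rw [← he, e.apply_symm_apply]
      rw [hS _ (hmem _ (by rw [hy]; exact hmem' k hk)), hy, (h1 k hk).1]
    · rw [(h2 k hk).2, ← he, e.symm_apply_apply, (h2 k hk).1]
  have hinv : LinearMap.det e.symm.toLinearMap * T00.det = 1 := by
    have : e.symm.toLinearMap ∘ₗ T00.toLinearMap = LinearMap.id := by
      ext1 v
      change e.symm (T00 v) = v
      rw [← he, e.symm_apply_apply]
    rw [ContinuousLinearMap.det, ← LinearMap.det_comp, this, LinearMap.det_id]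
  have hdet : T11.det = T01.det * (LinearMap.det e.symm.toLinearMap * T10.det) := by
    simp only [ContinuousLinearMap.det, hT, LinearMap.det_comp]
  rw [hdet]
  linear_combination T01.det * T10.det * hinv

/-! ### Jacobians of web-preserving maps are invisible to the mixed Hessian -/

theorem eq_of_fderiv_eq_zero_on_ball {f : Space c → Space c} {y v z : Space c} {ε : ℝ}
    (hf : ∀ x ∈ Metric.ball y ε, DifferentiableAt ℝ f x ∧ fderiv ℝ f x v = 0)
    (hz : z ∈ Metric.ball y ε) (hzv : z + v ∈ Metric.ball y ε) : f (z + v) = f z := by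
  have hline : ∀ t : ℝ, HasDerivAt (fun t : ℝ => z + t • v) v t := fun t => by
    simpa using ((hasDerivAt_id t).smul_const v).const_add z
  have hmem : ∀ t ∈ Icc (0 : ℝ) 1, z + t • v ∈ Metric.ball y ε := fun t ht => by
    have := (convex_ball y ε).add_smul_sub_mem hz hzv ht
    simpa using this
  have hd : ∀ t ∈ Icc (0 : ℝ) 1, HasDerivAt (fun t => f (z + t • v)) 0 t := fun t ht => by
    have := (hf _ (hmem t ht)).1.hasFDerivAt.comp_hasDerivAt t (hline t)
    rwa [(hf _ (hmem t ht)).2] at this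
  have := constant_of_has_deriv_right_zero
    (fun t ht => (hd t ht).continuousAt.continuousWithinAt)
    (fun t ht => (hd t ⟨ht.1, ht.2.le⟩).hasDerivWithinAt) 1 (by simp)
  simpa using this

/-- A column of the Jacobian matrix changes only when its own block of coordinates moves. So at the
corners of a small parallelogram spanned by directions from two blocks the four-point identity
`det_mul_det_eq` applies. It makes the log-determinant additive in the two directions, and the mixed
derivative vanishes. -/
theorem mixedHess_log_det (h : ∀ᶠ z in 𝓝 y, IsWebMapAt σ τ z) :
    mixedHess c (fun z => Real.log (fderiv ℝ τ z).det) y = 0 := by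
  obtain ⟨ε, hε, hball⟩ := Metric.eventually_nhds_iff_ball.1 h
  have hnhds : ∀ x ∈ Metric.ball y ε, ∀ᶠ z in 𝓝 x, IsWebMapAt σ τ z := fun x hx =>
    (Metric.isOpen_ball.eventually_mem hx).mono fun z hz => hball z hz
  have hconst : ∀ k a, block c k ≠ block c a → ∀ (s : ℝ), ∀ z ∈ Metric.ball y ε,
      z + s • ex c k ∈ Metric.ball y ε →
        fderiv ℝ τ (z + s • ex c k) (ex c a) = fderiv ℝ τ z (ex c a) := by
    intro k a hka s z hz hzs
    refine eq_of_fderiv_eq_zero_on_ball (f := fun z => fderiv ℝ τ z (ex c a)) (fun x hx => ?_)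
      hz hzs
    refine ⟨(contDiffAt_fderiv_apply (hball x hx).smooth _).differentiableAt (by simp), ?_⟩
    rw [map_smul, fderiv_fderiv_eq_zero (hnhds x hx) (Ne.symm hka), smul_zero]
  let g : Space c → ℝ := fun z => Real.log (fderiv ℝ τ z).det
  have hg : ∀ x ∈ Metric.ball y ε, ContDiffAt ℝ ∞ g x := fun x hx =>
    (contDiffAt_det_fderiv (hball x hx).smooth).log (hball x hx).det_ne
  refine bilinForm_ext fun k l => ?_
  rw [mixedHess_ex]
  split_ifs with hkl
  · rfl
  change fderiv ℝ (fun z => fderiv ℝ g z (ex c l)) y (ex c k) = 0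
  have hy : y ∈ Metric.ball y ε := Metric.mem_ball_self hε
  have hlim : ∀ x a, Tendsto (fun t : ℝ => x + t • ex c a) (𝓝 0) (𝓝 x) := fun x a => by
    have : Continuous fun t : ℝ => x + t • ex c a := by fun_prop
    simpa using this.tendsto 0
  have hderiv : ∀ x ∈ Metric.ball y ε, ∀ a,
      HasDerivAt (fun t : ℝ => g (x + t • ex c a)) (fderiv ℝ g x (ex c a)) 0 := by
    intro x hx a
    have hline : HasDerivAt (fun t : ℝ => x + t • ex c a) (ex c a) 0 := by
      simpa using ((hasDerivAt_id (0 : ℝ)).smul_const (ex c a)).const_add x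
    refine HasFDerivAt.comp_hasDerivAt (0 : ℝ) (l := g) ?_ hline
    simpa using ((hg x hx).differentiableAt (by simp)).hasFDerivAt
  have hadd : ∀ s t : ℝ, y + s • ex c k ∈ Metric.ball y ε → y + t • ex c l ∈ Metric.ball y ε →
      y + s • ex c k + t • ex c l ∈ Metric.ball y ε →
      g (y + s • ex c k + t • ex c l) = g (y + t • ex c l) + (g (y + s • ex c k) - g y) := by
    intro s t hs ht hst
    have hcomm : y + s • ex c k + t • ex c l = y + t • ex c l + s • ex c k := by abel
    have := det_mul_det_eq (σ := σ) (i := block c k)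
      (T00 := fderiv ℝ τ y) (T10 := fderiv ℝ τ (y + s • ex c k))
      (T01 := fderiv ℝ τ (y + t • ex c l)) (T11 := fderiv ℝ τ (y + s • ex c k + t • ex c l))
      (hball y hy).det_ne (fun v hv => (hball y hy).mem_stdCompl_of_map_mem hv)
      (fun a ha => (hball _ hs).mem_stdCompl (ha ▸ ex_mem_stdCompl a))
      (fun a ha => ⟨hconst l a (by rw [ha]; exact Ne.symm hkl) t _ hs hst,
        hconst l a (by rw [ha]; exact Ne.symm hkl) t _ hy ht⟩)
      (fun a ha => ⟨by
        rw [hcomm] at hst ⊢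
        exact hconst k a (Ne.symm ha) s _ ht hst, hconst k a (Ne.symm ha) s _ hy hs⟩)
    have hlog := congrArg Real.log this
    -- `Real.log` is the logarithm of the absolute value, so nonvanishing suffices and orientation
    -- plays no role.
    rw [Real.log_mul (hball _ hst).det_ne (hball _ hy).det_ne,
      Real.log_mul (hball _ ht).det_ne (hball _ hs).det_ne] at hlog
    change g _ + g _ = g _ + g _ at hlog
    linarith
  have hball_nhds : ∀ x ∈ Metric.ball y ε, ∀ᶠ z in 𝓝 x, z ∈ Metric.ball y ε :=
    fun x hx => Metric.isOpen_ball.mem_nhds hx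
  have h1 : ∀ᶠ s : ℝ in 𝓝 0,
      fderiv ℝ g (y + s • ex c k) (ex c l) = fderiv ℝ g y (ex c l) := by
    filter_upwards [(hlim y k).eventually (hball_nhds y hy)] with s hs
    refine (hderiv _ hs l).unique (((hderiv y hy l).add_const
      (g (y + s • ex c k) - g y)).congr_of_eventuallyEq ?_)
    filter_upwards [(hlim y l).eventually (hball_nhds y hy),
      (hlim (y + s • ex c k) l).eventually (hball_nhds _ hs)] with t ht hst
    exact hadd s t hs ht hst
  have hline : HasDerivAt (fun t : ℝ => y + t • ex c k) (ex c k) 0 := by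
    simpa using ((hasDerivAt_id (0 : ℝ)).smul_const (ex c k)).const_add y
  have h2 : HasDerivAt (fun s : ℝ => fderiv ℝ g (y + s • ex c k) (ex c l))
      (fderiv ℝ (fun z => fderiv ℝ g z (ex c l)) y (ex c k)) 0 := by
    refine HasFDerivAt.comp_hasDerivAt (0 : ℝ) (l := fun z => fderiv ℝ g z (ex c l)) ?_ hline
    simpa using ((contDiffAt_fderiv_apply (hg y hy) (ex c l)).differentiableAt
      (by simp)).hasFDerivAt
  exact h2.unique ((hasDerivAt_const 0 _).congr_of_eventuallyEq h1)

theorem mixedHess_add {u v : Space c → ℝ} (hu : ∀ᶠ z in 𝓝 y, ContDiffAt ℝ ∞ u z)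
    (hv : ∀ᶠ z in 𝓝 y, ContDiffAt ℝ ∞ v z) :
    mixedHess c (fun z => u z + v z) y = mixedHess c u y + mixedHess c v y := by
  refine bilinForm_ext fun k l => ?_
  rw [LinearMap.add_apply, LinearMap.add_apply, mixedHess_ex, mixedHess_ex, mixedHess_ex]
  split_ifs with hkl
  · simp
  have : (fun z => fderiv ℝ (fun z => u z + v z) z (ex c l)) =ᶠ[𝓝 y]
      fun z => fderiv ℝ u z (ex c l) + fderiv ℝ v z (ex c l) := by
    filter_upwards [hu, hv] with z huz hvz
    rw [fderiv_fun_add (huz.differentiableAt (by simp)) (hvz.differentiableAt (by simp)),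
      add_apply]
  rw [this.fderiv_eq, fderiv_fun_add, add_apply]
  · exact (contDiffAt_fderiv_apply hu.self_of_nhds _).differentiableAt (by simp)
  · exact (contDiffAt_fderiv_apply hv.self_of_nhds _).differentiableAt (by simp)

/-- The transformation law of the nonuniformity tensor. -/
theorem mixedLogHessian_transform {h h' : Space c → ℝ} (hτ : ∀ᶠ z in 𝓝 y, IsWebMapAt σ τ z)
    (hh' : ∀ᶠ z in 𝓝 (τ y), ContDiffAt ℝ ∞ h' z ∧ h' z ≠ 0)
    (hh : h =ᶠ[𝓝 y] fun z => h' (τ z) * (fderiv ℝ τ z).det) :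
    mixedLogHessian c h y = pullback τ (mixedLogHessian c h') y := by
  have hτc : ContinuousAt τ y := hτ.self_of_nhds.smooth.continuousAt
  let u : Space c → ℝ := fun w => Real.log (h' w)
  let v : Space c → ℝ := fun z => Real.log (fderiv ℝ τ z).det
  have hu : ∀ᶠ z in 𝓝 (τ y), ContDiffAt ℝ ∞ u z := hh'.mono fun z hz => hz.1.log hz.2
  have huτ : ∀ᶠ z in 𝓝 y, ContDiffAt ℝ ∞ (fun z => u (τ z)) z := by
    filter_upwards [hτ, hτc.eventually hu] with z hz huz
    exact ContDiffAt.comp (g := u) z huz hz.smooth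
  have hv : ∀ᶠ z in 𝓝 y, ContDiffAt ℝ ∞ v z :=
    hτ.mono fun z hz => (contDiffAt_det_fderiv hz.smooth).log hz.det_ne
  have h1 : (fun z => Real.log (h z)) =ᶠ[𝓝 y] fun z => u (τ z) + v z := by
    filter_upwards [hh, hτ, hτc.eventually hh'] with z hz hτz hhz
    rw [hz]
    exact Real.log_mul hhz.2 hτz.det_ne
  have hv0 : mixedHess c v y = 0 := mixedHess_log_det hτ
  calc mixedLogHessian c h y = mixedHess c (fun z => u (τ z) + v z) y := mixedHess_congr h1
    _ = mixedHess c (fun z => u (τ z)) y + mixedHess c v y := mixedHess_add huτ hv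
    _ = pullback τ (mixedHess c u) y := by rw [hv0, add_zero, mixedHess_comp hτ hu]

end WebMaps

/-! ### The group of web-preserving germs and its action -/

section WebGroup

variable {n : ℕ} {c : Fin n → ℕ}

theorem unitVol_ex : unitVol c (ex c) = 1 := by
  have h : ex c = (EuclideanSpace.basisFun (Fin (∑ i, c i)) ℝ).toBasis :=
    funext fun k => (basisFun_eq_ex k).symm
  rw [unitVol, h, Module.Basis.det_self]

theorem eq_smul_unitVol (η : Space c [⋀^Fin (∑ i, c i)]→ₗ[ℝ] ℝ) :
    η = η (ex c) • unitVol c := by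
  have h : ex c = (EuclideanSpace.basisFun (Fin (∑ i, c i)) ℝ).toBasis :=
    funext fun k => (basisFun_eq_ex k).symm
  rw [unitVol, h]
  exact η.eq_smul_basis_det _

/-- Top-degree forms are one-dimensional, so statements about volume forms reduce to densities and
determinants. -/
theorem compLinearMap_apply_ex (η : Space c [⋀^Fin (∑ i, c i)]→ₗ[ℝ] ℝ)
    (f : Space c →L[ℝ] Space c) : η.compLinearMap f.toLinearMap (ex c) = η (ex c) * f.det := by
  have h : ex c = (EuclideanSpace.basisFun (Fin (∑ i, c i)) ℝ).toBasis :=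
    funext fun k => (basisFun_eq_ex k).symm
  have h1 : unitVol c (f.toLinearMap ∘ ex c) = f.det * unitVol c (ex c) :=
    Module.Basis.det_comp _ _ _
  rw [unitVol_ex, mul_one] at h1
  conv_lhs => rw [eq_smul_unitVol η]
  rw [← h1]
  rfl

theorem eq_iff_apply_ex {η η' : Space c [⋀^Fin (∑ i, c i)]→ₗ[ℝ] ℝ} :
    η = η' ↔ η (ex c) = η' (ex c) :=
  ⟨fun h => by rw [h], fun h => by rw [eq_smul_unitVol η, eq_smul_unitVol η', h]⟩

theorem unitVol_compLinearMap_eq_iff (f : Space c →L[ℝ] Space c) :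
    (unitVol c).compLinearMap f.toLinearMap = unitVol c ↔ f.det = 1 := by
  rw [eq_iff_apply_ex, compLinearMap_apply_ex, unitVol_ex, one_mul]

theorem IsWebMapAt.comp {σ σ' : Equiv.Perm (Fin n)} {τ τ' : Space c → Space c} {y : Space c}
    (h' : IsWebMapAt σ' τ' (τ y)) (h : IsWebMapAt σ τ y) :
    IsWebMapAt (σ.trans σ') (τ' ∘ τ) y where
  smooth := h'.smooth.comp y h.smooth
  det_ne := by
    rw [fderiv_comp y (h'.smooth.differentiableAt (by simp)) (h.smooth.differentiableAt (by simp))]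
    change LinearMap.det ((fderiv ℝ τ' (τ y)).toLinearMap ∘ₗ (fderiv ℝ τ y).toLinearMap) ≠ 0
    rw [LinearMap.det_comp]
    exact mul_ne_zero h'.det_ne h.det_ne
  map_tangent i := by
    rw [fderiv_comp y (h'.smooth.differentiableAt (by simp)) (h.smooth.differentiableAt (by simp))]
    change (stdTangent c i).map
      ((fderiv ℝ τ' (τ y)).toLinearMap ∘ₗ (fderiv ℝ τ y).toLinearMap) = _
    rw [Submodule.map_comp, h.map_tangent, h'.map_tangent]
    rfl

theorem isWebMapAt_id (y : Space c) : IsWebMapAt 1 (id : Space c → Space c) y where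
  smooth := contDiffAt_id
  det_ne := by
    rw [fderiv_id]
    exact (LinearMap.det_id.trans_ne one_ne_zero :
      LinearMap.det (LinearMap.id : Space c →ₗ[ℝ] Space c) ≠ 0)
  map_tangent i := by
    rw [fderiv_id]
    exact Submodule.map_id _

theorem fderiv_comp_fderiv_symm {φ : OpenPartialHomeomorph (Space c) (Space c)} {x : Space c}
    (hx : x ∈ φ.source) (h : DifferentiableAt ℝ φ x) (h' : DifferentiableAt ℝ φ.symm (φ x)) :
    (fderiv ℝ φ.symm (φ x)).comp (fderiv ℝ φ x) = ContinuousLinearMap.id ℝ (Space c) := by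
  have h1 := h'.hasFDerivAt.comp x h.hasFDerivAt
  have h2 : φ.symm ∘ φ =ᶠ[𝓝 x] id := by
    filter_upwards [φ.open_source.mem_nhds hx] with z hz
    exact φ.left_inv hz
  exact (h1.congr_of_eventuallyEq h2.symm).unique (hasFDerivAt_id x)

theorem det_mul_det_of_comp_eq_id {f g : Space c →L[ℝ] Space c}
    (h : g.comp f = ContinuousLinearMap.id ℝ (Space c)) : g.det * f.det = 1 := by
  have := congrArg (fun f : Space c →L[ℝ] Space c => f.det) h
  change LinearMap.det (g.toLinearMap ∘ₗ f.toLinearMap) = LinearMap.det LinearMap.id at this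
  rwa [LinearMap.det_comp, LinearMap.det_id] at this

theorem det_fderiv_ne_zero {φ : OpenPartialHomeomorph (Space c) (Space c)} {x : Space c}
    (hx : x ∈ φ.source) (h : DifferentiableAt ℝ φ x) (h' : DifferentiableAt ℝ φ.symm (φ x)) :
    (fderiv ℝ φ x).det ≠ 0 := by
  intro h0
  have := det_mul_det_of_comp_eq_id (fderiv_comp_fderiv_symm hx h h')
  rw [h0, mul_zero] at this
  exact zero_ne_one this

theorem IsWebMapAt.symm {φ : OpenPartialHomeomorph (Space c) (Space c)}
    {σ : Equiv.Perm (Fin n)} {x : Space c} (hx : x ∈ φ.source) (h : IsWebMapAt σ φ x)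
    (h' : ContDiffAt ℝ ∞ φ.symm (φ x)) : IsWebMapAt σ.symm φ.symm (φ x) where
  smooth := h'
  det_ne := by
    intro h0
    have := det_mul_det_of_comp_eq_id (fderiv_comp_fderiv_symm hx
      (h.smooth.differentiableAt (by simp)) (h'.differentiableAt (by simp)))
    rw [h0, zero_mul] at this
    exact zero_ne_one this
  map_tangent i := by
    have := h.map_tangent (σ.symm i)
    rw [σ.apply_symm_apply] at this
    rw [← this, ← Submodule.map_comp]
    change (stdTangent c (σ.symm i)).map
      ((fderiv ℝ φ.symm (φ x)).comp (fderiv ℝ φ x)).toLinearMap = _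
    rw [fderiv_comp_fderiv_symm hx (h.smooth.differentiableAt (by simp))
      (h'.differentiableAt (by simp))]
    exact Submodule.map_id _

/-- Germs preserving the web permute the leaves `Fᵢ`. -/
theorem eventually_mem_stdCompl {σ : Equiv.Perm (Fin n)} {τ : Space c → Space c}
    (h : ∀ᶠ x in 𝓝 0, IsWebMapAt σ τ x) (h0 : τ 0 = 0) :
    ∀ᶠ x in 𝓝 (0 : Space c), ∀ i, x ∈ stdCompl c i → τ x ∈ stdCompl c (σ i) := by
  refine eventually_all.2 fun i => ?_
  have hP : Tendsto (blockProj c i) (𝓝 0) (𝓝 0) := by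
    simpa using (blockProj c i).continuous.tendsto 0
  -- Along the leaf the coordinates of `τ` outside block `σ i` have zero differential, and they
  -- vanish at `0`.
  have key : ∀ k, block c k ≠ σ i → ∀ᶠ x in 𝓝 (0 : Space c), τ (blockProj c i x) k = 0 := by
    intro k hk
    have hd : ∀ x, IsWebMapAt σ τ (blockProj c i x) → HasFDerivAt (fun x => τ (blockProj c i x) k)
        ((EuclideanSpace.proj k : Space c →L[ℝ] ℝ).comp
          ((fderiv ℝ τ (blockProj c i x)).comp (blockProj c i))) x := fun x hx =>
      (EuclideanSpace.proj k : Space c →L[ℝ] ℝ).hasFDerivAt.comp x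
        ((hx.smooth.differentiableAt (by simp)).hasFDerivAt.comp x (blockProj c i).hasFDerivAt)
    have := eventually_eq_of_fderiv_comp_eq_zero (ContinuousLinearMap.id ℝ (Space c))
      (f := fun x => τ (blockProj c i x) k)
      ((hP.eventually h).mono fun x hx => (hd x hx).differentiableAt)
      (by
        filter_upwards [hP.eventually h] with x hx v
        rw [(hd x hx).fderiv]
        exact mem_stdCompl.1 (hx.mem_stdCompl (blockProj_mem i v)) k hk)
    filter_upwards [this] with x hx
    rw [hx]
    simp [h0]
  have key' : ∀ᶠ x in 𝓝 (0 : Space c), ∀ k, block c k ≠ σ i → τ (blockProj c i x) k = 0 :=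
    eventually_all.2 fun k => eventually_imp_distrib_left.2 fun hk => key k hk
  filter_upwards [key'] with x hx hxi
  rw [blockProj_of_mem hxi] at hx
  exact mem_stdCompl.2 hx

/-- Invertibility of the derivative comes for free from the smooth inverse, and preserving the unit
volume form means Jacobian determinant `1`. -/
theorem mem_webGroup_iff {φ : OpenPartialHomeomorph (Space c) (Space c)} :
    φ ∈ webGroup c ↔ 0 ∈ φ.source ∧ φ 0 = 0 ∧ ContDiffOn ℝ ∞ φ φ.source ∧
      ContDiffOn ℝ ∞ φ.symm φ.target ∧
      (∃ σ : Equiv.Perm (Fin n), ∀ᶠ x in 𝓝 (0 : Space c), IsWebMapAt σ φ x) ∧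
      ∀ᶠ q in 𝓝 (0 : Space c), ∀ i, q ∈ stdCompl c i → (fderiv ℝ φ q).det = 1 := by
  simp only [webGroup, mem_ofPred_eq, unitVol_compLinearMap_eq_iff]
  refine and_congr_right fun h0 => and_congr_right fun _ => and_congr_right fun hs =>
    and_congr_right fun hs' => and_congr_left fun _ => exists_congr fun σ =>
    ⟨fun h => ?_, fun h => h.mono fun x hx => hx.map_tangent⟩
  filter_upwards [h, φ.open_source.mem_nhds h0] with x hx hxs
  have h1 : ContDiffAt ℝ ∞ φ x := hs.contDiffAt (φ.open_source.mem_nhds hxs)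
  have h2 : ContDiffAt ℝ ∞ φ.symm (φ x) :=
    hs'.contDiffAt (φ.open_target.mem_nhds (φ.map_source hxs))
  exact ⟨h1, det_fderiv_ne_zero hxs (h1.differentiableAt (by simp))
    (h2.differentiableAt (by simp)), hx⟩

theorem refl_mem_webGroup : OpenPartialHomeomorph.refl (Space c) ∈ webGroup c :=
  mem_webGroup_iff.2 ⟨mem_univ _, rfl, contDiffOn_id, contDiffOn_id,
    ⟨1, Eventually.of_forall fun x => isWebMapAt_id x⟩, Eventually.of_forall fun x _ _ => by
      change (fderiv ℝ id x).det = 1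
      rw [fderiv_id]
      exact LinearMap.det_id⟩

theorem symm_mem_webGroup {φ : OpenPartialHomeomorph (Space c) (Space c)}
    (hφ : φ ∈ webGroup c) : φ.symm ∈ webGroup c := by
  obtain ⟨h0, h00, hs, hs', ⟨σ, hσ⟩, hdet⟩ := mem_webGroup_iff.1 hφ
  have h0' : (0 : Space c) ∈ φ.target := h00 ▸ φ.map_source h0
  have h00' : φ.symm 0 = 0 := by
    conv_lhs => rw [← h00]
    exact φ.left_inv h0
  have hlim : Tendsto φ.symm (𝓝 0) (𝓝 0) := by
    simpa [h00'] using (φ.continuousAt_symm h0').tendsto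
  have hsymm : ∀ᶠ y in 𝓝 (0 : Space c), IsWebMapAt σ.symm φ.symm y := by
    filter_upwards [hlim.eventually hσ, φ.open_target.mem_nhds h0'] with y hy hyt
    have := IsWebMapAt.symm (φ.map_target hyt) hy (by
      rw [φ.right_inv hyt]
      exact hs'.contDiffAt (φ.open_target.mem_nhds hyt))
    rwa [φ.right_inv hyt] at this
  refine mem_webGroup_iff.2 ⟨h0', h00', hs', hs, ⟨σ.symm, hsymm⟩, ?_⟩
  -- The inverse maps leaves to leaves, so the Jacobian of `φ` at the preimage of a leaf point is
  -- also known to be `1`.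
  filter_upwards [hlim.eventually hdet, hlim.eventually hσ, hsymm, φ.open_target.mem_nhds h0',
    eventually_mem_stdCompl hsymm h00'] with y hy hyσ hys hyt hmem i hi
  have h1 := hy _ (hmem i hi)
  have h2 := det_mul_det_of_comp_eq_id (fderiv_comp_fderiv_symm (φ.map_target hyt)
    (hyσ.smooth.differentiableAt (by simp)) (by
      rw [φ.right_inv hyt]
      exact hys.smooth.differentiableAt (by simp)))
  rwa [h1, mul_one, φ.right_inv hyt] at h2

theorem tendsto_of_mem_webGroup {φ : OpenPartialHomeomorph (Space c) (Space c)}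
    (hφ : φ ∈ webGroup c) : Tendsto φ (𝓝 0) (𝓝 0) := by
  simpa [hφ.2.1] using (φ.continuousAt hφ.1).tendsto

theorem eventually_contDiffAt_of_mem_webGroup {φ : OpenPartialHomeomorph (Space c) (Space c)}
    (hφ : φ ∈ webGroup c) : ∀ᶠ x in 𝓝 (0 : Space c), ContDiffAt ℝ ∞ φ x :=
  (φ.open_source.eventually_mem hφ.1).mono fun _ hx =>
    hφ.2.2.1.contDiffAt (φ.open_source.mem_nhds hx)

theorem trans_mem_webGroup {φ χ : OpenPartialHomeomorph (Space c) (Space c)}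
    (hφ : φ ∈ webGroup c) (hχ : χ ∈ webGroup c) : φ.trans χ ∈ webGroup c := by
  have hlim := tendsto_of_mem_webGroup hφ
  obtain ⟨h0, h00, hs, hs', ⟨σ, hσ⟩, hdet⟩ := mem_webGroup_iff.1 hφ
  obtain ⟨k0, k00, ks, ks', ⟨σ', hσ'⟩, kdet⟩ := mem_webGroup_iff.1 hχ
  refine mem_webGroup_iff.2 ⟨⟨h0, ?_⟩, ?_, ?_, ?_, ⟨σ.trans σ', ?_⟩, ?_⟩
  · change φ 0 ∈ χ.source
    rwa [h00]
  · change χ (φ 0) = 0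
    rw [h00, k00]
  · rw [OpenPartialHomeomorph.trans_source]
    exact ks.comp (hs.mono inter_subset_left) fun x hx => hx.2
  · rw [OpenPartialHomeomorph.trans_target]
    exact hs'.comp (ks'.mono inter_subset_left) fun x hx => hx.2
  · filter_upwards [hσ, hlim.eventually hσ'] with x hx hx'
    exact hx'.comp hx
  · filter_upwards [hσ, hlim.eventually hσ', hdet, hlim.eventually kdet,
      eventually_mem_stdCompl hσ h00] with x hx hx' hd hd' hmem i hi
    have : fderiv ℝ (φ.trans χ) x = (fderiv ℝ χ (φ x)).comp (fderiv ℝ φ x) :=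
      fderiv_comp x (hx'.smooth.differentiableAt (by simp)) (hx.smooth.differentiableAt (by simp))
    rw [this]
    change LinearMap.det ((fderiv ℝ χ (φ x)).toLinearMap ∘ₗ (fderiv ℝ φ x).toLinearMap) = 1
    rw [LinearMap.det_comp]
    change (fderiv ℝ χ (φ x)).det * (fderiv ℝ φ x).det = 1
    rw [hd i hi, hd' _ (hmem i hi), one_mul]

/-! ### The action by pullback -/

theorem pullback_comp {φ χ : Space c → Space c} {A : Space c → LinearMap.BilinForm ℝ (Space c)}
    {x : Space c} (hφ : DifferentiableAt ℝ φ x) (hχ : DifferentiableAt ℝ χ (φ x)) :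
    pullback (χ ∘ φ) A x = pullback φ (pullback χ A) x := by
  simp only [pullback]
  rw [fderiv_comp x hχ hφ]
  rfl

theorem pullback_congr {φ : Space c → Space c} {A B : Space c → LinearMap.BilinForm ℝ (Space c)}
    (hφ : Tendsto φ (𝓝 0) (𝓝 0)) (h : A =ᶠ[𝓝 0] B) : pullback φ A =ᶠ[𝓝 0] pullback φ B := by
  filter_upwards [hφ.eventually h] with x hx
  simp only [pullback, hx]

theorem pullback_trans {φ χ : OpenPartialHomeomorph (Space c) (Space c)}
    (hφ : φ ∈ webGroup c) (hχ : χ ∈ webGroup c)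
    (A : Space c → LinearMap.BilinForm ℝ (Space c)) :
    pullback (φ.trans χ) A =ᶠ[𝓝 0] pullback φ (pullback χ A) := by
  filter_upwards [eventually_contDiffAt_of_mem_webGroup hφ,
    (tendsto_of_mem_webGroup hφ).eventually (eventually_contDiffAt_of_mem_webGroup hχ)]
    with x hx hx'
  exact pullback_comp (hx.differentiableAt (by simp)) (hx'.differentiableAt (by simp))

theorem pullback_of_eventuallyEq_id {φ : Space c → Space c} (h : φ =ᶠ[𝓝 0] id)
    (A : Space c → LinearMap.BilinForm ℝ (Space c)) : pullback φ A =ᶠ[𝓝 0] A := by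
  filter_upwards [h.eventuallyEq_nhds] with x hx
  simp only [pullback]
  rw [hx.fderiv_eq, fderiv_id, hx.eq_of_nhds]
  rfl

/-- The identities need no direct verification: if `u` is a potential of `A`, then `u ∘ φ` is one of
the pullback, and every mixed Hessian satisfies them. -/
theorem exists_pullback_nonuniformityTensor {φ : OpenPartialHomeomorph (Space c) (Space c)}
    (hφ : φ ∈ webGroup c) (A : NonuniformityTensor c) :
    ∃ B : NonuniformityTensor c, B.toFun =ᶠ[𝓝 0] pullback φ A.toFun := by
  obtain ⟨u, hu, hA, -⟩ := A.exists_potential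
  obtain ⟨σ, hσ⟩ := (mem_webGroup_iff.1 hφ).2.2.2.2.1
  refine ⟨NonuniformityTensor.ofPotential (fun x => u (φ x)) ?_, ?_⟩
  · filter_upwards [eventually_contDiffAt_of_mem_webGroup hφ] with x hx
    exact ContDiffAt.comp (g := u) x hu.contDiffAt hx
  · refine EventuallyEq.trans ?_ (pullback_congr (tendsto_of_mem_webGroup hφ) hA.symm)
    filter_upwards [hσ.eventually_nhds] with x hx
    exact mixedHess_comp hx (Eventually.of_forall fun z => hu.contDiffAt)

theorem sameOrbit_equivalence : Equivalence (SameOrbit (c := c)) where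
  refl A := ⟨_, refl_mem_webGroup,
    (pullback_of_eventuallyEq_id (EventuallyEq.refl _ _) A.toFun).symm⟩
  symm := by
    rintro A B ⟨φ, hφ, hA⟩
    refine ⟨φ.symm, symm_mem_webGroup hφ, ?_⟩
    have h1 := pullback_congr (tendsto_of_mem_webGroup (symm_mem_webGroup hφ)) hA
    have h2 := pullback_trans (symm_mem_webGroup hφ) hφ B.toFun
    have h3 : φ.symm.trans φ =ᶠ[𝓝 0] id := by
      filter_upwards [φ.open_target.mem_nhds (symm_mem_webGroup hφ).1] with x hx
      exact φ.right_inv hx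
    exact (pullback_of_eventuallyEq_id h3 B.toFun).symm.trans (h2.trans h1.symm)
  trans := by
    rintro A B C ⟨φ, hφ, hA⟩ ⟨χ, hχ, hB⟩
    refine ⟨φ.trans χ, trans_mem_webGroup hφ hχ, hA.trans ?_⟩
    exact (pullback_congr (tendsto_of_mem_webGroup hφ) hB).trans
      (pullback_trans hφ hχ C.toFun).symm

end WebGroup

/-! ### Charts, transition maps and densities -/

section Charts

variable {n : ℕ} {c : Fin n → ℕ} {M : Type*} [TopologicalSpace M] [ChartedSpace (Space c) M]

section Transition

variable {ψ ψ' : OpenPartialHomeomorph M (Space c)}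

theorem mdifferentiable_of_mem_maximalAtlas
    (hψ : ψ ∈ IsManifold.maximalAtlas 𝓘(ℝ, Space c) ∞ M) :
    ψ.MDifferentiable 𝓘(ℝ, Space c) 𝓘(ℝ, Space c) :=
  ⟨(contMDiffOn_of_mem_maximalAtlas hψ).mdifferentiableOn (by simp),
    (contMDiffOn_symm_of_mem_maximalAtlas hψ).mdifferentiableOn (by simp)⟩

theorem contDiffAt_transition (hψ : ψ ∈ IsManifold.maximalAtlas 𝓘(ℝ, Space c) ∞ M)
    (hψ' : ψ' ∈ IsManifold.maximalAtlas 𝓘(ℝ, Space c) ∞ M) {θ : M → M} {y : Space c}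
    (hy : y ∈ ψ.target)
    (hθ : ContMDiffAt 𝓘(ℝ, Space c) 𝓘(ℝ, Space c) ∞ θ (ψ.symm y))
    (hθy : θ (ψ.symm y) ∈ ψ'.source) : ContDiffAt ℝ ∞ (ψ' ∘ θ ∘ ψ.symm) y :=
  ((contMDiffAt_of_mem_maximalAtlas hψ' hθy).comp y
    (hθ.comp y (contMDiffAt_symm_of_mem_maximalAtlas hψ hy))).contDiffAt

theorem density_apply (Ω : ∀ x : M, TangentSpace 𝓘(ℝ, Space c) x [⋀^Fin (∑ i, c i)]→ₗ[ℝ] ℝ)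
    (y : Space c) : density Ω ψ y =
      Ω (ψ.symm y) (fun k => mfderiv 𝓘(ℝ, Space c) 𝓘(ℝ, Space c) ψ.symm y (ex c k)) := rfl

/-- All tangent spaces are definitionally the model space. This allows the base point of a form to
be changed without transporting the vectors. -/
theorem form_congr (Ω : ∀ x : M, TangentSpace 𝓘(ℝ, Space c) x [⋀^Fin (∑ i, c i)]→ₗ[ℝ] ℝ)
    {x x' : M} (h : x = x') (v : Fin (∑ i, c i) → Space c) : Ω x v = Ω x' v := by
  subst h
  rfl

theorem coordForm_eq_iff
    {Ω : ∀ x : M, TangentSpace 𝓘(ℝ, Space c) x [⋀^Fin (∑ i, c i)]→ₗ[ℝ] ℝ} {y : Space c} :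
    coordForm Ω ψ y = unitVol c ↔ density Ω ψ y = 1 := by
  rw [eq_iff_apply_ex, unitVol_ex]
  rfl

theorem mfderiv_symm_mfderiv (hψ : ψ ∈ IsManifold.maximalAtlas 𝓘(ℝ, Space c) ∞ M) {x : M}
    (hx : x ∈ ψ.source) (v : Space c) :
    mfderiv 𝓘(ℝ, Space c) 𝓘(ℝ, Space c) ψ.symm (ψ x)
      (mfderiv 𝓘(ℝ, Space c) 𝓘(ℝ, Space c) ψ x v) = v :=
  congrArg (fun f : Space c →L[ℝ] Space c => f v)
    ((mdifferentiable_of_mem_maximalAtlas hψ).symm_comp_deriv hx)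

theorem mfderiv_mfderiv_symm (hψ : ψ ∈ IsManifold.maximalAtlas 𝓘(ℝ, Space c) ∞ M) {y : Space c}
    (hy : y ∈ ψ.target) (v : Space c) :
    mfderiv 𝓘(ℝ, Space c) 𝓘(ℝ, Space c) ψ (ψ.symm y)
      (mfderiv 𝓘(ℝ, Space c) 𝓘(ℝ, Space c) ψ.symm y v) = v :=
  congrArg (fun f : Space c →L[ℝ] Space c => f v)
    ((mdifferentiable_of_mem_maximalAtlas hψ).comp_symm_deriv hy)

/-- The map `θ` is included so that coordinate changes (`θ = id`) and coordinate expressions of web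
equivalences share one chain rule. -/
theorem fderiv_transition (hψ : ψ ∈ IsManifold.maximalAtlas 𝓘(ℝ, Space c) ∞ M)
    (hψ' : ψ' ∈ IsManifold.maximalAtlas 𝓘(ℝ, Space c) ∞ M) {θ : M → M} {y : Space c}
    (hy : y ∈ ψ.target)
    (hθ : MDifferentiableAt 𝓘(ℝ, Space c) 𝓘(ℝ, Space c) θ (ψ.symm y))
    (hθy : θ (ψ.symm y) ∈ ψ'.source) (v : Space c) :
    fderiv ℝ (ψ' ∘ θ ∘ ψ.symm) y v =
      mfderiv 𝓘(ℝ, Space c) 𝓘(ℝ, Space c) ψ' (θ (ψ.symm y))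
        (mfderiv 𝓘(ℝ, Space c) 𝓘(ℝ, Space c) θ (ψ.symm y)
          (mfderiv 𝓘(ℝ, Space c) 𝓘(ℝ, Space c) ψ.symm y v)) := by
  have h1 := (mdifferentiable_of_mem_maximalAtlas hψ).mdifferentiableAt_symm hy
  have h2 := (mdifferentiable_of_mem_maximalAtlas hψ').mdifferentiableAt hθy
  rw [← mfderiv_eq_fderiv, mfderiv_comp y (I' := 𝓘(ℝ, Space c)) h2 (hθ.comp y h1),
    mfderiv_comp y (I' := 𝓘(ℝ, Space c)) hθ h1]
  rfl

theorem det_ne_zero_of_injective {f : Space c →L[ℝ] Space c} (hf : Function.Injective f) :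
    f.det ≠ 0 := by
  intro h
  have := LinearMap.bot_lt_ker_of_det_eq_zero (f := f.toLinearMap) h
  rw [LinearMap.ker_eq_bot.2 hf] at this
  exact lt_irrefl _ this

theorem injective_fderiv_transition (hψ : ψ ∈ IsManifold.maximalAtlas 𝓘(ℝ, Space c) ∞ M)
    (hψ' : ψ' ∈ IsManifold.maximalAtlas 𝓘(ℝ, Space c) ∞ M) {θ : M → M} {y : Space c}
    (hy : y ∈ ψ.target)
    (hθ : MDifferentiableAt 𝓘(ℝ, Space c) 𝓘(ℝ, Space c) θ (ψ.symm y))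
    (hinj : Function.Injective (mfderiv 𝓘(ℝ, Space c) 𝓘(ℝ, Space c) θ (ψ.symm y)))
    (hθy : θ (ψ.symm y) ∈ ψ'.source) :
    Function.Injective (fderiv ℝ (ψ' ∘ θ ∘ ψ.symm) y) := by
  intro v w hvw
  rw [fderiv_transition hψ hψ' hy hθ hθy, fderiv_transition hψ hψ' hy hθ hθy] at hvw
  have h1 := hinj ((mdifferentiable_of_mem_maximalAtlas hψ').mfderiv_injective hθy hvw)
  have h2 := congrArg (mfderiv 𝓘(ℝ, Space c) 𝓘(ℝ, Space c) ψ (ψ.symm y)) h1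
  rwa [mfderiv_mfderiv_symm hψ hy, mfderiv_mfderiv_symm hψ hy] at h2

/-- Block `i` is the foliation `σ₁ i` in the first chart; `θ` carries it to `ρ (σ₁ i)`, which is
block `σ₂⁻¹ (ρ (σ₁ i))` in the second. -/
theorem isWebMapAt_transition {W : RegularWeb c M}
    (hψ : ψ ∈ IsManifold.maximalAtlas 𝓘(ℝ, Space c) ∞ M)
    (hψ' : ψ' ∈ IsManifold.maximalAtlas 𝓘(ℝ, Space c) ∞ M) {θ : M → M} {y : Space c}
    (hy : y ∈ ψ.target)
    (hθ : ContMDiffAt 𝓘(ℝ, Space c) 𝓘(ℝ, Space c) ∞ θ (ψ.symm y))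
    (hinj : Function.Injective (mfderiv 𝓘(ℝ, Space c) 𝓘(ℝ, Space c) θ (ψ.symm y)))
    (hθy : θ (ψ.symm y) ∈ ψ'.source) {σ₁ σ₂ ρ : Equiv.Perm (Fin n)}
    (h₁ : ∀ i, W.tangent (σ₁ i) (ψ.symm y) = (stdTangent c i).comap
      (mfderiv 𝓘(ℝ, Space c) 𝓘(ℝ, Space c) ψ (ψ.symm y)).toLinearMap)
    (h₂ : ∀ i, W.tangent (σ₂ i) (θ (ψ.symm y)) = (stdTangent c i).comap
      (mfderiv 𝓘(ℝ, Space c) 𝓘(ℝ, Space c) ψ' (θ (ψ.symm y))).toLinearMap)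
    (hmap : ∀ i, (W.tangent i (ψ.symm y)).map
      (mfderiv 𝓘(ℝ, Space c) 𝓘(ℝ, Space c) θ (ψ.symm y)).toLinearMap =
        W.tangent (ρ i) (θ (ψ.symm y))) :
    IsWebMapAt (σ₁.trans (ρ.trans σ₂.symm)) (ψ' ∘ θ ∘ ψ.symm) y := by
  have hθd := hθ.mdifferentiableAt (by simp)
  refine ⟨contDiffAt_transition hψ hψ' hy hθ hθy, det_ne_zero_of_injective
    (injective_fderiv_transition hψ hψ' hy hθd hinj hθy), fun i => ?_⟩
  have hj : W.tangent (ρ (σ₁ i)) (θ (ψ.symm y)) =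
      (stdTangent c (σ₂.symm (ρ (σ₁ i)))).comap
        (mfderiv 𝓘(ℝ, Space c) 𝓘(ℝ, Space c) ψ' (θ (ψ.symm y))).toLinearMap := by
    rw [← h₂, σ₂.apply_symm_apply]
  change _ = stdTangent c (σ₂.symm (ρ (σ₁ i)))
  apply le_antisymm
  · rintro _ ⟨v, hv, rfl⟩
    change fderiv ℝ (ψ' ∘ θ ∘ ψ.symm) y v ∈ _
    rw [fderiv_transition hψ hψ' hy hθd hθy]
    have hv' : mfderiv 𝓘(ℝ, Space c) 𝓘(ℝ, Space c) ψ.symm y v ∈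
        W.tangent (σ₁ i) (ψ.symm y) := by
      rw [h₁]
      change mfderiv 𝓘(ℝ, Space c) 𝓘(ℝ, Space c) ψ (ψ.symm y) _ ∈ stdTangent c i
      rw [mfderiv_mfderiv_symm hψ hy]
      exact hv
    have := Submodule.mem_map_of_mem
      (f := (mfderiv 𝓘(ℝ, Space c) 𝓘(ℝ, Space c) θ (ψ.symm y)).toLinearMap) hv'
    rw [hmap, hj] at this
    exact this
  · intro w hw
    let w' : TangentSpace 𝓘(ℝ, Space c) (θ (ψ.symm y)) :=
      mfderiv 𝓘(ℝ, Space c) 𝓘(ℝ, Space c) ψ'.symm (ψ' (θ (ψ.symm y))) w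
    have hw' : mfderiv 𝓘(ℝ, Space c) 𝓘(ℝ, Space c) ψ' (θ (ψ.symm y)) w' = w := by
      have := mfderiv_mfderiv_symm hψ' (ψ'.map_source hθy) w
      rwa [ψ'.left_inv hθy] at this
    have hmem : w' ∈ W.tangent (ρ (σ₁ i)) (θ (ψ.symm y)) := by
      rw [hj]
      change mfderiv 𝓘(ℝ, Space c) 𝓘(ℝ, Space c) ψ' (θ (ψ.symm y)) w' ∈ stdTangent c _
      rw [hw']
      exact hw
    rw [← hmap] at hmem
    obtain ⟨v', hv', hvw⟩ := hmem
    rw [h₁] at hv'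
    refine ⟨mfderiv 𝓘(ℝ, Space c) 𝓘(ℝ, Space c) ψ (ψ.symm y) v', hv', ?_⟩
    have h3 := mfderiv_symm_mfderiv hψ (ψ.map_target hy) v'
    rw [ψ.right_inv hy] at h3
    refine (fderiv_transition hψ hψ' hy hθd hθy _).trans (Eq.trans ?_ hw')
    exact congrArg (mfderiv 𝓘(ℝ, Space c) 𝓘(ℝ, Space c) ψ' (θ (ψ.symm y)))
      ((congrArg (mfderiv 𝓘(ℝ, Space c) 𝓘(ℝ, Space c) θ (ψ.symm y)) h3).trans hvw)

/-! ### Densities of volume forms in different charts -/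

theorem density_transition
    {Ω Ω' : ∀ x : M, TangentSpace 𝓘(ℝ, Space c) x [⋀^Fin (∑ i, c i)]→ₗ[ℝ] ℝ}
    (hψ : ψ ∈ IsManifold.maximalAtlas 𝓘(ℝ, Space c) ∞ M)
    (hψ' : ψ' ∈ IsManifold.maximalAtlas 𝓘(ℝ, Space c) ∞ M) {θ : M → M} {y : Space c}
    (hy : y ∈ ψ.target)
    (hθ : MDifferentiableAt 𝓘(ℝ, Space c) 𝓘(ℝ, Space c) θ (ψ.symm y))
    (hθy : θ (ψ.symm y) ∈ ψ'.source)
    (hΩ : (Ω' (θ (ψ.symm y))).compLinearMap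
      (mfderiv 𝓘(ℝ, Space c) 𝓘(ℝ, Space c) θ (ψ.symm y)).toLinearMap = Ω (ψ.symm y)) :
    density Ω ψ y = density Ω' ψ' ((ψ' ∘ θ ∘ ψ.symm) y) *
      (fderiv ℝ (ψ' ∘ θ ∘ ψ.symm) y).det := by
  rw [density, density, ← compLinearMap_apply_ex]
  change Ω (ψ.symm y) (fun k => mfderiv 𝓘(ℝ, Space c) 𝓘(ℝ, Space c) ψ.symm y (ex c k)) =
    Ω' (ψ'.symm (ψ' (θ (ψ.symm y)))) (fun k =>
      mfderiv 𝓘(ℝ, Space c) 𝓘(ℝ, Space c) ψ'.symm (ψ' (θ (ψ.symm y)))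
        (fderiv ℝ (ψ' ∘ θ ∘ ψ.symm) y (ex c k)))
  rw [← hΩ]
  refine Eq.trans ?_ (form_congr Ω' (ψ'.left_inv hθy).symm _)
  refine congrArg (Ω' (θ (ψ.symm y))) (funext fun k => ?_)
  refine (mfderiv_symm_mfderiv hψ' hθy _).symm.trans ?_
  exact congrArg (mfderiv 𝓘(ℝ, Space c) 𝓘(ℝ, Space c) ψ'.symm (ψ' (θ (ψ.symm y))))
    (fderiv_transition hψ hψ' hy hθ hθy _).symm

theorem density_change
    {Ω : ∀ x : M, TangentSpace 𝓘(ℝ, Space c) x [⋀^Fin (∑ i, c i)]→ₗ[ℝ] ℝ}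
    (hψ : ψ ∈ IsManifold.maximalAtlas 𝓘(ℝ, Space c) ∞ M)
    (hψ' : ψ' ∈ IsManifold.maximalAtlas 𝓘(ℝ, Space c) ∞ M) {y : Space c}
    (hy : y ∈ ψ.target) (hy' : ψ.symm y ∈ ψ'.source) :
    density Ω ψ y = density Ω ψ' ((ψ' ∘ ψ.symm) y) * (fderiv ℝ (ψ' ∘ ψ.symm) y).det :=
  density_transition (θ := id) hψ hψ' hy mdifferentiableAt_id hy' (by
    rw [mfderiv_id]
    rfl)

theorem form_eq_of_density_eq
    {Ω Ω' : ∀ x : M, TangentSpace 𝓘(ℝ, Space c) x [⋀^Fin (∑ i, c i)]→ₗ[ℝ] ℝ}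
    (hψ : ψ ∈ IsManifold.maximalAtlas 𝓘(ℝ, Space c) ∞ M) {x : M} (hx : x ∈ ψ.source)
    (h : density Ω ψ (ψ x) = density Ω' ψ (ψ x)) : Ω x = Ω' x := by
  have h0 : coordForm Ω ψ (ψ x) = coordForm Ω' ψ (ψ x) := eq_iff_apply_ex.2 h
  have h1 : ∀ (Θ : ∀ x : M, TangentSpace 𝓘(ℝ, Space c) x [⋀^Fin (∑ i, c i)]→ₗ[ℝ] ℝ)
      (v : Fin (∑ i, c i) → TangentSpace 𝓘(ℝ, Space c) x), coordForm Θ ψ (ψ x)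
      (fun k => mfderiv 𝓘(ℝ, Space c) 𝓘(ℝ, Space c) ψ x (v k)) = Θ x v := by
    intro Θ v
    change Θ (ψ.symm (ψ x)) (fun k => mfderiv 𝓘(ℝ, Space c) 𝓘(ℝ, Space c) ψ.symm (ψ x)
      (mfderiv 𝓘(ℝ, Space c) 𝓘(ℝ, Space c) ψ x (v k))) = Θ x v
    refine (form_congr Θ (ψ.left_inv hx) _).trans ?_
    exact congrArg (Θ x) (funext fun k => mfderiv_symm_mfderiv hψ hx (v k))
  ext v
  rw [← h1 Ω, ← h1 Ω', h0]

theorem density_ne_zero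
    {Ω : ∀ x : M, TangentSpace 𝓘(ℝ, Space c) x [⋀^Fin (∑ i, c i)]→ₗ[ℝ] ℝ}
    (hψ : ψ ∈ IsManifold.maximalAtlas 𝓘(ℝ, Space c) ∞ M) {x : M} (hx : x ∈ ψ.source)
    (hΩ : Ω x ≠ 0) : density Ω ψ (ψ x) ≠ 0 := fun h =>
  hΩ (form_eq_of_density_eq (Ω' := fun _ => 0) hψ hx h)

variable [IsManifold 𝓘(ℝ, Space c) ∞ M]

/-- `VolumeForm` asks for smoothness only in the preferred chart at `p`. The neighbourhood obtained
here does not depend on the chart `χ`, as is required because `nonuniformity` selects a chart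
separately at each point. -/
theorem VolumeForm.eventually_density {p : M} (Ω : VolumeForm c p) :
    ∀ᶠ x in 𝓝 p, ∀ χ ∈ IsManifold.maximalAtlas 𝓘(ℝ, Space c) ∞ M, x ∈ χ.source →
      ContDiffAt ℝ ∞ (density Ω.toFun χ) (χ x) ∧ density Ω.toFun χ (χ x) ≠ 0 := by
  have hlim := ((chartAt (Space c) p).continuousAt (mem_chart_source _ p)).tendsto
  filter_upwards [(chartAt (Space c) p).open_source.mem_nhds (mem_chart_source _ p), Ω.ne_zero,
    hlim.eventually Ω.smooth] with x hx h0 hs χ hχ hxχ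
  refine ⟨?_, density_ne_zero hχ hxχ h0⟩
  have hc : chartAt (Space c) p ∈ IsManifold.maximalAtlas 𝓘(ℝ, Space c) ∞ M :=
    IsManifold.chart_mem_maximalAtlas p
  have hτ : ContDiffAt ℝ ∞ (chartAt (Space c) p ∘ χ.symm) (χ x) :=
    contDiffAt_transition (θ := id) hχ hc (χ.map_source hxχ) contMDiffAt_id
      (by rwa [χ.left_inv hxχ])
  have h1 : density Ω.toFun χ =ᶠ[𝓝 (χ x)] fun y =>
      density Ω.toFun (chartAt (Space c) p) ((chartAt (Space c) p ∘ χ.symm) y) *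
        (fderiv ℝ (chartAt (Space c) p ∘ χ.symm) y).det := by
    have hsrc : ∀ᶠ y in 𝓝 (χ x), χ.symm y ∈ (chartAt (Space c) p).source := by
      refine (χ.continuousAt_symm (χ.map_source hxχ)).eventually ?_
      rw [χ.left_inv hxχ]
      exact (chartAt (Space c) p).open_source.mem_nhds hx
    filter_upwards [χ.open_target.mem_nhds (χ.map_source hxχ), hsrc] with y hy hys
    exact density_change hχ hc hy hys
  refine ContDiffAt.congr_of_eventuallyEq ?_ h1
  refine ContDiffAt.mul (ContDiffAt.comp (g := density Ω.toFun (chartAt (Space c) p))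
    (χ x) ?_ hτ) (contDiffAt_det_fderiv hτ)
  rwa [Function.comp_apply, χ.left_inv hxχ]

theorem VolumeForm.eventually_density_chart {p : M} (Ω : VolumeForm c p) :
    ∀ᶠ x in 𝓝 p, ∀ χ ∈ IsManifold.maximalAtlas 𝓘(ℝ, Space c) ∞ M, x ∈ χ.source →
      ∀ᶠ y in 𝓝 (χ x), ContDiffAt ℝ ∞ (density Ω.toFun χ) y ∧ density Ω.toFun χ y ≠ 0 := by
  filter_upwards [Ω.eventually_density.eventually_nhds] with x hx χ hχ hxχ
  have hlim : Tendsto χ.symm (𝓝 (χ x)) (𝓝 x) := by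
    simpa [χ.left_inv hxχ] using (χ.continuousAt_symm (χ.map_source hxχ)).tendsto
  filter_upwards [hlim.eventually hx, χ.open_target.mem_nhds (χ.map_source hxχ)] with y hy hyt
  simpa [χ.right_inv hyt] using hy χ hχ (χ.map_target hyt)

end Transition

variable [IsManifold 𝓘(ℝ, Space c) ∞ M]

/-! ### Existence of charts with given germs -/

/-- The inverse function theorem, with the domain shrunk until `G` is smooth with invertible
derivative at every point of it. The inverse is then smooth on the whole target, as membership in
the maximal atlas requires. -/
theorem exists_openPartialHomeomorph {G : Space c → Space c} {y : Space c}
    (hG : ∀ᶠ z in 𝓝 y, ContDiffAt ℝ ∞ G z) (hdet : (fderiv ℝ G y).det ≠ 0) :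
    ∃ Φ : OpenPartialHomeomorph (Space c) (Space c), ⇑Φ = G ∧ y ∈ Φ.source ∧
      ContDiffOn ℝ ∞ Φ Φ.source ∧ ContDiffOn ℝ ∞ Φ.symm Φ.target := by
  have hequiv : ∀ z, (fderiv ℝ G z).det ≠ 0 →
      ∃ f' : Space c ≃L[ℝ] Space c, (f' : Space c →L[ℝ] Space c) = fderiv ℝ G z := fun z hz =>
    ⟨(LinearMap.equivOfDetNeZero (fderiv ℝ G z).toLinearMap hz).toContinuousLinearEquiv, rfl⟩
  have hy := hG.self_of_nhds
  obtain ⟨f', hf'⟩ := hequiv y hdet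
  have hd : HasFDerivAt G (f' : Space c →L[ℝ] Space c) y := by
    rw [hf']
    exact (hy.differentiableAt (by simp)).hasFDerivAt
  let Φ₀ := hy.toOpenPartialHomeomorph G hd (by simp)
  have hdet' : ∀ᶠ z in 𝓝 y, (fderiv ℝ G z).det ≠ 0 :=
    (contDiffAt_det_fderiv hy).continuousAt.eventually_ne hdet
  obtain ⟨s, hs, hso, hys⟩ := eventually_nhds_iff.1 (hG.and hdet')
  refine ⟨Φ₀.restrOpen s hso, rfl, ⟨hy.mem_toOpenPartialHomeomorph_source hd (by simp), hys⟩,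
    fun z hz => (hs z hz.2).1.contDiffWithinAt, fun w hw => ?_⟩
  have hz := (Φ₀.restrOpen s hso).map_target hw
  obtain ⟨g', hg'⟩ := hequiv _ (hs _ hz.2).2
  refine ContDiffAt.contDiffWithinAt
    ((Φ₀.restrOpen s hso).contDiffAt_symm (f₀' := g') hw ?_ (hs _ hz.2).1)
  rw [hg']
  exact ((hs _ hz.2).1.differentiableAt (by simp)).hasFDerivAt

theorem exists_box_subset {s : Set (Space c)} (hs : s ∈ 𝓝 (0 : Space c)) :
    ∃ r > 0, {y : Space c | ∀ k, -r < y k ∧ y k < r} ⊆ s := by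
  have h : (EuclideanSpace.equiv (Fin (∑ i, c i)) ℝ).symm ⁻¹' s ∈ 𝓝 0 := by
    refine (EuclideanSpace.equiv (Fin (∑ i, c i)) ℝ).symm.continuous.continuousAt.preimage_mem_nhds
      ?_
    rwa [map_zero]
  obtain ⟨r, hr, hrs⟩ := Metric.mem_nhds_iff.1 h
  refine ⟨r, hr, fun y hy => ?_⟩
  have : (EuclideanSpace.equiv (Fin (∑ i, c i)) ℝ) y ∈ Metric.ball 0 r := by
    rw [Metric.mem_ball, dist_pi_lt_iff hr]
    intro k
    simpa [Real.dist_eq, abs_lt] using hy k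
  exact hrs this

theorem isOpen_box (a b : Fin (∑ i, c i) → ℝ) :
    IsOpen {y : Space c | ∀ k, a k < y k ∧ y k < b k} := by
  simp only [ofPred_forall]
  refine isOpen_iInter_of_finite fun k => ?_
  have : Continuous fun y : Space c => y k := by fun_prop
  exact (isOpen_lt continuous_const this).inter (isOpen_lt this continuous_const)

/-- The inverse function theorem makes `g` a chart. It is then restricted to the preimage of a cube
so small that the straightening condition holds on all of it. -/
theorem exists_isAdapted_of_germ (W : RegularWeb c M) {g : M → Space c} {x : M} (hg0 : g x = 0)
    (hg : ∀ᶠ y in 𝓝 x, ContMDiffAt 𝓘(ℝ, Space c) 𝓘(ℝ, Space c) ∞ g y)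
    (hinj : Function.Injective (mfderiv 𝓘(ℝ, Space c) 𝓘(ℝ, Space c) g x))
    {σ : Equiv.Perm (Fin n)}
    (hσ : ∀ᶠ y in 𝓝 x, ∀ i, W.tangent (σ i) y =
      (stdTangent c i).comap (mfderiv 𝓘(ℝ, Space c) 𝓘(ℝ, Space c) g y).toLinearMap) :
    ∃ ψ, IsAdapted W x ψ ∧ ∀ y ∈ ψ.source, ψ y = g y := by
  let e := chartAt (Space c) x
  have he : e ∈ IsManifold.maximalAtlas 𝓘(ℝ, Space c) ∞ M := IsManifold.chart_mem_maximalAtlas x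
  have hx : x ∈ e.source := mem_chart_source _ x
  have hlim : Tendsto e.symm (𝓝 (e x)) (𝓝 x) := by
    simpa [e.left_inv hx] using (e.continuousAt_symm (e.map_source hx)).tendsto
  have hG : ∀ᶠ z in 𝓝 (e x), ContDiffAt ℝ ∞ (g ∘ e.symm) z := by
    filter_upwards [hlim.eventually hg, e.open_target.mem_nhds (e.map_source hx)] with z hz hzt
    exact (hz.comp z (contMDiffAt_symm_of_mem_maximalAtlas he hzt)).contDiffAt
  have hdet : (fderiv ℝ (g ∘ e.symm) (e x)).det ≠ 0 := by
    refine det_ne_zero_of_injective fun v w hvw => ?_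
    have h1 := (mdifferentiable_of_mem_maximalAtlas he).mdifferentiableAt_symm (e.map_source hx)
    have h2 : MDifferentiableAt 𝓘(ℝ, Space c) 𝓘(ℝ, Space c) g (e.symm (e x)) := by
      rw [e.left_inv hx]
      exact hg.self_of_nhds.mdifferentiableAt (by simp)
    rw [← mfderiv_eq_fderiv, mfderiv_comp (e x) (I' := 𝓘(ℝ, Space c)) h2 h1] at hvw
    have hinj' : Function.Injective
        (mfderiv 𝓘(ℝ, Space c) 𝓘(ℝ, Space c) g (e.symm (e x))) := by
      rw [e.left_inv hx]
      exact hinj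
    exact (mdifferentiable_of_mem_maximalAtlas he).symm.mfderiv_injective
      (e.map_source hx) (hinj' hvw)
  obtain ⟨Φ, hΦG, hΦs, hΦ, hΦ'⟩ := exists_openPartialHomeomorph hG hdet
  let ψ₀ := e.trans Φ
  have hψ₀ : ψ₀ ∈ IsManifold.maximalAtlas 𝓘(ℝ, Space c) ∞ M := by
    refine (IsManifold.mem_maximalAtlas_iff_contMDiffOn ψ₀).2 ⟨?_, ?_⟩
    · rw [OpenPartialHomeomorph.trans_source]
      exact hΦ.contMDiffOn.comp ((contMDiffOn_of_mem_maximalAtlas he).mono inter_subset_left)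
        fun z hz => hz.2
    · rw [OpenPartialHomeomorph.trans_target]
      exact (contMDiffOn_symm_of_mem_maximalAtlas he).comp
        (hΦ'.contMDiffOn.mono inter_subset_left) fun z hz => hz.2
  have hψ₀g : ∀ z ∈ ψ₀.source, ψ₀ z = g z := fun z hz => by
    change Φ (e z) = g z
    rw [hΦG, Function.comp_apply, e.left_inv hz.1]
  have hx₀ : x ∈ ψ₀.source := ⟨hx, hΦs⟩
  have hψ₀x : ψ₀ x = 0 := by rw [hψ₀g x hx₀, hg0]
  have h0t : (0 : Space c) ∈ ψ₀.target := hψ₀x ▸ ψ₀.map_source hx₀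
  have hlim₀ : Tendsto ψ₀.symm (𝓝 0) (𝓝 x) := by
    have := (ψ₀.continuousAt_symm h0t).tendsto
    rwa [← hψ₀x, ψ₀.left_inv hx₀, hψ₀x] at this
  obtain ⟨r, hr, hbox⟩ := exists_box_subset
    ((ψ₀.open_target.eventually_mem h0t).and (hlim₀.eventually hσ))
  let B : Set (Space c) := {y | ∀ k, -r < y k ∧ y k < r}
  have hB : IsOpen B := isOpen_box (fun _ => -r) (fun _ => r)
  have hs : IsOpen (ψ₀.source ∩ ψ₀ ⁻¹' B) := ψ₀.isOpen_inter_preimage hB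
  have hsrc : (ψ₀.restr (ψ₀.source ∩ ψ₀ ⁻¹' B)).source = ψ₀.source ∩ ψ₀ ⁻¹' B := by
    rw [OpenPartialHomeomorph.restr_source, hs.interior_eq, ← inter_assoc, inter_self]
  have hψψ : ∀ y ∈ (ψ₀.restr (ψ₀.source ∩ ψ₀ ⁻¹' B)).source,
      (ψ₀.restr (ψ₀.source ∩ ψ₀ ⁻¹' B)) y = g y := fun y hy => by
    rw [hsrc] at hy
    exact hψ₀g y hy.1
  refine ⟨ψ₀.restr (ψ₀.source ∩ ψ₀ ⁻¹' B), ⟨?_, ?_, hψ₀x, ⟨fun _ => -r, fun _ => r, ?_⟩, σ, ?_⟩,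
    hψψ⟩
  · exact restr_mem_maximalAtlas _ hψ₀ hs
  · rw [hsrc]
    refine ⟨hx₀, ?_⟩
    rw [mem_preimage, hψ₀x]
    exact fun k => ⟨by simpa using hr, by simpa using hr⟩
  · ext y
    constructor
    · intro hy
      have h1 := (ψ₀.restr (ψ₀.source ∩ ψ₀ ⁻¹' B)).map_target hy
      rw [hsrc] at h1
      have h2 := (ψ₀.restr (ψ₀.source ∩ ψ₀ ⁻¹' B)).right_inv hy
      have h3 := h1.2
      rw [mem_preimage] at h3
      rw [← h2]
      exact h3
    · intro hy
      have h1 := (hbox hy).1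
      have h2 : ψ₀.symm y ∈ (ψ₀.restr (ψ₀.source ∩ ψ₀ ⁻¹' B)).source := by
        rw [hsrc]
        refine ⟨ψ₀.map_target h1, ?_⟩
        rw [mem_preimage, ψ₀.right_inv h1]
        exact hy
      have h3 := (ψ₀.restr (ψ₀.source ∩ ψ₀ ⁻¹' B)).map_source h2
      have h4 : (ψ₀.restr (ψ₀.source ∩ ψ₀ ⁻¹' B)) (ψ₀.symm y) = y := ψ₀.right_inv h1
      rwa [h4] at h3
  · intro y hy i
    have heq : (ψ₀.restr (ψ₀.source ∩ ψ₀ ⁻¹' B)) =ᶠ[𝓝 y] g :=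
      ((OpenPartialHomeomorph.open_source _).eventually_mem hy).mono hψψ
    rw [heq.mfderiv_eq]
    rw [hsrc] at hy
    have := (hbox hy.2).2 i
    rwa [ψ₀.left_inv hy.1] at this

end Charts

/-! ### Web-preserving maps with prescribed Jacobian along the leaves -/

section Normalization

variable {n : ℕ} {c : Fin n → ℕ}

/-- The fibrewise Poincaré lemma for the projection to a single axis, where closedness is automatic.
-/
theorem exists_primitive_along_ex {g : Space c → ℝ}
    (hg : ∀ᶠ x in 𝓝 (0 : Space c), ContDiffAt ℝ ∞ g x) (k : Fin (∑ i, c i)) :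
    ∃ b : Space c → ℝ, ContDiff ℝ ∞ b ∧ (∀ᶠ x in 𝓝 0, fderiv ℝ b x (ex c k) = g x) ∧
      ∀ x : Space c, x k = 0 → b x = 0 := by
  let Q : Space c →L[ℝ] Space c :=
    (EuclideanSpace.proj k : Space c →L[ℝ] ℝ).smulRight (ex c k)
  have hQ : ∀ x, Q x = x k • ex c k := fun x => rfl
  have hk : ex c k k = 1 := by simp [ex_apply]
  have hQe : Q (ex c k) = ex c k := by rw [hQ, hk, one_smul]
  obtain ⟨b, hb, hb', hb0⟩ := exists_fiberwise_primitive Q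
    (fun x => by rw [hQ x, map_smul, hQe])
    (α := fun x => g x • (EuclideanSpace.proj k : Space c →L[ℝ] ℝ))
    (hg.mono fun x hx => hx.smul contDiffAt_const)
    (Eventually.of_forall fun x v w => by
      simp only [hQ, map_smul, smul_apply, smul_eq_mul]
      ring)
  refine ⟨b, hb, ?_, fun x hx => hb0 x (by rw [hQ, hx, zero_smul])⟩
  filter_upwards [hb'] with x hx
  have := hx (ex c k)
  rw [hQe] at this
  rw [this, smul_apply]
  simp [hk]

/-- The pivot of a block of coordinates is its first coordinate. -/
def IsPivot (k : Fin (∑ i, c i)) : Prop := ∀ l, block c l = block c k → k ≤ l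

theorem exists_isPivot (k : Fin (∑ i, c i)) : ∃ l, IsPivot l ∧ block c l = block c k := by
  obtain ⟨l, hl, hmin⟩ := Finset.exists_min_image
    (Finset.univ.filter fun l => block c l = block c k) id ⟨k, by simp⟩
  rw [Finset.mem_filter] at hl
  refine ⟨l, fun j hj => hmin j ?_, hl.2⟩
  rw [Finset.mem_filter]
  exact ⟨Finset.mem_univ _, hj.trans hl.2⟩

theorem IsPivot.eq {k l : Fin (∑ i, c i)} (hk : IsPivot k) (hl : IsPivot l)
    (h : block c k = block c l) : k = l :=
  le_antisymm (hk l h.symm) (hl k h)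

open Classical in
-- A nonempty block has exactly one pivot. The hypothesis `hi` takes care of an empty block, that
-- is, a foliation of codimension `0`.
theorem prod_pivot {r : Fin n → ℝ} {i : Fin n} (hr : ∀ j, j ≠ i → r j = 1)
    (hi : (∀ k, block c k ≠ i) → r i = 1) :
    ∏ k : Fin (∑ i, c i), (if IsPivot k then r (block c k) else 1) = r i := by
  by_cases h : ∃ k, block c k = i
  · obtain ⟨k, rfl⟩ := h
    obtain ⟨l, hl, hlk⟩ := exists_isPivot k
    rw [Finset.prod_eq_single l]
    · rw [if_pos hl, hlk]
    · intro j _ hj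
      split_ifs with hp
      · exact hr _ fun e => hj (hp.eq hl (e.trans hlk.symm))
      · rfl
    · simp
  · push Not at h
    rw [hi h]
    refine Finset.prod_eq_one fun k _ => ?_
    split_ifs
    · exact hr _ (h k)
    · rfl

open Classical in
-- In each block only the pivot coordinate is changed: it becomes a primitive, in the pivot
-- direction, of `h / h 0` restricted to the leaf of that block. The Jacobian is then a product of
-- one factor per nonempty block. Along a leaf all factors but one are `h 0 / h 0 = 1`, and an
-- overall constant `h 0` restores the value `h`.
theorem exists_webMap_with_det (hm : 0 < ∑ i, c i) {h : Space c → ℝ}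
    (hh : ∀ᶠ x in 𝓝 (0 : Space c), ContDiffAt ℝ ∞ h x) (h0 : h 0 ≠ 0) :
    ∃ Φ : Space c → Space c, Φ 0 = 0 ∧ (∀ᶠ x in 𝓝 0, IsWebMapAt 1 Φ x) ∧
      ∀ᶠ x in 𝓝 (0 : Space c), ∀ i, x ∈ stdCompl c i → (fderiv ℝ Φ x).det = h x := by
  obtain ⟨k₀, hk₀, -⟩ := exists_isPivot (c := c) ⟨0, hm⟩
  have hP : ∀ i, Tendsto (blockProj c i) (𝓝 0) (𝓝 0) := fun i => by
    simpa using (blockProj c i).continuous.tendsto 0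
  -- The constant `h 0`, possibly negative, is put into the one distinguished pivot `k₀`.
  choose b hb hb' hb0 using fun k => exists_primitive_along_ex (c := c)
    (g := fun x => h x / h 0 * if k = k₀ then h 0 else 1)
    (hh.mono fun x hx => (hx.div_const _).mul contDiffAt_const) k
  let f : Fin (∑ i, c i) → Space c → ℝ := fun k x =>
    if IsPivot k then b k (blockProj c (block c k) x) else x k
  have hf : ∀ k, ContDiff ℝ ∞ (f k) := fun k => by
    by_cases hk : IsPivot k
    · simp only [f, if_pos hk]
      exact (hb k).comp (blockProj c (block c k)).contDiff
    · simp only [f, if_neg hk]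
      exact (EuclideanSpace.proj k : Space c →L[ℝ] ℝ).contDiff
  let Φ : Space c → Space c := fun x => WithLp.toLp 2 fun k => f k x
  have hΦ : ContDiff ℝ ∞ Φ := contDiff_euclidean.2 hf
  have hD : ∀ x v k, fderiv ℝ Φ x v k = fderiv ℝ (f k) x v := fun x v k => by
    have h1 : HasFDerivAt (f k) ((EuclideanSpace.proj k : Space c →L[ℝ] ℝ).comp (fderiv ℝ Φ x)) x :=
      (EuclideanSpace.proj k : Space c →L[ℝ] ℝ).hasFDerivAt.comp x
        (hΦ.differentiable (by simp) x).hasFDerivAt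
    rw [h1.fderiv]
    rfl
  have hDpivot : ∀ x v k, IsPivot k → fderiv ℝ Φ x v k =
      fderiv ℝ (b k) (blockProj c (block c k) x) (blockProj c (block c k) v) := fun x v k hk => by
    have h1 : HasFDerivAt (f k) ((fderiv ℝ (b k) (blockProj c (block c k) x)).comp
        (blockProj c (block c k))) x := by
      simp only [f, if_pos hk]
      exact ((hb k).differentiable (by simp) _).hasFDerivAt.comp x
        (blockProj c (block c k)).hasFDerivAt
    rw [hD, h1.fderiv]
    rfl
  have hDnot : ∀ x v k, ¬ IsPivot k → fderiv ℝ Φ x v k = v k := fun x v k hk => by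
    have h1 : HasFDerivAt (f k) (EuclideanSpace.proj k : Space c →L[ℝ] ℝ) x := by
      simp only [f, if_neg hk]
      exact (EuclideanSpace.proj k : Space c →L[ℝ] ℝ).hasFDerivAt
    rw [hD, h1.fderiv]
    rfl
  have hdet : ∀ᶠ x in 𝓝 (0 : Space c), (fderiv ℝ Φ x).det =
      (∏ k, if IsPivot k then h (blockProj c (block c k) x) / h 0 else 1) * h 0 := by
    have hb'' := eventually_all.2 fun k => (hP (block c k)).eventually (hb' k)
    filter_upwards [hb''] with x hx
    -- A pivot is the least index of its block, so the row of a pivot is supported on and above the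
    -- diagonal; every other row is a unit vector.
    rw [det_eq_matrix_det, Matrix.det_of_isUpperTriangular]
    · have hk0 : h 0 = ∏ k, if k = k₀ then h 0 else 1 := by simp
      conv_rhs => rw [hk0]
      rw [← Finset.prod_mul_distrib]
      refine Finset.prod_congr rfl fun k _ => ?_
      rw [Matrix.of_apply]
      by_cases hk : IsPivot k
      · rw [hDpivot x _ k hk, blockProj_of_mem (ex_mem_stdCompl k), hx k, if_pos hk, ← hk0]
      · rw [hDnot x _ k hk, if_neg hk,
          if_neg (fun e : k = k₀ => hk (e ▸ hk₀))]
        simp [ex_apply]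
    · intro k l hlk
      rw [Matrix.of_apply]
      by_cases hk : IsPivot k
      · have hne : block c l ≠ block c k := fun e => not_le_of_gt hlk (hk l e)
        rw [hDpivot x _ k hk, blockProj_of_mem_of_ne hne (ex_mem_stdCompl l), map_zero]
      · rw [hDnot x _ k hk, ex_apply, if_neg (ne_of_gt (show l < k from hlk))]
  have hleaf : ∀ᶠ x in 𝓝 (0 : Space c), ∀ i, x ∈ stdCompl c i → (fderiv ℝ Φ x).det = h x := by
    filter_upwards [hdet] with x hx i hi
    rw [hx, prod_pivot (r := fun j => h (blockProj c j x) / h 0) (i := i)]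
    · rw [blockProj_of_mem hi, div_mul_cancel₀ _ h0]
    · intro j hj
      rw [blockProj_of_mem_of_ne (Ne.symm hj) hi, div_self h0]
    -- The leaf of an empty block is the origin alone, where the missing factor would have been `1`.
    · intro hempty
      have : x = 0 := by
        ext k
        exact mem_stdCompl.1 hi k (hempty k)
      rw [this, map_zero, div_self h0]
  have hdet0 : (fderiv ℝ Φ 0).det ≠ 0 := by
    rw [hleaf.self_of_nhds (block c k₀) (Submodule.zero_mem _)]
    exact h0
  refine ⟨Φ, ?_, ?_, hleaf⟩
  · ext k
    change f k 0 = 0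
    by_cases hk : IsPivot k
    · simp only [f, if_pos hk, map_zero]
      exact hb0 k 0 rfl
    · simp only [f, if_neg hk]
      rfl
  · filter_upwards [(contDiffAt_det_fderiv hΦ.contDiffAt).continuousAt.eventually_ne hdet0]
      with x hx
    refine ⟨hΦ.contDiffAt, hx, fun i => ?_⟩
    have hle : (stdTangent c i).map (fderiv ℝ Φ x).toLinearMap ≤ stdTangent c i := by
      rintro _ ⟨v, hv, rfl⟩
      refine mem_stdTangent.2 fun k hk => ?_
      change fderiv ℝ Φ x v k = 0
      by_cases hp : IsPivot k
      · have hv0 : blockProj c (block c k) v = 0 := by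
          ext l
          rw [blockProj_apply]
          split_ifs with hl
          · exact mem_stdTangent.1 hv l (hl.trans hk)
          · rfl
        rw [hDpivot x v k hp, hv0, map_zero]
      · rw [hDnot x v k hp]
        exact mem_stdTangent.1 hv k hk
    refine Submodule.eq_of_le_of_finrank_eq hle ?_
    exact (Submodule.equivMapOfInjective _ (injective_of_det_ne_zero hx) _).finrank_eq.symm

end Normalization

/-! ### Adapted and normalized charts -/

section AdaptedCharts

variable {n : ℕ} {c : Fin n → ℕ} {M : Type*} [TopologicalSpace M] [ChartedSpace (Space c) M]

theorem IsAdapted.tendsto_symm {W : RegularWeb c M} {x : M} {ψ : OpenPartialHomeomorph M (Space c)}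
    (h : IsAdapted W x ψ) : Tendsto ψ.symm (𝓝 0) (𝓝 x) := by
  have := (ψ.continuousAt_symm (ψ.map_source h.mem_source)).tendsto
  rwa [ψ.left_inv h.mem_source, h.map_point] at this

theorem IsAdapted.zero_mem_target {W : RegularWeb c M} {x : M}
    {ψ : OpenPartialHomeomorph M (Space c)} (h : IsAdapted W x ψ) : (0 : Space c) ∈ ψ.target :=
  h.map_point ▸ ψ.map_source h.mem_source

theorem IsAdapted.symm_zero {W : RegularWeb c M} {x : M} {ψ : OpenPartialHomeomorph M (Space c)}
    (h : IsAdapted W x ψ) : ψ.symm 0 = x := by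
  rw [← h.map_point, ψ.left_inv h.mem_source]

theorem IsAdapted.isWebMapAt_transition {W : RegularWeb c M} {x x' : M}
    {ψ ψ' : OpenPartialHomeomorph M (Space c)} (hψ : IsAdapted W x ψ) (hψ' : IsAdapted W x' ψ')
    {θ : M → M} {ρ : Equiv.Perm (Fin n)} {y : Space c} (hy : y ∈ ψ.target)
    (hθy : θ (ψ.symm y) ∈ ψ'.source)
    (hθ : ∀ᶠ z in 𝓝 (ψ.symm y), ContMDiffAt 𝓘(ℝ, Space c) 𝓘(ℝ, Space c) ∞ θ z ∧
      Function.Injective (mfderiv 𝓘(ℝ, Space c) 𝓘(ℝ, Space c) θ z) ∧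
      ∀ i, (W.tangent i z).map (mfderiv 𝓘(ℝ, Space c) 𝓘(ℝ, Space c) θ z).toLinearMap =
        W.tangent (ρ i) (θ z)) :
    ∃ σ, ∀ᶠ z in 𝓝 y, IsWebMapAt σ (ψ' ∘ θ ∘ ψ.symm) z := by
  obtain ⟨σ₁, h₁⟩ := hψ.straight
  obtain ⟨σ₂, h₂⟩ := hψ'.straight
  have hc := (ψ.continuousAt_symm hy).tendsto
  refine ⟨σ₁.trans (ρ.trans σ₂.symm), ?_⟩
  filter_upwards [ψ.open_target.mem_nhds hy, hc.eventually hθ,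
    hc.eventually (hθ.self_of_nhds.1.continuousAt.eventually (ψ'.open_source.eventually_mem hθy))]
    with z hz hθz hzs
  exact DivFreeWeb.isWebMapAt_transition hψ.mem_atlas hψ'.mem_atlas hz hθz.1 hθz.2.1 hzs
    (h₁ _ (ψ.map_target hz)) (h₂ _ hzs) hθz.2.2

theorem IsAdapted.isWebMapAt_change {W : RegularWeb c M} {x x' : M}
    {ψ ψ' : OpenPartialHomeomorph M (Space c)} (hψ : IsAdapted W x ψ) (hψ' : IsAdapted W x' ψ')
    {y : Space c} (hy : y ∈ ψ.target) (hy' : ψ.symm y ∈ ψ'.source) :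
    ∃ σ, ∀ᶠ z in 𝓝 y, IsWebMapAt σ (ψ' ∘ ψ.symm) z :=
  hψ.isWebMapAt_transition hψ' (θ := id) (ρ := 1) hy hy' (Eventually.of_forall fun z =>
    ⟨contMDiffAt_id, by
      rw [mfderiv_id]
      exact Function.injective_id, fun i => by
      rw [mfderiv_id]
      exact Submodule.map_id _⟩)

theorem isNormalized_iff {W : RegularWeb c M} {p : M} {Ω : VolumeForm c p}
    {ψ : OpenPartialHomeomorph M (Space c)} : IsNormalized W Ω ψ ↔ IsAdapted W p ψ ∧
      ∀ᶠ y in 𝓝 (0 : Space c), ∀ i, y ∈ stdCompl c i → density Ω.toFun ψ y = 1 := by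
  simp only [IsNormalized, coordForm_eq_iff]

variable [IsManifold 𝓘(ℝ, Space c) ∞ M]

/-- The coordinates are the components of the submersions that define the foliations near `x`. The
codimensions add up to the dimension, so general position makes the tangent spaces at `x` intersect
trivially. Hence the combined differential is injective there. -/
theorem exists_isAdapted (W : RegularWeb c M) (x : M) : ∃ ψ, IsAdapted W x ψ := by
  choose U f hU hxU hf hfU using fun i => W.isFoliation i x
  let j : (k : Fin (∑ i, c i)) → Fin (c (block c k)) := fun k => (finSigmaFinEquiv.symm k).2
  let g : M → Space c := fun y => WithLp.toLp 2 fun k => f (block c k) y (j k) -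
    f (block c k) x (j k)
  have hUx : ∀ᶠ y in 𝓝 x, ∀ i, y ∈ U i :=
    eventually_all.2 fun i => (hU i).eventually_mem (hxU i)
  have hfs : ∀ y i, y ∈ U i →
      ContMDiffAt 𝓘(ℝ, Space c) 𝓘(ℝ, EuclideanSpace ℝ (Fin (c i))) ∞ (f i) y := fun y i hy =>
    (hf i).contMDiffAt ((hU i).mem_nhds hy)
  have hTd : ∀ k, ContDiff ℝ ∞ fun z : EuclideanSpace ℝ (Fin (c (block c k))) =>
      z (j k) - f (block c k) x (j k) := fun k => by fun_prop
  have hg : ∀ y, (∀ i, y ∈ U i) → ContMDiffAt 𝓘(ℝ, Space c) 𝓘(ℝ, Space c) ∞ g y := by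
    intro y hy
    have h1 : ContMDiffAt 𝓘(ℝ, Space c) 𝓘(ℝ, Fin (∑ i, c i) → ℝ) ∞
        (fun y k => f (block c k) y (j k) - f (block c k) x (j k)) y := by
      refine contMDiffAt_pi_space.2 fun k => ?_
      exact (hTd k).contMDiff.contMDiffAt.comp y (hfs y _ (hy _))
    exact (EuclideanSpace.equiv (Fin (∑ i, c i)) ℝ).symm.contDiff.contMDiff.contMDiffAt.comp y h1
  have hgd : ∀ y, (∀ i, y ∈ U i) → ∀ (v : TangentSpace 𝓘(ℝ, Space c) y) k,
      (EuclideanSpace.proj k : Space c →L[ℝ] ℝ)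
        (mfderiv 𝓘(ℝ, Space c) 𝓘(ℝ, Space c) g y v) =
      (EuclideanSpace.proj (j k) : EuclideanSpace ℝ (Fin (c (block c k))) →L[ℝ] ℝ)
        (mfderiv 𝓘(ℝ, Space c) 𝓘(ℝ, EuclideanSpace ℝ (Fin (c (block c k))))
          (f (block c k)) y v) := by
    intro y hy v k
    have h1 : HasMFDerivAt 𝓘(ℝ, Space c) 𝓘(ℝ, ℝ)
        ((EuclideanSpace.proj k : Space c →L[ℝ] ℝ) ∘ g) y _ :=
      (EuclideanSpace.proj k : Space c →L[ℝ] ℝ).hasFDerivAt.hasMFDerivAt.comp y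
        ((hg y hy).mdifferentiableAt (by simp)).hasMFDerivAt
    have hT : HasFDerivAt (fun z : EuclideanSpace ℝ (Fin (c (block c k))) =>
        z (j k) - f (block c k) x (j k))
        (EuclideanSpace.proj (j k) : EuclideanSpace ℝ (Fin (c (block c k))) →L[ℝ] ℝ)
        (f (block c k) y) :=
      (EuclideanSpace.proj (j k) :
        EuclideanSpace ℝ (Fin (c (block c k))) →L[ℝ] ℝ).hasFDerivAt.sub_const _
    have h2 : HasMFDerivAt 𝓘(ℝ, Space c) 𝓘(ℝ, ℝ)
        ((EuclideanSpace.proj k : Space c →L[ℝ] ℝ) ∘ g) y _ :=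
      hT.hasMFDerivAt.comp y ((hfs y _ (hy _)).mdifferentiableAt (by simp)).hasMFDerivAt
    exact congrArg (fun L : Space c →L[ℝ] ℝ => L v) (hasMFDerivAt_unique h1 h2)
  have hgk : ∀ y, (∀ i, y ∈ U i) → ∀ i, W.tangent i y =
      (stdTangent c i).comap (mfderiv 𝓘(ℝ, Space c) 𝓘(ℝ, Space c) g y).toLinearMap := by
    intro y hy i
    rw [(hfU i y (hy i)).2]
    ext v
    rw [LinearMap.mem_ker]
    refine Iff.trans ?_ mem_stdTangent.symm
    constructor
    · rintro hv k rfl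
      exact (hgd y hy v k).trans
        (congrArg (fun z : EuclideanSpace ℝ (Fin (c (block c k))) => z (j k)) hv)
    · intro hv
      refine PiLp.ext fun a => ?_
      have hk : finSigmaFinEquiv.symm (finSigmaFinEquiv ⟨i, a⟩) = (⟨i, a⟩ : (i : Fin n) × Fin (c i)) :=
        finSigmaFinEquiv.symm_apply_apply _
      have h1 := (hgd y hy v (finSigmaFinEquiv ⟨i, a⟩)).symm.trans
        (hv _ (congrArg Sigma.fst hk))
      -- The target of `f s.1` depends on `s`, so the index is generalized before the equality `hk`
      -- is substituted.
      have key : ∀ s : (i : Fin n) × Fin (c i), s = ⟨i, a⟩ →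
          (EuclideanSpace.proj s.2 : EuclideanSpace ℝ (Fin (c s.1)) →L[ℝ] ℝ)
            (mfderiv 𝓘(ℝ, Space c) 𝓘(ℝ, EuclideanSpace ℝ (Fin (c s.1))) (f s.1) y v) = 0 →
          (EuclideanSpace.proj a : EuclideanSpace ℝ (Fin (c i)) →L[ℝ] ℝ)
            (mfderiv 𝓘(ℝ, Space c) 𝓘(ℝ, EuclideanSpace ℝ (Fin (c i))) (f i) y v) = 0 := by
        rintro _ rfl h
        exact h
      exact key _ hk h1
  have hker : ∀ v : TangentSpace 𝓘(ℝ, Space c) x, v ∈ ⨅ i, W.tangent i x → v = 0 := by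
    have hcod : ∀ i, Module.finrank ℝ (TangentSpace 𝓘(ℝ, Space c) x ⧸ W.tangent i x) = c i := by
      intro i
      rw [(hfU i x (hxU i)).2,
        ((mfderiv 𝓘(ℝ, Space c) 𝓘(ℝ, EuclideanSpace ℝ (Fin (c i))) (f i)
          x).toLinearMap.quotKerEquivOfSurjective (hfU i x (hxU i)).1).finrank_eq]
      exact finrank_euclideanSpace_fin
    have hgp := W.generalPosition x
    simp only [hcod] at hgp
    have hfin : FiniteDimensional ℝ (TangentSpace 𝓘(ℝ, Space c) x) :=
      inferInstanceAs (FiniteDimensional ℝ (Space c))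
    have htot : Module.finrank ℝ (TangentSpace 𝓘(ℝ, Space c) x) = ∑ i, c i :=
      (finrank_euclideanSpace_fin : Module.finrank ℝ (Space c) = ∑ i, c i)
    have hadd := Submodule.finrank_quotient_add_finrank (⨅ i, W.tangent i x)
    rw [hgp, htot] at hadd
    have hbot : (⨅ i, W.tangent i x) = ⊥ := Submodule.finrank_eq_zero.1 (by omega)
    intro v hv
    rwa [hbot, Submodule.mem_bot] at hv
  have hinj : Function.Injective (mfderiv 𝓘(ℝ, Space c) 𝓘(ℝ, Space c) g x) := by
    refine (injective_iff_map_eq_zero _).2 fun v hv => hker v ?_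
    rw [Submodule.mem_iInf]
    intro i
    rw [hgk x hxU i]
    change mfderiv 𝓘(ℝ, Space c) 𝓘(ℝ, Space c) g x v ∈ stdTangent c i
    rw [hv]
    exact Submodule.zero_mem _
  obtain ⟨ψ, hψ, -⟩ := exists_isAdapted_of_germ W (g := g) (x := x) (σ := 1)
    (by
      ext k
      exact sub_self _)
    (hUx.mono hg) hinj (hUx.mono hgk)
  exact ⟨ψ, hψ⟩

/-- In any adapted chart, the nonuniformity tensor is the mixed Hessian of the logarithm of the
density. -/
theorem IsAdapted.coordNonuniformity_eq {W : RegularWeb c M} {p : M} (Ω : VolumeForm c p)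
    {ψ : OpenPartialHomeomorph M (Space c)} (hψ : IsAdapted W p ψ) :
    coordNonuniformity W Ω.toFun ψ =ᶠ[𝓝 0] mixedLogHessian c (density Ω.toFun ψ) := by
  filter_upwards [hψ.tendsto_symm.eventually Ω.eventually_density_chart,
    ψ.open_target.mem_nhds hψ.zero_mem_target] with y hy hyt
  -- The definition uses an arbitrary adapted chart centred at the point itself, a possibly
  -- different one for each `y`. The transformation law from `ψ` to that chart removes the choice.
  have H : ∃ χ, IsAdapted W (ψ.symm y) χ := exists_isAdapted W _
  have hχ := H.choose_spec
  set χ := H.choose with hχdef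
  obtain ⟨σ, hσ⟩ := hψ.isWebMapAt_change hχ hyt hχ.mem_source
  have hdens : density Ω.toFun ψ =ᶠ[𝓝 y] fun z =>
      density Ω.toFun χ ((χ ∘ ψ.symm) z) * (fderiv ℝ (χ ∘ ψ.symm) z).det := by
    filter_upwards [ψ.open_target.mem_nhds hyt,
      (ψ.continuousAt_symm hyt).eventually (χ.open_source.eventually_mem hχ.mem_source)]
      with z hz hzs
    exact density_change hψ.mem_atlas hχ.mem_atlas hz hzs
  rw [mixedLogHessian_transform hσ (hy χ hχ.mem_atlas hχ.mem_source) hdens]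
  have hd : ∀ v : Space c, fderiv ℝ (χ ∘ ψ.symm) y v =
      mfderiv 𝓘(ℝ, Space c) 𝓘(ℝ, Space c) χ (ψ.symm y)
        (mfderiv 𝓘(ℝ, Space c) 𝓘(ℝ, Space c) ψ.symm y v) := fun v => by
    have := fderiv_transition hψ.mem_atlas hχ.mem_atlas (θ := id) hyt mdifferentiableAt_id
      hχ.mem_source v
    rwa [mfderiv_id] at this
  refine LinearMap.ext fun v => LinearMap.ext fun w => ?_
  rw [coordNonuniformity, nonuniformity, dif_pos H]
  change mixedLogHessian c (density Ω.toFun χ) (χ (ψ.symm y)) _ _ =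
    mixedLogHessian c (density Ω.toFun χ) (χ (ψ.symm y)) (fderiv ℝ (χ ∘ ψ.symm) y v)
      (fderiv ℝ (χ ∘ ψ.symm) y w)
  rw [hd, hd]
  rfl

theorem IsAdapted.eventually_density {W : RegularWeb c M} {p : M} (Ω : VolumeForm c p)
    {ψ : OpenPartialHomeomorph M (Space c)} (hψ : IsAdapted W p ψ) :
    ∀ᶠ y in 𝓝 0, ContDiffAt ℝ ∞ (density Ω.toFun ψ) y ∧ density Ω.toFun ψ y ≠ 0 := by
  have := Ω.eventually_density_chart.self_of_nhds ψ hψ.mem_atlas hψ.mem_source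
  rwa [hψ.map_point] at this

/-- An adapted chart is composed with a web-preserving `Φ` whose Jacobian equals the old density
along the leaves. The new density is the old one divided by this Jacobian, hence `1` there. -/
theorem exists_isNormalized (hm : 0 < ∑ i, c i) (W : RegularWeb c M) {p : M}
    (Ω : VolumeForm c p) : ∃ ψ, IsNormalized W Ω ψ := by
  obtain ⟨ψ, hψ⟩ := exists_isAdapted W p
  have hd := hψ.eventually_density Ω
  obtain ⟨Φ, hΦ0, hΦ, hdet⟩ := exists_webMap_with_det hm (hd.mono fun y hy => hy.1)
    hd.self_of_nhds.2
  have hlim : Tendsto ψ (𝓝 p) (𝓝 0) := by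
    have := (ψ.continuousAt hψ.mem_source).tendsto
    rwa [hψ.map_point] at this
  have hmd : ∀ y ∈ ψ.source, IsWebMapAt 1 Φ (ψ y) → ∀ v,
      mfderiv 𝓘(ℝ, Space c) 𝓘(ℝ, Space c) (Φ ∘ ψ) y v =
        fderiv ℝ Φ (ψ y) (mfderiv 𝓘(ℝ, Space c) 𝓘(ℝ, Space c) ψ y v) := fun y hy hyΦ v => by
    rw [mfderiv_comp y (I' := 𝓘(ℝ, Space c))
      (hyΦ.smooth.differentiableAt (by simp)).mdifferentiableAt
      ((mdifferentiable_of_mem_maximalAtlas hψ.mem_atlas).mdifferentiableAt hy),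
      mfderiv_eq_fderiv]
    rfl
  obtain ⟨σ, hσ⟩ := hψ.straight
  obtain ⟨ψ', hψ', hψΦ⟩ := exists_isAdapted_of_germ W (g := Φ ∘ ψ) (x := p) (σ := σ)
    (by rw [Function.comp_apply, hψ.map_point, hΦ0])
    (by
      filter_upwards [hlim.eventually hΦ, ψ.open_source.mem_nhds hψ.mem_source] with y hy hys
      exact hy.smooth.contMDiffAt.comp y (contMDiffAt_of_mem_maximalAtlas hψ.mem_atlas hys))
    (by
      intro v w hvw
      have h0 : IsWebMapAt 1 Φ (ψ p) := by
        rw [hψ.map_point]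
        exact hΦ.self_of_nhds
      rw [hmd p hψ.mem_source h0, hmd p hψ.mem_source h0] at hvw
      exact (mdifferentiable_of_mem_maximalAtlas hψ.mem_atlas).mfderiv_injective hψ.mem_source
        (injective_of_det_ne_zero h0.det_ne hvw))
    (by
      filter_upwards [hlim.eventually hΦ, ψ.open_source.mem_nhds hψ.mem_source] with y hy hys i
      rw [hσ y hys i]
      ext v
      change mfderiv 𝓘(ℝ, Space c) 𝓘(ℝ, Space c) ψ y v ∈ stdTangent c i ↔
        mfderiv 𝓘(ℝ, Space c) 𝓘(ℝ, Space c) (Φ ∘ ψ) y v ∈ stdTangent c i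
      rw [hmd y hys hy]
      refine ⟨fun h => hy.mem_stdTangent h, fun h => ?_⟩
      have h1 := h
      rw [show stdTangent c i = stdTangent c ((1 : Equiv.Perm (Fin n)) i) from rfl,
        ← hy.map_tangent i] at h1
      obtain ⟨w, hw, hwv⟩ := h1
      rw [← injective_of_det_ne_zero hy.det_ne hwv]
      exact hw)
  refine ⟨ψ', isNormalized_iff.2 ⟨hψ', ?_⟩⟩
  obtain ⟨σ', hσ'⟩ := hψ'.isWebMapAt_change hψ hψ'.zero_mem_target
    (by rw [hψ'.symm_zero]; exact hψ.mem_source)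
  have h00 : (ψ ∘ ψ'.symm) 0 = 0 := by
    rw [Function.comp_apply, hψ'.symm_zero, hψ.map_point]
  have hlim' : Tendsto (ψ ∘ ψ'.symm) (𝓝 0) (𝓝 0) := hlim.comp hψ'.tendsto_symm
  have hgerm : ψ' ∘ ψ.symm =ᶠ[𝓝 0] Φ := by
    filter_upwards [ψ.open_target.mem_nhds hψ.zero_mem_target,
      hψ.tendsto_symm.eventually (ψ'.open_source.eventually_mem hψ'.mem_source)] with y hy hys
    rw [Function.comp_apply, hψΦ _ hys, Function.comp_apply, ψ.right_inv hy]
  -- The Jacobian of `Φ` is prescribed on the leaves in the old coordinates; the change of charts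
  -- carries leaves of the new coordinates to these, up to a permutation.
  filter_upwards [eventually_mem_stdCompl hσ' h00, hlim'.eventually hdet,
    hlim'.eventually hgerm.eventuallyEq_nhds, hlim'.eventually hd,
    ψ'.open_target.mem_nhds hψ'.zero_mem_target,
    hψ'.tendsto_symm.eventually (ψ.open_source.eventually_mem hψ.mem_source)]
    with z hz hzdet hzΦ hzd hzt hzs i hi
  have hback : ψ.symm ((ψ ∘ ψ'.symm) z) = ψ'.symm z := ψ.left_inv hzs
  have h1 := density_change (Ω := Ω.toFun) hψ.mem_atlas hψ'.mem_atlas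
    (y := (ψ ∘ ψ'.symm) z) (ψ.map_source hzs) (by rw [hback]; exact ψ'.map_target hzt)
  rw [Function.comp_apply (f := ψ'), hback, ψ'.right_inv hzt, hzΦ.fderiv_eq,
    hzdet _ (hz i hi)] at h1
  exact mul_right_cancel₀ hzd.2 (by rw [← h1, one_mul])

end AdaptedCharts

/-! ### Equivalence of divergence-free web-germs -/

section Equivalence

variable {n : ℕ} {c : Fin n → ℕ} {M : Type*} [TopologicalSpace M] [ChartedSpace (Space c) M]

theorem tangent_congr (W : RegularWeb c M) {x x' : M} (h : x = x') {i : Fin n} {v : Space c} :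
    v ∈ W.tangent i x ↔ v ∈ W.tangent i x' := by
  subst h
  rfl

theorem webEquiv_refl (W : RegularWeb c M) {p : M} (Ω : VolumeForm c p) : WebEquiv W Ω Ω := by
  refine ⟨OpenPartialHomeomorph.refl M, mem_univ _, rfl, contMDiffOn_id, contMDiffOn_id,
    ⟨1, Eventually.of_forall fun x i => ?_⟩, Eventually.of_forall fun x => ?_⟩
  · change (W.tangent i x).map (mfderiv 𝓘(ℝ, Space c) 𝓘(ℝ, Space c) id x).toLinearMap = _
    rw [mfderiv_id]
    exact Submodule.map_id _
  · change (Ω.toFun x).compLinearMap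
      (mfderiv 𝓘(ℝ, Space c) 𝓘(ℝ, Space c) id x).toLinearMap = _
    rw [mfderiv_id]
    rfl

theorem webEquiv_symm {W : RegularWeb c M} {p : M} {Ω Ω' : VolumeForm c p}
    (h : WebEquiv W Ω Ω') : WebEquiv W Ω' Ω := by
  obtain ⟨φ, hp, hφp, hφ, hφ', ⟨σ, hσ⟩, hΩ⟩ := h
  have hd : φ.MDifferentiable 𝓘(ℝ, Space c) 𝓘(ℝ, Space c) :=
    ⟨hφ.mdifferentiableOn (by simp), hφ'.mdifferentiableOn (by simp)⟩
  have hp' : p ∈ φ.target := by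
    have := φ.map_source hp
    rwa [hφp] at this
  have hφp' : φ.symm p = p := by
    have := φ.left_inv hp
    rwa [hφp] at this
  have hlim : Tendsto φ.symm (𝓝 p) (𝓝 p) := by
    have := (φ.continuousAt_symm hp').tendsto
    rwa [hφp'] at this
  have hinv : ∀ x ∈ φ.target, ∀ v : Space c,
      mfderiv 𝓘(ℝ, Space c) 𝓘(ℝ, Space c) φ (φ.symm x)
        (mfderiv 𝓘(ℝ, Space c) 𝓘(ℝ, Space c) φ.symm x v) = v := fun x hx v =>
    congrArg (fun f : Space c →L[ℝ] Space c => f v) (hd.comp_symm_deriv hx)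
  refine ⟨φ.symm, hp', hφp', hφ', hφ, ⟨σ.symm, ?_⟩, ?_⟩
  · filter_upwards [hlim.eventually hσ, φ.open_target.mem_nhds hp'] with x hx hxt i
    have hi := hx (σ.symm i)
    rw [σ.apply_symm_apply] at hi
    have hinj := hd.mfderiv_injective (φ.map_target hxt)
    apply le_antisymm
    · rintro _ ⟨w, hw, rfl⟩
      have hw' : (w : Space c) ∈ W.tangent i (φ (φ.symm x)) :=
        (tangent_congr W (φ.right_inv hxt)).2 hw
      rw [← hi] at hw'
      obtain ⟨v, hv, hvw⟩ := hw'
      have : v = mfderiv 𝓘(ℝ, Space c) 𝓘(ℝ, Space c) φ.symm x w :=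
        hinj (hvw.trans (hinv x hxt w).symm)
      rw [this] at hv
      exact hv
    · intro v hv
      have hw := Submodule.mem_map_of_mem
        (f := (mfderiv 𝓘(ℝ, Space c) 𝓘(ℝ, Space c) φ (φ.symm x)).toLinearMap) hv
      rw [hi] at hw
      have hw' := (tangent_congr W (φ.right_inv hxt)).1 hw
      exact ⟨_, hw', hinj (hinv x hxt _)⟩
  · filter_upwards [hlim.eventually hΩ, φ.open_target.mem_nhds hp'] with x hx hxt
    rw [← hx]
    ext v
    change Ω'.toFun (φ (φ.symm x)) (fun k => mfderiv 𝓘(ℝ, Space c) 𝓘(ℝ, Space c) φ (φ.symm x)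
      (mfderiv 𝓘(ℝ, Space c) 𝓘(ℝ, Space c) φ.symm x (v k))) = Ω'.toFun x v
    refine (congrArg (Ω'.toFun (φ (φ.symm x))) (funext fun k => hinv x hxt (v k))).trans ?_
    exact form_congr Ω'.toFun (φ.right_inv hxt) v

theorem webEquiv_trans {W : RegularWeb c M} {p : M} {Ω Ω' Ω'' : VolumeForm c p}
    (h : WebEquiv W Ω Ω') (h' : WebEquiv W Ω' Ω'') : WebEquiv W Ω Ω'' := by
  obtain ⟨φ, hp, hφp, hφ, hφ', ⟨σ, hσ⟩, hΩ⟩ := h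
  obtain ⟨χ, kp, hχp, hχ, hχ', ⟨ρ, hρ⟩, kΩ⟩ := h'
  have hlim : Tendsto φ (𝓝 p) (𝓝 p) := by
    have := (φ.continuousAt hp).tendsto
    rwa [hφp] at this
  have hmd : ∀ᶠ x in 𝓝 p, mfderiv 𝓘(ℝ, Space c) 𝓘(ℝ, Space c) (φ.trans χ) x =
      (mfderiv 𝓘(ℝ, Space c) 𝓘(ℝ, Space c) χ (φ x)).comp
        (mfderiv 𝓘(ℝ, Space c) 𝓘(ℝ, Space c) φ x) := by
    filter_upwards [φ.open_source.eventually_mem hp,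
      hlim.eventually (χ.open_source.eventually_mem kp)] with x hx hx'
    exact mfderiv_comp x
      (((hχ.contMDiffAt (χ.open_source.mem_nhds hx'))).mdifferentiableAt (by simp))
      (((hφ.contMDiffAt (φ.open_source.mem_nhds hx))).mdifferentiableAt (by simp))
  refine ⟨φ.trans χ, ⟨hp, ?_⟩, ?_, ?_, ?_, ⟨σ.trans ρ, ?_⟩, ?_⟩
  · change φ p ∈ χ.source
    rwa [hφp]
  · change χ (φ p) = p
    rw [hφp, hχp]
  · rw [OpenPartialHomeomorph.trans_source]
    exact hχ.comp (hφ.mono inter_subset_left) fun x hx => hx.2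
  · rw [OpenPartialHomeomorph.trans_target]
    exact hφ'.comp (hχ'.mono inter_subset_left) fun x hx => hx.2
  · filter_upwards [hmd, hσ, hlim.eventually hρ] with x hx h1 h2 i
    rw [hx]
    refine (Submodule.map_comp (mfderiv 𝓘(ℝ, Space c) 𝓘(ℝ, Space c) φ x).toLinearMap
      (mfderiv 𝓘(ℝ, Space c) 𝓘(ℝ, Space c) χ (φ x)).toLinearMap (W.tangent i x)).trans ?_
    rw [h1, h2]
    rfl
  · filter_upwards [hmd, hΩ, hlim.eventually kΩ] with x hx h1 h2
    rw [hx, ← h1, ← h2]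
    rfl

theorem webEquiv_equivalence (W : RegularWeb c M) (p : M) : Equivalence (WebEquiv W (p := p)) :=
  ⟨webEquiv_refl W, webEquiv_symm, webEquiv_trans⟩

/-- The equivalence is `ψ'⁻¹ ∘ τ ∘ ψ`, and the equation between densities is the coordinate form of
`φ^* Ω' = Ω`. -/
theorem webEquiv_of_density_eq {W : RegularWeb c M} {p : M} {Ω Ω' : VolumeForm c p}
    {ψ ψ' : OpenPartialHomeomorph M (Space c)} (hψ : IsAdapted W p ψ) (hψ' : IsAdapted W p ψ')
    {τ : OpenPartialHomeomorph (Space c) (Space c)} (hτ : τ ∈ webGroup c)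
    (hdens : ∀ᶠ y in 𝓝 (0 : Space c), density Ω.toFun ψ y =
      density Ω'.toFun ψ' (τ y) * (fderiv ℝ τ y).det) : WebEquiv W Ω Ω' := by
  obtain ⟨h0, h00, hs, hs', ⟨σ, hσ⟩, -⟩ := mem_webGroup_iff.1 hτ
  obtain ⟨σ₁, h₁⟩ := hψ.straight
  obtain ⟨σ₂, h₂⟩ := hψ'.straight
  have hlimψ : Tendsto ψ (𝓝 p) (𝓝 0) := by
    have := (ψ.continuousAt hψ.mem_source).tendsto
    rwa [hψ.map_point] at this
  let φ : OpenPartialHomeomorph M M := ψ.trans (τ.trans ψ'.symm)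
  have hφp : φ p = p := by
    change ψ'.symm (τ (ψ p)) = p
    rw [hψ.map_point, h00, hψ'.symm_zero]
  have hps : p ∈ φ.source := by
    refine ⟨hψ.mem_source, ?_, ?_⟩
    · change ψ p ∈ τ.source
      rwa [hψ.map_point]
    · change τ (ψ p) ∈ ψ'.target
      rw [hψ.map_point, h00]
      exact hψ'.zero_mem_target
  have hφ : ContMDiffOn 𝓘(ℝ, Space c) 𝓘(ℝ, Space c) ∞ φ φ.source := fun x hx => by
    refine ContMDiffAt.contMDiffWithinAt ?_
    have h1 := contMDiffAt_of_mem_maximalAtlas hψ.mem_atlas hx.1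
    have h2 := (hs.contDiffAt (τ.open_source.mem_nhds hx.2.1)).contMDiffAt
    have h3 := contMDiffAt_symm_of_mem_maximalAtlas hψ'.mem_atlas hx.2.2
    exact ContMDiffAt.comp (g := ψ'.symm) (f := τ ∘ ψ) x h3 (h2.comp x h1)
  have hφ' : ContMDiffOn 𝓘(ℝ, Space c) 𝓘(ℝ, Space c) ∞ φ.symm φ.target := fun x hx => by
    refine ContMDiffAt.contMDiffWithinAt ?_
    have hx1 : x ∈ ψ'.source := hx.1.1
    have hx2 : ψ' x ∈ τ.target := hx.1.2
    have hx3 : τ.symm (ψ' x) ∈ ψ.target := hx.2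
    have h1 := contMDiffAt_of_mem_maximalAtlas hψ'.mem_atlas hx1
    have h2 := (hs'.contDiffAt (τ.open_target.mem_nhds hx2)).contMDiffAt
    have h3 := contMDiffAt_symm_of_mem_maximalAtlas hψ.mem_atlas hx3
    exact ContMDiffAt.comp (g := ψ.symm) (f := τ.symm ∘ ψ') x h3 (h2.comp x h1)
  have hd : φ.MDifferentiable 𝓘(ℝ, Space c) 𝓘(ℝ, Space c) :=
    ⟨hφ.mdifferentiableOn (by simp), hφ'.mdifferentiableOn (by simp)⟩
  have hφs : ∀ x ∈ φ.source, φ x ∈ ψ'.source := fun x hx => ψ'.map_target hx.2.2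
  have hψφ : ∀ x ∈ φ.source, ψ' (φ x) = τ (ψ x) := fun x hx => ψ'.right_inv hx.2.2
  have hchain : ∀ x ∈ φ.source, ∀ v : TangentSpace 𝓘(ℝ, Space c) x,
      mfderiv 𝓘(ℝ, Space c) 𝓘(ℝ, Space c) ψ' (φ x)
        (mfderiv 𝓘(ℝ, Space c) 𝓘(ℝ, Space c) φ x v) =
      fderiv ℝ τ (ψ x) (mfderiv 𝓘(ℝ, Space c) 𝓘(ℝ, Space c) ψ x v) := by
    intro x hx v
    have e1 : mfderiv 𝓘(ℝ, Space c) 𝓘(ℝ, Space c) (ψ' ∘ φ) x = _ :=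
      mfderiv_comp x ((mdifferentiable_of_mem_maximalAtlas hψ'.mem_atlas).mdifferentiableAt
        (hφs x hx)) (hd.mdifferentiableAt hx)
    have e2 : mfderiv 𝓘(ℝ, Space c) 𝓘(ℝ, Space c) (τ ∘ ψ) x = _ :=
      mfderiv_comp (I' := 𝓘(ℝ, Space c)) x ((hs.contDiffAt (τ.open_source.mem_nhds
        hx.2.1)).differentiableAt (by simp)).mdifferentiableAt
        ((mdifferentiable_of_mem_maximalAtlas hψ.mem_atlas).mdifferentiableAt hx.1)
    have e3 : ψ' ∘ φ =ᶠ[𝓝 x] τ ∘ ψ :=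
      (φ.open_source.eventually_mem hx).mono hψφ
    have e4 := e3.mfderiv_eq (I := 𝓘(ℝ, Space c)) (I' := 𝓘(ℝ, Space c))
    have e5 := congrArg (fun L : Space c →L[ℝ] Space c => L v) (e1.symm.trans (e4.trans e2))
    rw [mfderiv_eq_fderiv] at e5
    exact e5
  refine ⟨φ, hps, hφp, hφ, hφ', ⟨σ₁.symm.trans (σ.trans σ₂), ?_⟩, ?_⟩
  · filter_upwards [φ.open_source.eventually_mem hps, hlimψ.eventually hσ] with x hx hxσ i
    obtain ⟨j, rfl⟩ := σ₁.surjective i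
    have hj := h₂ (φ x) (hφs x hx) (σ j)
    have hj' := h₁ x hx.1 j
    simp only [Equiv.trans_apply, Equiv.symm_apply_apply]
    rw [hj, hj']
    apply le_antisymm
    · rintro _ ⟨v, hv, rfl⟩
      change mfderiv 𝓘(ℝ, Space c) 𝓘(ℝ, Space c) ψ' (φ x)
        (mfderiv 𝓘(ℝ, Space c) 𝓘(ℝ, Space c) φ x v) ∈ stdTangent c (σ j)
      rw [hchain x hx]
      exact hxσ.mem_stdTangent hv
    · intro w hw
      have hw' : mfderiv 𝓘(ℝ, Space c) 𝓘(ℝ, Space c) ψ' (φ x) w ∈ stdTangent c (σ j) := hw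
      rw [← hxσ.map_tangent] at hw'
      obtain ⟨u, hu, huw⟩ := hw'
      obtain ⟨v, rfl⟩ := (mdifferentiable_of_mem_maximalAtlas
        hψ.mem_atlas).mfderiv_surjective hx.1 u
      exact ⟨v, hu, (mdifferentiable_of_mem_maximalAtlas hψ'.mem_atlas).mfderiv_injective
        (hφs x hx) ((hchain x hx v).trans huw)⟩
  · have hgerm : ∀ x ∈ φ.source, ψ' ∘ φ ∘ ψ.symm =ᶠ[𝓝 (ψ x)] τ := by
      intro x hx
      have hc : ContinuousAt ψ.symm (ψ x) := ψ.continuousAt_symm (ψ.map_source hx.1)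
      have hm : ∀ᶠ y in 𝓝 (ψ.symm (ψ x)), y ∈ φ.source := by
        rw [ψ.left_inv hx.1]
        exact φ.open_source.eventually_mem hx
      filter_upwards [hc.eventually hm, ψ.open_target.eventually_mem (ψ.map_source hx.1)]
        with y hy hyt
      rw [Function.comp_apply, Function.comp_apply, hψφ _ hy, ψ.right_inv hyt]
    filter_upwards [φ.open_source.eventually_mem hps, hlimψ.eventually hdens] with x hx hxd
    refine form_eq_of_density_eq (Ω := fun x => (Ω'.toFun (φ x)).compLinearMap
      (mfderiv 𝓘(ℝ, Space c) 𝓘(ℝ, Space c) φ x).toLinearMap) (ψ := ψ) hψ.mem_atlas hx.1 ?_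
    have hb : ψ.symm (ψ x) = x := ψ.left_inv hx.1
    rw [hxd, density_transition (θ := φ) (Ω' := Ω'.toFun) hψ.mem_atlas hψ'.mem_atlas
      (ψ.map_source hx.1) (by rw [hb]; exact hd.mdifferentiableAt hx)
      (by rw [hb]; exact hφs x hx) rfl, (hgerm x hx).fderiv_eq, (hgerm x hx).eq_of_nhds]

variable [IsManifold 𝓘(ℝ, Space c) ∞ M]

/-! ### The correspondence between web-germs and orbits -/

/-- The logarithm of the density is a potential, so the identities are those of a mixed Hessian. -/
theorem IsNormalized.exists_nonuniformityTensor {W : RegularWeb c M} {p : M} {Ω : VolumeForm c p}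
    {ψ : OpenPartialHomeomorph M (Space c)} (hψ : IsNormalized W Ω ψ) :
    ∃ A : NonuniformityTensor c, A.toFun =ᶠ[𝓝 0] coordNonuniformity W Ω.toFun ψ :=
  ⟨NonuniformityTensor.ofPotential (fun y => Real.log (density Ω.toFun ψ y))
    ((hψ.1.eventually_density Ω).mono fun _ hy => hy.1.log hy.2),
    (hψ.1.coordNonuniformity_eq Ω).symm⟩

/-- The coordinate expression `ψ' ∘ φ ∘ ψ⁻¹` preserves the web. It relates two densities that are
both `1` on the leaves, so its Jacobian is `1` there and it belongs to `𝔊_W`. With `Ω = Ω'` and the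
identity equivalence this is independence of the normalized chart. -/
theorem sameOrbit_of_webEquiv {W : RegularWeb c M} {p : M} {Ω Ω' : VolumeForm c p}
    (h : WebEquiv W Ω Ω') {ψ ψ' : OpenPartialHomeomorph M (Space c)}
    (hψ : IsNormalized W Ω ψ) (hψ' : IsNormalized W Ω' ψ') {A A' : NonuniformityTensor c}
    (hA : A.toFun =ᶠ[𝓝 0] coordNonuniformity W Ω.toFun ψ)
    (hA' : A'.toFun =ᶠ[𝓝 0] coordNonuniformity W Ω'.toFun ψ') : SameOrbit A A' := by
  obtain ⟨φ, hp, hφp, hφ, hφ', ⟨ρ, hρ⟩, hΩ⟩ := h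
  obtain ⟨hψa, hψn⟩ := isNormalized_iff.1 hψ
  obtain ⟨hψa', hψn'⟩ := isNormalized_iff.1 hψ'
  have hd : φ.MDifferentiable 𝓘(ℝ, Space c) 𝓘(ℝ, Space c) :=
    ⟨hφ.mdifferentiableOn (by simp), hφ'.mdifferentiableOn (by simp)⟩
  have hφ0 : φ (ψ.symm 0) = p := by rw [hψa.symm_zero, hφp]
  have hlimφ : Tendsto φ (𝓝 p) (𝓝 p) := by
    have := (φ.continuousAt hp).tendsto
    rwa [hφp] at this
  let τ : OpenPartialHomeomorph (Space c) (Space c) := ψ.symm.trans (φ.trans ψ')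
  have hτ0 : τ 0 = 0 := by
    change ψ' (φ (ψ.symm 0)) = 0
    rw [hφ0, hψa'.map_point]
  have hτs : (0 : Space c) ∈ τ.source := by
    refine ⟨hψa.zero_mem_target, ?_, ?_⟩
    · change ψ.symm 0 ∈ φ.source
      rwa [hψa.symm_zero]
    · change φ (ψ.symm 0) ∈ ψ'.source
      rw [hφ0]
      exact hψa'.mem_source
  have hsmooth : ContDiffOn ℝ ∞ τ τ.source := fun y hy => by
    refine ContDiffAt.contDiffWithinAt (contDiffAt_transition hψa.mem_atlas hψa'.mem_atlas hy.1
      (hφ.contMDiffAt (φ.open_source.mem_nhds hy.2.1)) hy.2.2)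
  have hsmooth' : ContDiffOn ℝ ∞ τ.symm τ.target := fun y hy => by
    have hy1 : y ∈ ψ'.target := hy.1.1
    have hy2 : ψ'.symm y ∈ φ.target := hy.1.2
    have hy3 : φ.symm (ψ'.symm y) ∈ ψ.source := hy.2
    exact ContDiffAt.contDiffWithinAt (contDiffAt_transition hψa'.mem_atlas hψa.mem_atlas hy1
      (hφ'.contMDiffAt (φ.open_target.mem_nhds hy2)) hy3)
  obtain ⟨σ, hσ⟩ := hψa.isWebMapAt_transition hψa' (θ := φ) (ρ := ρ) hψa.zero_mem_target
    (by rw [hφ0]; exact hψa'.mem_source) (by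
      rw [hψa.symm_zero]
      filter_upwards [hρ, φ.open_source.eventually_mem hp] with z hz hzs
      exact ⟨hφ.contMDiffAt (φ.open_source.mem_nhds hzs), hd.mfderiv_injective hzs, hz⟩)
  have hlim : Tendsto τ (𝓝 0) (𝓝 0) := by
    have := (τ.continuousAt hτs).tendsto
    rwa [hτ0] at this
  have hdens : ∀ᶠ y in 𝓝 (0 : Space c), density Ω.toFun ψ y =
      density Ω'.toFun ψ' (τ y) * (fderiv ℝ τ y).det := by
    filter_upwards [τ.open_source.eventually_mem hτs, hψa.tendsto_symm.eventually hΩ] with y hy hyΩ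
    exact density_transition (θ := φ) hψa.mem_atlas hψa'.mem_atlas hy.1
      (hd.mdifferentiableAt hy.2.1) hy.2.2 hyΩ
  have hτ : τ ∈ webGroup c := by
    refine mem_webGroup_iff.2 ⟨hτs, hτ0, hsmooth, hsmooth', ⟨σ, hσ⟩, ?_⟩
    filter_upwards [hdens, hψn, hlim.eventually hψn', eventually_mem_stdCompl hσ hτ0]
      with y hy h1 h2 hmem i hi
    rw [h1 i hi, h2 _ (hmem i hi), one_mul] at hy
    exact hy.symm
  refine ⟨τ, hτ, hA.trans (EventuallyEq.trans ?_ (pullback_congr hlim hA'.symm))⟩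
  refine (hψa.coordNonuniformity_eq Ω).trans (EventuallyEq.trans ?_
    (pullback_congr hlim (hψa'.coordNonuniformity_eq Ω').symm))
  filter_upwards [hσ.eventually_nhds, hdens.eventually_nhds,
    hlim.eventually (hψa'.eventually_density Ω').eventually_nhds] with y hy1 hy2 hy3
  exact mixedLogHessian_transform hy1 hy3 hy2

theorem eq_of_log_eq_log {a b : ℝ} (ha : 0 < a) (hb : 0 < b) (h : Real.log a - Real.log b = 0) :
    a = b :=
  Real.log_injOn_pos ha hb (sub_eq_zero.1 h)

theorem mixedHess_sub_eq_zero {u v : Space c → ℝ} {y : Space c}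
    (hu : ∀ᶠ z in 𝓝 y, ContDiffAt ℝ ∞ u z) (hv : ∀ᶠ z in 𝓝 y, ContDiffAt ℝ ∞ v z)
    (h : mixedHess c u y = mixedHess c v y) : mixedHess c (fun z => u z - v z) y = 0 := by
  have h1 := mixedHess_add ((hu.and hv).mono fun z hz => hz.1.sub hz.2) hv
  simp only [sub_add_cancel] at h1
  rw [h] at h1
  refine bilinForm_ext fun k l => ?_
  have h2 := congrArg (fun B : LinearMap.BilinForm ℝ (Space c) => B (ex c k) (ex c l)) h1
  simp only [LinearMap.add_apply] at h2
  rw [LinearMap.zero_apply, LinearMap.zero_apply]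
  linarith

/-- For `τ` in the group, the density of `Ω` and that of `Ω'` pulled back by `τ` have logarithms
with the same mixed Hessian, and both densities are `1` on the leaves. By uniqueness of potentials
they agree near `0`, so `τ` induces an equivalence. -/
theorem webEquiv_of_sameOrbit (hm : 0 < ∑ i, c i) {W : RegularWeb c M} {p : M}
    {Ω Ω' : VolumeForm c p} {ψ ψ' : OpenPartialHomeomorph M (Space c)}
    (hψ : IsNormalized W Ω ψ) (hψ' : IsNormalized W Ω' ψ') {A A' : NonuniformityTensor c}
    (hA : A.toFun =ᶠ[𝓝 0] coordNonuniformity W Ω.toFun ψ)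
    (hA' : A'.toFun =ᶠ[𝓝 0] coordNonuniformity W Ω'.toFun ψ') (h : SameOrbit A A') :
    WebEquiv W Ω Ω' := by
  obtain ⟨hψa, hψn⟩ := isNormalized_iff.1 hψ
  obtain ⟨hψa', hψn'⟩ := isNormalized_iff.1 hψ'
  obtain ⟨τ, hτ, hAτ⟩ := h
  obtain ⟨h0, h00, hs, hs', ⟨σ, hσ⟩, hdet⟩ := mem_webGroup_iff.1 hτ
  have hlim := tendsto_of_mem_webGroup hτ
  refine webEquiv_of_density_eq hψa hψa' hτ ?_
  let h₁ : Space c → ℝ := density Ω.toFun ψ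
  let h₂ : Space c → ℝ := fun y => density Ω'.toFun ψ' (τ y) * (fderiv ℝ τ y).det
  have hs₁ : ∀ᶠ y in 𝓝 (0 : Space c), ContDiffAt ℝ ∞ h₁ y ∧ h₁ y ≠ 0 := hψa.eventually_density Ω
  have hs₂ : ∀ᶠ y in 𝓝 (0 : Space c), ContDiffAt ℝ ∞ h₂ y ∧ h₂ y ≠ 0 := by
    filter_upwards [hσ, hlim.eventually (hψa'.eventually_density Ω')] with y hy hy'
    exact ⟨(ContDiffAt.comp (g := density Ω'.toFun ψ') y hy'.1 hy.smooth).mul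
      (contDiffAt_det_fderiv hy.smooth), mul_ne_zero hy'.2 hy.det_ne⟩
  have hn₂ : ∀ᶠ y in 𝓝 (0 : Space c), ∀ i, y ∈ stdCompl c i → h₂ y = 1 := by
    filter_upwards [hdet, hlim.eventually hψn', eventually_mem_stdCompl hσ h00]
      with y hy hy' hmem i hi
    simp only [h₂]
    rw [hy i hi, hy' _ (hmem i hi), one_mul]
  have hlog₁ : ∀ᶠ y in 𝓝 (0 : Space c), ContDiffAt ℝ ∞ (fun y => Real.log (h₁ y)) y :=
    hs₁.mono fun y hy => hy.1.log hy.2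
  have hlog₂ : ∀ᶠ y in 𝓝 (0 : Space c), ContDiffAt ℝ ∞ (fun y => Real.log (h₂ y)) y :=
    hs₂.mono fun y hy => hy.1.log hy.2
  have hK : mixedLogHessian c h₁ =ᶠ[𝓝 0] mixedLogHessian c h₂ := by
    have e1 : A.toFun =ᶠ[𝓝 0] pullback τ (mixedLogHessian c (density Ω'.toFun ψ')) :=
      hAτ.trans (pullback_congr hlim (hA'.trans (hψa'.coordNonuniformity_eq Ω')))
    refine ((hA.trans (hψa.coordNonuniformity_eq Ω)).symm.trans e1).trans ?_
    filter_upwards [hσ.eventually_nhds,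
      hlim.eventually (hψa'.eventually_density Ω').eventually_nhds] with y hy1 hy2
    exact (mixedLogHessian_transform hy1 hy2 (EventuallyEq.refl _ _)).symm
  have hw := eventually_eq_zero_of_mixedHess_eq_zero hm
    (w := fun y => Real.log (h₁ y) - Real.log (h₂ y))
    (by
      filter_upwards [hlog₁, hlog₂] with y hy1 hy2
      exact hy1.sub hy2)
    (by
      filter_upwards [hlog₁.eventually_nhds, hlog₂.eventually_nhds, hK] with y hy1 hy2 hy
      exact mixedHess_sub_eq_zero hy1 hy2 hy)
    (by
      filter_upwards [hψn, hn₂] with y hy1 hy2 i hi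
      rw [hy2 i hi]
      simp only [h₁]
      rw [hy1 i hi, sub_self])
  -- The logarithm forgets signs; the value `1` at the origin shows that both densities are positive
  -- near it.
  have hpos₁ : ∀ᶠ y in 𝓝 (0 : Space c), 0 < h₁ y := by
    refine hs₁.self_of_nhds.1.continuousAt.eventually_const_lt ?_
    have : h₁ 0 = 1 := hψn.self_of_nhds (block c ⟨0, hm⟩) (Submodule.zero_mem _)
    rw [this]
    exact one_pos
  have hpos₂ : ∀ᶠ y in 𝓝 (0 : Space c), 0 < h₂ y := by
    refine hs₂.self_of_nhds.1.continuousAt.eventually_const_lt ?_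
    rw [hn₂.self_of_nhds (block c ⟨0, hm⟩) (Submodule.zero_mem _)]
    exact one_pos
  filter_upwards [hw, hpos₁, hpos₂] with y hy hy1 hy2
  exact eq_of_log_eq_log hy1 hy2 hy

/-- In any adapted chart take the form with density `exp u`, where `u` is a potential of `A`
vanishing on the leaves. The chart is then already normalized and the log-density is `u`. -/
theorem exists_volumeForm (W : RegularWeb c M) (p : M) (A : NonuniformityTensor c) :
    ∃ (Ω : VolumeForm c p) (ψ : OpenPartialHomeomorph M (Space c)), IsNormalized W Ω ψ ∧
      A.toFun =ᶠ[𝓝 0] coordNonuniformity W Ω.toFun ψ := by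
  obtain ⟨u, hu, hAu, hu0⟩ := A.exists_potential
  obtain ⟨ψ, hψ⟩ := exists_isAdapted W p
  let F : ∀ x : M, TangentSpace 𝓘(ℝ, Space c) x [⋀^Fin (∑ i, c i)]→ₗ[ℝ] ℝ := fun x =>
    (Real.exp (u (ψ x)) • unitVol c).compLinearMap
      (mfderiv 𝓘(ℝ, Space c) 𝓘(ℝ, Space c) ψ x).toLinearMap
  have hF : ∀ y ∈ ψ.target, density F ψ y = Real.exp (u y) := by
    intro y hy
    change Real.exp (u (ψ (ψ.symm y))) • unitVol c (fun k =>
      mfderiv 𝓘(ℝ, Space c) 𝓘(ℝ, Space c) ψ (ψ.symm y)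
        (mfderiv 𝓘(ℝ, Space c) 𝓘(ℝ, Space c) ψ.symm y (ex c k))) = _
    rw [ψ.right_inv hy]
    refine (congrArg (fun v => Real.exp (u y) • unitVol c v)
      (funext fun k => mfderiv_mfderiv_symm hψ.mem_atlas hy (ex c k))).trans ?_
    exact (congrArg (fun r => Real.exp (u y) • r) unitVol_ex).trans (mul_one _)
  let e := chartAt (Space c) p
  have he : e ∈ IsManifold.maximalAtlas 𝓘(ℝ, Space c) ∞ M := IsManifold.chart_mem_maximalAtlas p
  have hp : p ∈ e.source := mem_chart_source _ p
  have hlim : Tendsto e.symm (𝓝 (e p)) (𝓝 p) := by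
    simpa [e.left_inv hp] using (e.continuousAt_symm (e.map_source hp)).tendsto
  have hsmooth : ∀ᶠ y in 𝓝 (e p), ContDiffAt ℝ ∞ (density F e) y := by
    have hev := (e.open_target.eventually_mem (e.map_source hp)).and
      (hlim.eventually (ψ.open_source.eventually_mem hψ.mem_source))
    filter_upwards [hev.eventually_nhds] with y hy
    have hτ : ContDiffAt ℝ ∞ (ψ ∘ e.symm) y :=
      contDiffAt_transition (θ := id) he hψ.mem_atlas hy.self_of_nhds.1 contMDiffAt_id
        hy.self_of_nhds.2
    have heq : density F e =ᶠ[𝓝 y] fun z =>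
        Real.exp (u ((ψ ∘ e.symm) z)) * (fderiv ℝ (ψ ∘ e.symm) z).det := by
      filter_upwards [hy] with z hz
      rw [density_change he hψ.mem_atlas hz.1 hz.2]
      exact congrArg (· * _) (hF _ (ψ.map_source hz.2))
    exact ((hu.contDiffAt.comp y hτ).exp.mul (contDiffAt_det_fderiv hτ)).congr_of_eventuallyEq heq
  have hne : ∀ᶠ x in 𝓝 p, F x ≠ 0 := by
    filter_upwards [ψ.open_source.eventually_mem hψ.mem_source] with x hx h0
    have h1 := hF _ (ψ.map_source hx)
    have h2 : density F ψ (ψ x) = 0 := by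
      rw [density_apply]
      refine (form_congr F (ψ.left_inv hx) _).trans ?_
      rw [h0]
      rfl
    rw [h2] at h1
    exact (Real.exp_pos _).ne h1
  have hdens : ∀ᶠ y in 𝓝 (0 : Space c), density F ψ y = Real.exp (u y) :=
    (ψ.open_target.eventually_mem hψ.zero_mem_target).mono hF
  refine ⟨⟨F, hsmooth, hne⟩, ψ, isNormalized_iff.2 ⟨hψ, ?_⟩, ?_⟩
  · filter_upwards [hdens, hu0] with y hy hy0 i hi
    rw [hy, hy0 i hi, Real.exp_zero]
  · refine (hAu.trans ?_).trans (hψ.coordNonuniformity_eq ⟨F, hsmooth, hne⟩).symm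
    filter_upwards [hdens.eventually_nhds] with y hy
    rw [mixedLogHessian_eq]
    refine mixedHess_congr (hy.mono fun z hz => ?_)
    change u z = Real.log (density F ψ z)
    rw [hz, Real.log_exp]

theorem exists_orbit_correspondence (hm : 0 < ∑ i, c i) (W : RegularWeb c M) (p : M) :
    ∃ Φ : Quot (WebEquiv W (p := p)) → Quot (SameOrbit (c := c)),
      Function.Bijective Φ ∧
      ∀ (Ω : VolumeForm c p) (ψ : OpenPartialHomeomorph M (Space c))
        (A : NonuniformityTensor c), IsNormalized W Ω ψ →
          A.toFun =ᶠ[𝓝 0] coordNonuniformity W Ω.toFun ψ →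
            Φ (Quot.mk _ Ω) = Quot.mk _ A := by
  choose ψ hψ using fun Ω : VolumeForm c p => exists_isNormalized hm W Ω
  choose A hA using fun Ω : VolumeForm c p => (hψ Ω).exists_nonuniformityTensor
  -- Equality in `Quot` yields only the generated equivalence relation, which is `SameOrbit` itself
  -- by `sameOrbit_equivalence`.
  have hexact : ∀ {A B : NonuniformityTensor c}, Quot.mk SameOrbit A = Quot.mk SameOrbit B →
      SameOrbit A B := fun h => sameOrbit_equivalence.eqvGen_iff.1 (Quot.eqvGen_exact h)
  refine ⟨Quot.lift (fun Ω => Quot.mk _ (A Ω)) fun Ω Ω' h =>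
    Quot.sound (sameOrbit_of_webEquiv h (hψ Ω) (hψ Ω') (hA Ω) (hA Ω')), ⟨?_, ?_⟩, ?_⟩
  · rintro ⟨Ω⟩ ⟨Ω'⟩ h
    exact Quot.sound (webEquiv_of_sameOrbit hm (hψ Ω) (hψ Ω') (hA Ω) (hA Ω') (hexact h))
  · rintro ⟨B⟩
    obtain ⟨Ω, χ, hχ, hB⟩ := exists_volumeForm W p B
    exact ⟨Quot.mk _ Ω, Quot.sound (sameOrbit_of_webEquiv (webEquiv_refl W Ω) (hψ Ω) hχ (hA Ω) hB)⟩
  · intro Ω χ B hχ hB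
    exact Quot.sound (sameOrbit_of_webEquiv (webEquiv_refl W Ω) (hψ Ω) hχ (hA Ω) hB)

end Equivalence

end DivFreeWeb

end

theorem mainTheorem4 {n : ℕ} (c : Fin n → ℕ) (hm : 0 < ∑ i, c i)
    {M : Type*} [TopologicalSpace M] [ChartedSpace (DivFreeWeb.Space c) M]
    [IsManifold 𝓘(ℝ, DivFreeWeb.Space c) ∞ M]
    (W : DivFreeWeb.RegularWeb c M) (p : M) :
    -- the germs in `𝔊_W` form a group under composition
    (OpenPartialHomeomorph.refl (DivFreeWeb.Space c) ∈ DivFreeWeb.webGroup c ∧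
      (∀ φ ∈ DivFreeWeb.webGroup c, φ.symm ∈ DivFreeWeb.webGroup c) ∧
      (∀ φ ∈ DivFreeWeb.webGroup c, ∀ χ ∈ DivFreeWeb.webGroup c,
        φ.trans χ ∈ DivFreeWeb.webGroup c)) ∧
    -- which acts by pullback on the tensor germs satisfying the nonuniformity identities
    (∀ φ ∈ DivFreeWeb.webGroup c, ∀ A : DivFreeWeb.NonuniformityTensor c,
      ∃ B : DivFreeWeb.NonuniformityTensor c,
        B.toFun =ᶠ[𝓝 0] DivFreeWeb.pullback φ A.toFun) ∧
    (∀ φ ∈ DivFreeWeb.webGroup c, ∀ χ ∈ DivFreeWeb.webGroup c,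
      ∀ A : DivFreeWeb.NonuniformityTensor c,
        DivFreeWeb.pullback (φ.trans χ) A.toFun =ᶠ[𝓝 0]
          DivFreeWeb.pullback φ (DivFreeWeb.pullback χ A.toFun)) ∧
    -- the orbits, and the classes of divergence-free web-germs, are classes of equivalences
    Equivalence (DivFreeWeb.SameOrbit (c := c)) ∧
    Equivalence (DivFreeWeb.WebEquiv W (p := p)) ∧
    -- normalized coordinates exist, and the tensor in them satisfies the identities
    (∀ Ω : DivFreeWeb.VolumeForm c p, ∃ ψ, DivFreeWeb.IsNormalized W Ω ψ) ∧
    (∀ (Ω : DivFreeWeb.VolumeForm c p) (ψ : OpenPartialHomeomorph M (DivFreeWeb.Space c)),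
      DivFreeWeb.IsNormalized W Ω ψ →
        ∃ A : DivFreeWeb.NonuniformityTensor c,
          A.toFun =ᶠ[𝓝 0] DivFreeWeb.coordNonuniformity W Ω.toFun ψ) ∧
    -- the correspondence is a well-defined bijection between equivalence classes and orbits
    ∃ Φ : Quot (DivFreeWeb.WebEquiv W (p := p)) → Quot (DivFreeWeb.SameOrbit (c := c)),
      Function.Bijective Φ ∧
      ∀ (Ω : DivFreeWeb.VolumeForm c p) (ψ : OpenPartialHomeomorph M (DivFreeWeb.Space c))
        (A : DivFreeWeb.NonuniformityTensor c), DivFreeWeb.IsNormalized W Ω ψ →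
          A.toFun =ᶠ[𝓝 0] DivFreeWeb.coordNonuniformity W Ω.toFun ψ →
            Φ (Quot.mk _ Ω) = Quot.mk _ A := by
  open DivFreeWeb in
  exact ⟨⟨refl_mem_webGroup, fun _ => symm_mem_webGroup, fun _ hφ _ => trans_mem_webGroup hφ⟩,
    fun _ hφ A => exists_pullback_nonuniformityTensor hφ A,
    fun _ hφ _ hχ A => pullback_trans hφ hχ A.toFun,
    sameOrbit_equivalence, webEquiv_equivalence W p, exists_isNormalized hm W,
    fun _ _ hψ => hψ.exists_nonuniformityTensor, exists_orbit_correspondence hm W p⟩
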